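/- Let $p\ge 2$, let $\Omega\subset\mathbb{R}^2$ be a rectangle partitioned into $n_1\times n_2$ equal squares of side $\ell>0$, and place on each square the $p\times p$ tensor grid of Chebyshev nodes $\cos\frac{j\pi}{p-1}$, $0\le j\le p-1$ (scaled to the square). Nodes on a common edge of two squares are shared, and the corners of the squares are dropped. This leaves $N=(p-2)(pn_1n_2+n_1+n_2)$ collocation points. Consider the heat equation $u_t=\Delta u+f$ in $\Omega$, $u=g$ on $\partial\Omega$, with backward Euler in time with step size $h>0$, i.e. $u^{n+1}-h\Delta u^{n+1}=u^n+hf^{n+1}$ in $\Omega$ and $u^{n+1}=g^{n+1}$ on $\partial\Omega$, discretized by the HPS (hierarchical Poincaré–Steklov) method. That is, let $\tau$ be any hierarchical partition of $\Omega$, obtained by repeatedly cutting rectangles along vertical or horizontal grid lines into two until single squares are left. On a single square the equation is collocated at the interior nodes with the second order Chebyshev differentiation matrices, and the resulting matrix $\mathsf A_{i,i}$ is inverted to express the interior values through the right-hand side and the boundary values. A rectangle cut into $\alpha$ (left, or lower) and $\beta$ (right, or upper) is solved by choosing the values at the nodes of the interface such that the spectral normal derivatives computed in $\alpha$ and in $\beta$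 agree there, which means inverting $\mathsf T^\alpha_{3,3}-\mathsf T^\beta_{3,3}$, where $\mathsf T^\alpha,\mathsf T^\beta$ are the discrete Dirichlet-to-Neumann operators and the index $3$ denotes the interface nodes; then $\alpha$ and $\beta$ are solved with these values. Then the following hold for every $p\ge 2$. 1. For all $n_1,n_2,\ell,\tau$ and every step size $h>0$, all matrices inverted by the method are invertible, so the step $\mathsf u^n\mapsto\mathsf u^{n+1}$ is well defined. It is affine, $\mathsf u^{n+1}=\mathsf M\mathsf u^n+\mathsf r$, where $\mathsf r$ depends on $f,g$ but not on $\mathsf u^n$, and where the $N\times N$ matrix $\mathsf M$ does not depend on $f,g$. Every complex eigenvalue $\mu$ of $\mathsf M$ satisfies $|\mu|\le 1$. 2. The scheme is unconditionally Lax–Richtmyer stable: there is a constant $C$ depending only on $p$ such that $\|\mathsf M^k\|_2\le C$ for all $k\ge 0$, all $n_1,n_2,\ell,\tau$ and all $h>0$, where $\|\cdot\|_2$ is the operator norm induced by the Euclidean norm on $\mathbb{R}^N$. -/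

import Mathlib

open Polynomial

noncomputable section

namespace HPS

/-! ### One-dimensional Chebyshev collocation -/

/-- The `p` Chebyshev nodes `cos (jπ / (p - 1))` of `[-1, 1]`, listed from left to right. -/
def node (p j : ℕ) : ℝ := -Real.cos (Real.pi * j / ((p : ℝ) - 1))

/-- The Lagrange cardinal polynomials (of degree at most `p - 1`) of the Chebyshev nodes. -/
def cardinal (p : ℕ) (l : Fin p) : ℝ[X] :=
  Lagrange.basis Finset.univ (fun m : Fin p => node p m) l

/-- First order Chebyshev differentiation matrix on `[-1, 1]`. -/
def diff1 (p k : ℕ) (l : Fin p) : ℝ := (derivative (cardinal p l)).eval (node p k)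

/-- Second order Chebyshev differentiation matrix on `[-1, 1]`. -/
def diff2 (p k : ℕ) (l : Fin p) : ℝ := (derivative (derivative (cardinal p l))).eval (node p k)

/-! ### The composite grid on a rectangle of `n₁ × n₂` equal squares

The node with index `(i, j)`, `i = (p - 1) * e₁ + k₁`, `j = (p - 1) * e₂ + k₂`, `k₁, k₂ ≤ p - 1`,
is the Chebyshev node `(k₁, k₂)` of the square `(e₁, e₂)`.  Nodes on a common edge of two squares
are shared.  It lies on a vertical (horizontal) edge line iff `(p - 1) ∣ i` (iff `(p - 1) ∣ j`);
the corners of the squares are not collocation points. -/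

/-- The collocation points. -/
abbrev Grid (p n₁ n₂ : ℕ) : Type :=
  {x : Fin (n₁ * (p - 1) + 1) × Fin (n₂ * (p - 1) + 1) //
    ¬ ((p - 1) ∣ (x.1 : ℕ) ∧ (p - 1) ∣ (x.2 : ℕ))}

variable {p n₁ n₂ : ℕ}

/-- First index of a grid point. -/
def Grid.i (x : Grid p n₁ n₂) : ℕ := x.1.1

/-- Second index of a grid point. -/
def Grid.j (x : Grid p n₁ n₂) : ℕ := x.1.2

/-- The value of a grid function at the node with index `(i, j)` (zero if that is no grid point;
no such value enters the scheme). -/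
def val (u : Grid p n₁ n₂ → ℝ) (i j : ℕ) : ℝ :=
  if hx : (i < n₁ * (p - 1) + 1 ∧ j < n₂ * (p - 1) + 1) ∧ ¬ ((p - 1) ∣ i ∧ (p - 1) ∣ j) then
    u ⟨(⟨i, hx.1.1⟩, ⟨j, hx.1.2⟩), hx.2⟩
  else 0

/-- Spectral Laplacian at a node `x` interior to one of the squares (of side `ℓ`). -/
def lap (ℓ : ℝ) (u : Grid p n₁ n₂ → ℝ) (x : Grid p n₁ n₂) : ℝ :=
  (2 / ℓ) ^ 2 *
    ((∑ l : Fin p, diff2 p (x.i % (p - 1)) l * val u ((p - 1) * (x.i / (p - 1)) + l) x.j) +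
      ∑ l : Fin p, diff2 p (x.j % (p - 1)) l * val u x.i ((p - 1) * (x.j / (p - 1)) + l))

/-- Spectral `∂/∂x₁` at a node of a vertical edge, computed in the square to its left. -/
def dxLeft (ℓ : ℝ) (u : Grid p n₁ n₂ → ℝ) (x : Grid p n₁ n₂) : ℝ :=
  2 / ℓ * ∑ l : Fin p, diff1 p (p - 1) l * val u (x.i - (p - 1) + l) x.j

/-- Spectral `∂/∂x₁` at a node of a vertical edge, computed in the square to its right. -/
def dxRight (ℓ : ℝ) (u : Grid p n₁ n₂ → ℝ) (x : Grid p n₁ n₂) : ℝ :=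
  2 / ℓ * ∑ l : Fin p, diff1 p 0 l * val u (x.i + l) x.j

/-- Spectral `∂/∂x₂` at a node of a horizontal edge, computed in the square below it. -/
def dyBelow (ℓ : ℝ) (u : Grid p n₁ n₂ → ℝ) (x : Grid p n₁ n₂) : ℝ :=
  2 / ℓ * ∑ l : Fin p, diff1 p (p - 1) l * val u x.i (x.j - (p - 1) + l)

/-- Spectral `∂/∂x₂` at a node of a horizontal edge, computed in the square above it. -/
def dyAbove (ℓ : ℝ) (u : Grid p n₁ n₂ → ℝ) (x : Grid p n₁ n₂) : ℝ :=
  2 / ℓ * ∑ l : Fin p, diff1 p 0 l * val u x.i (x.j + l)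

/-- The collocated operator `I - h Δ` of backward Euler. -/
def euler (ℓ h : ℝ) (u : Grid p n₁ n₂ → ℝ) (x : Grid p n₁ n₂) : ℝ := u x - h * lap ℓ u x

/-! ### Local operators -/

/-- Overwrite the grid function `b` by `c` on the set `J`. -/
def overwrite (J : Grid p n₁ n₂ → Prop) [DecidablePred J] (b : Grid p n₁ n₂ → ℝ)
    (c : {x // J x} → ℝ) (x : Grid p n₁ n₂) : ℝ :=
  if hx : J x then c ⟨x, hx⟩ else b x

/-- The block of an operator on grid functions with rows and columns in `J`. -/
def block (J : Grid p n₁ n₂ → Prop) (A : (Grid p n₁ n₂ → ℝ) → Grid p n₁ n₂ → ℝ) :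
    Matrix {x // J x} {x // J x} ℝ :=
  fun x y => A (Pi.single (y : Grid p n₁ n₂) 1) x

/-- Interior nodes of the square `(a, c)`. -/
abbrev InLeaf (p n₁ n₂ a c : ℕ) (x : Grid p n₁ n₂) : Prop :=
  ((p - 1) * a < x.i ∧ x.i < (p - 1) * (a + 1)) ∧ (p - 1) * c < x.j ∧ x.j < (p - 1) * (c + 1)

/-- Nodes of the vertical segment at `m` between the heights `c` and `d`. -/
abbrev OnX (p n₁ n₂ m c d : ℕ) (x : Grid p n₁ n₂) : Prop :=
  x.i = (p - 1) * m ∧ (p - 1) * c < x.j ∧ x.j < (p - 1) * d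

/-- Nodes of the horizontal segment at height `m` between the abscissae `a` and `b`. -/
abbrev OnY (p n₁ n₂ m a b : ℕ) (x : Grid p n₁ n₂) : Prop :=
  x.j = (p - 1) * m ∧ (p - 1) * a < x.i ∧ x.i < (p - 1) * b

/-- A local solver takes a right-hand side `g` and a grid function `b` carrying boundary data on
the boundary of a subdomain, and overwrites `b` in the interior of the subdomain. -/
abbrev Solver (p n₁ n₂ : ℕ) : Type :=
  (Grid p n₁ n₂ → ℝ) → (Grid p n₁ n₂ → ℝ) → Grid p n₁ n₂ → ℝ

/-- Collocation on the square `(a, c)`: `u_i = A_ii⁻¹ (g_i - A_ib u_b)`. -/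
def leafSolve (ℓ h : ℝ) (a c : ℕ) : Solver p n₁ n₂ := fun g b =>
  overwrite (InLeaf p n₁ n₂ a c) b
    ((block (InLeaf p n₁ n₂ a c) (euler ℓ h))⁻¹.mulVec fun x =>
      g x - euler ℓ h (overwrite (InLeaf p n₁ n₂ a c) b 0) x)

/-- The matrix `Tα₃₃ - Tβ₃₃` on the interface `J` of two subdomains with solvers `Sα`, `Sβ` and
one-sided fluxes `Fα`, `Fβ`: the Dirichlet-to-Neumann operator `Tα` maps boundary data to the
flux `Fα` of the local solution with zero right-hand side, and likewise for `β`. -/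
def mergeMatrix (J : Grid p n₁ n₂ → Prop) (Fα Fβ : (Grid p n₁ n₂ → ℝ) → Grid p n₁ n₂ → ℝ)
    (Sα Sβ : Solver p n₁ n₂) : Matrix {x // J x} {x // J x} ℝ :=
  block J (fun b => Fα (Sα 0 b)) - block J (fun b => Fβ (Sβ 0 b))

/-- Merge of two subdomains: the interface values
`u₃ = (Tα₃₃ - Tβ₃₃)⁻¹ (Tβ₃₂ u₂ + hβ₃ - Tα₃₁ u₁ - hα₃)`, with `hα`, `hβ` the fluxes of the local
particular solutions, make the two fluxes agree on `J`; then both subdomains are solved. -/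
def mergeSolve (J : Grid p n₁ n₂ → Prop) [DecidablePred J]
    (Fα Fβ : (Grid p n₁ n₂ → ℝ) → Grid p n₁ n₂ → ℝ) (Sα Sβ : Solver p n₁ n₂) :
    Solver p n₁ n₂ := fun g b =>
  Sβ g (Sα g (overwrite J b ((mergeMatrix J Fα Fβ Sα Sβ)⁻¹.mulVec fun x =>
    Fβ (Sβ g (overwrite J b 0)) x - Fα (Sα g (overwrite J b 0)) x)))

/-! ### The hierarchical tree -/

/-- Hierarchical partitions of the rectangle of the squares `(e₁, e₂)`, `a ≤ e₁ < b`, `c ≤ e₂ < d`: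
it is one square, or it is cut vertically or horizontally into two partitioned rectangles. -/
inductive Tree : ℕ → ℕ → ℕ → ℕ → Type
  | leaf (a c : ℕ) : Tree a (a + 1) c (c + 1)
  | splitX {a b c d : ℕ} (m : ℕ) : Tree a m c d → Tree m b c d → Tree a b c d
  | splitY {a b c d : ℕ} (m : ℕ) : Tree a b c m → Tree a b m d → Tree a b c d

/-- The HPS solver of `u - h Δ u = g` with Dirichlet data `b`, built along a tree. -/
def solve (ℓ h : ℝ) : {a b c d : ℕ} → Tree a b c d → Solver p n₁ n₂
  | _, _, _, _, .leaf a c => leafSolve ℓ h a c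
  | _, _, c, d, .splitX m α β =>
      mergeSolve (OnX p n₁ n₂ m c d) (dxLeft ℓ) (dxRight ℓ) (solve ℓ h α) (solve ℓ h β)
  | a, b, _, _, .splitY m α β =>
      mergeSolve (OnY p n₁ n₂ m a b) (dyBelow ℓ) (dyAbove ℓ) (solve ℓ h α) (solve ℓ h β)

/-- Every matrix inverted by the HPS solver is invertible. -/
def WellDefined (p n₁ n₂ : ℕ) (ℓ h : ℝ) : {a b c d : ℕ} → Tree a b c d → Prop
  | _, _, _, _, .leaf a c => IsUnit (block (InLeaf p n₁ n₂ a c) (euler ℓ h)).det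
  | _, _, c, d, .splitX m α β =>
      WellDefined p n₁ n₂ ℓ h α ∧ WellDefined p n₁ n₂ ℓ h β ∧
        IsUnit (mergeMatrix (OnX p n₁ n₂ m c d) (dxLeft ℓ) (dxRight ℓ)
          (solve ℓ h α) (solve ℓ h β)).det
  | a, b, _, _, .splitY m α β =>
      WellDefined p n₁ n₂ ℓ h α ∧ WellDefined p n₁ n₂ ℓ h β ∧
        IsUnit (mergeMatrix (OnY p n₁ n₂ m a b) (dyBelow ℓ) (dyAbove ℓ)
          (solve ℓ h α) (solve ℓ h β)).det

/-- One step of backward Euler HPS for `u_t = Δ u + f`, `u = g` on the boundary, where `f` and `g`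
are the nodal values of the data at the new time: solve `(I - h Δ) u⁺ = u + h f`. -/
def step (ℓ h : ℝ) (τ : Tree 0 n₁ 0 n₂) (f g u : Grid p n₁ n₂ → ℝ) : Grid p n₁ n₂ → ℝ :=
  solve ℓ h τ (u + h • f) g

/-- The matrix of the time-stepping map with `f = g = 0`. -/
def stepMatrix (p : ℕ) {n₁ n₂ : ℕ} (ℓ h : ℝ) (τ : Tree 0 n₁ 0 n₂) :
    Matrix (Grid p n₁ n₂) (Grid p n₁ n₂) ℝ :=
  fun x y => step ℓ h τ 0 0 (Pi.single y 1) x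

end HPS

end

/-! Write `N = p - 1`. Everything rests on a one-dimensional fact (`exists_rows`): on the values at
the interior Chebyshev nodes there is a symmetric positive definite form B, depending only on `N`,
with B(u, u'') ≤ [u u'] between -1 and 1 for all polynomials u of degree at most `N`, whatever their
boundary values.

Summing B ⊗ B over the squares gives an energy. Along each grid line through interior nodes the
boundary terms of neighbouring squares cancel, because values are shared and slopes agree, and they
vanish at the outer ends. So the discrete Laplacian is dissipative and backward Euler never
increases the energy (`energy_le`), whatever `h` and `ℓ`. The energy is equivalent to the sum of
squares over the interior nodes, with constants depending on `p` only. Interface values are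
recovered from `exists_edge_bound`, which bounds u(±1)² by a multiple of [u u'] plus interior
values; the boundary terms cancel once more. This bounds all powers of the step matrix, and hence
its eigenvalues. For zero data the same argument proves uniqueness on every subrectangle
(`Solves.eq_zero`), which makes every matrix inverted along any tree injective.

To find B, use that the interior nodes are the zeros of U_{N-1}. The even derivatives of X U_{N-1}
and of U_{N-1} form a basis in which u ↦ u'' shifts the coordinates by two, while interior nodal
values forget exactly the first two coordinates. The ansatz B(u, u'') = [u u'] - ∑ 2 d_k a_k² then
is a recursion along antidiagonals with zero boundary values. Its solvability condition fixes d_k as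
an alternating convolution of derivatives at 1 (`sum_kypRhs_antidiagonal`).

That d_k ≥ 0 is the hard analytic point. Up to a positive factor, d_k is an odd coefficient of
|G(e^{iπ/4} s)|² with G(z) = ∑ f_a z^a, where f_a is the a-th derivative of the generator at 1. The
identity U_{n+2}' = U_n' + 2(n+2) U_{n+1} yields recursions in n for these coefficients, and
induction gives an explicit lower bound (`derivU_mul_le_sqCoeff`).

Positive definiteness of B follows by a Lyapunov argument (`posDef_of_dissipative`): the Dirichlet
second derivative is strictly dissipative both for B and for the Gram matrix of the weight √(1 -
x²), so the least generalized eigenvalue of B relative to that Gram matrix is positive. -/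

noncomputable section

namespace HPS

/-! ### Derivatives of Chebyshev polynomials at the right end point -/

/-- The `a`-th derivative of the Chebyshev polynomial `U n` at `1`. -/
def derivU (n a : ℕ) : ℝ := (derivative^[a] (Chebyshev.U ℝ n)).eval 1

theorem derivU_zero (n : ℕ) : derivU n 0 = n + 1 := by
  simp [derivU]

/-- The Chebyshev differential equation, differentiated `a` times, loses its leading term at `1`. -/
theorem derivU_succ (n a : ℕ) :
    (2 * a + 3) * derivU n (a + 1) = ((n + 1) ^ 2 - (a + 1) ^ 2) * derivU n a := by
  have h := Chebyshev.iterate_derivative_U_eval_one_recurrence (R := ℝ) (n : ℤ) a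
  push_cast at h
  simpa [derivU] using h

/-- Differentiate U_{n+2} = 2 T_{n+2} + U_n and use T_{n+2}' = (n+2) U_{n+1}. All recursions in `n`
below come from here. -/
theorem derivU_add_two (n a : ℕ) :
    derivU (n + 2) (a + 1) = derivU n (a + 1) + 2 * (n + 2) * derivU (n + 1) a := by
  have h1 := Chebyshev.U_eq_two_mul_T_add_U ℝ (n : ℤ)
  have h2 := Chebyshev.T_derivative_eq_U (R := ℝ) ((n : ℤ) + 2)
  have h3 : derivative (Chebyshev.U ℝ ((n + 2 : ℕ) : ℤ)) =
      derivative (Chebyshev.U ℝ (n : ℤ)) +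
        C (2 * ((n : ℝ) + 2)) * Chebyshev.U ℝ ((n + 1 : ℕ) : ℤ) := by
    push_cast
    rw [h1]
    have h4 : ((n : ℤ) + 2 - 1) = n + 1 := by ring
    rw [h4] at h2
    simp only [derivative_add, derivative_mul, h2, derivative_ofNat]
    push_cast
    simp only [map_mul, map_add, map_ofNat, map_natCast]
    ring
  simp only [derivU, Function.iterate_succ, Function.comp, h3]
  rw [iterate_map_add, Polynomial.iterate_derivative_C_mul]
  simp

theorem derivU_eq_zero {n a : ℕ} (h : n < a) : derivU n a = 0 := by
  obtain ⟨k, rfl⟩ := Nat.exists_eq_add_of_lt h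
  induction k with
  | zero =>
    have := derivU_succ n n
    simp only [sub_self, zero_mul, mul_eq_zero] at this
    rcases this with h | h
    · exfalso; linarith [n.cast_nonneg (α := ℝ)]
    · exact h
  | succ k ih =>
    have h1 := derivU_succ n (n + k + 1)
    rw [ih (by omega), mul_zero, mul_eq_zero] at h1
    rcases h1 with h | h
    · exfalso; linarith [(n + k + 1).cast_nonneg (α := ℝ)]
    · exact h

theorem derivU_pos {n a : ℕ} (h : a ≤ n) : 0 < derivU n a := by
  induction a with
  | zero => rw [derivU_zero]; positivity
  | succ a ih =>
    have h1 := derivU_succ n a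
    have h2 := ih (by omega)
    have h3 : (a : ℝ) + 1 ≤ n := by exact_mod_cast h
    have h4 : 0 < ((n : ℝ) + 1) ^ 2 - (a + 1) ^ 2 := by nlinarith
    have h5 : 0 < (2 * (a : ℝ) + 3) * derivU n (a + 1) := h1 ▸ mul_pos h4 h2
    exact pos_of_mul_pos_right h5 (by positivity)

theorem derivU_nonneg (n a : ℕ) : 0 ≤ derivU n a := by
  rcases le_or_gt a n with h | h
  · exact (derivU_pos h).le
  · rw [derivU_eq_zero h]

/-- By `derivU_succ`, for `a ≤ n` the value `derivU n a` is (n+1+a)!/(n-a)! up to a factor depending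
on `a` only. -/
theorem derivU_adjacent (n a : ℕ) :
    (n + 1 - a) * derivU (n + 1) a = (n + 2 + a) * derivU n a := by
  induction a with
  | zero => simp [derivU_zero]; ring
  | succ a ih =>
    have h1 := derivU_succ n a
    have h2 := derivU_succ (n + 1) a
    have h3 : (2 * (a : ℝ) + 3) ≠ 0 := by positivity
    apply mul_left_cancel₀ h3
    push_cast at *
    linear_combination ((n : ℝ) - a) * h2 - (n + 2 + (a + 1)) * h1 + (n - a) * (n + 3 + a) * ih

/-! ### The squared modulus of the generating polynomial along a ray -/

/-- The Taylor generating polynomial of `U n` at `1` along the ray of direction `c`. -/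
def rayU (c : ℂ) : ℕ → ℂ[X]
  | 0 => 1
  | 1 => 2 + 2 * C c * X
  | n + 2 => rayU c n + 2 + C (2 * ((n : ℂ) + 2) * c) * (X * rayU c (n + 1))

/-- No factorials occur: raising the order of the derivative is then multiplication by `X`, and
`derivU_add_two` becomes the defining recursion. Its summand 2 corrects the constant term, where n +
3 = (n + 1) + 2. -/
theorem coeff_rayU (c : ℂ) (n a : ℕ) : (rayU c n).coeff a = c ^ a * derivU n a := by
  induction n using Nat.twoStepInduction generalizing a with
  | zero =>
    cases a with
    | zero => simp [rayU, derivU_zero]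
    | succ a => simp [rayU, derivU_eq_zero, coeff_one]
  | one =>
    have h1 : (derivU 1 1) = 2 := by
      have := derivU_succ 1 0
      rw [derivU_zero] at this
      norm_num at this; linarith
    match a with
    | 0 => simp [rayU, derivU_zero, mul_assoc]; norm_num
    | 1 => simp [rayU, h1, mul_assoc, coeff_ofNat_succ]; ring
    | a + 2 =>
      rw [derivU_eq_zero (by omega)]
      simp [rayU, mul_assoc, coeff_ofNat_succ]
  | more n ih1 ih2 =>
    rw [rayU]
    cases a with
    | zero => simp [ih1, derivU_zero]; ring
    | succ a =>
      simp only [coeff_add, coeff_C_mul, coeff_X_mul, ih1, ih2, derivU_add_two, coeff_ofNat_succ]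
      push_cast; ring

/-- A primitive eighth root of unity. -/
def zeta8 : ℂ := ⟨√2 / 2, √2 / 2⟩

/-- Its complex conjugate. -/
def zeta8' : ℂ := ⟨√2 / 2, -(√2 / 2)⟩

theorem zeta8_sq : zeta8 ^ 2 = Complex.I := by
  have h : √2 * √2 = (2 : ℝ) := Real.mul_self_sqrt (by norm_num)
  rw [sq]; apply Complex.ext <;> simp [zeta8] ; linarith

theorem zeta8'_sq : zeta8' ^ 2 = -Complex.I := by
  have h : √2 * √2 = (2 : ℝ) := Real.mul_self_sqrt (by norm_num)
  rw [sq]; apply Complex.ext <;> simp [zeta8']; linarith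

theorem zeta8_mul : zeta8 * zeta8' = 1 := by
  have h : √2 * √2 = (2 : ℝ) := Real.mul_self_sqrt (by norm_num)
  apply Complex.ext <;> simp [zeta8, zeta8']
  linarith

theorem abs_re_zeta8_pow (k : ℕ) : |(zeta8 ^ (2 * k + 1) + zeta8' ^ (2 * k + 1)).re| ≤ √2 := by
  have h : √2 / 2 + √2 / 2 = √2 := by ring
  rw [pow_succ, pow_succ, pow_mul, pow_mul, zeta8_sq, zeta8'_sq]
  rcases Nat.even_or_odd' k with ⟨m, rfl | rfl⟩
  · rw [pow_mul, pow_mul]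
    rcases neg_one_pow_eq_or ℂ m with h1 | h1 <;>
    · simp [h1, zeta8, zeta8', h, abs_of_nonneg, Real.sqrt_nonneg, ← abs_neg (-(√2 / 2) + -(√2 / 2))]
      try ring_nf
      try simp [abs_of_nonneg, Real.sqrt_nonneg]
  · rw [pow_succ, pow_succ, pow_mul, pow_mul]
    rcases neg_one_pow_eq_or ℂ m with h1 | h1 <;>
    · simp [h1, zeta8, zeta8']
      try ring_nf
      try simp [abs_of_nonneg, Real.sqrt_nonneg]

/-- Squared modulus of `rayU zeta8 n`. -/
def raySq (n : ℕ) : ℂ[X] := rayU zeta8 n * rayU zeta8' n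

/-- Twice the real part of `z * U (n + 1) * conj (U n)` along the ray. -/
def rayCross (n : ℕ) : ℂ[X] :=
  X * (C zeta8 * (rayU zeta8 (n + 1) * rayU zeta8' n) +
    C zeta8' * (rayU zeta8' (n + 1) * rayU zeta8 n))

/-- Normalized coefficients of `raySq`. -/
def sqCoeff (n a : ℕ) : ℝ := ((raySq n).coeff a).re / √2

/-- Normalized coefficients of `rayCross`. -/
def crossCoeff (n a : ℕ) : ℝ := ((rayCross n).coeff a).re / (2 * √2)

/-- The signs `√2 * cos (a * π / 4)`. -/
def raySign (a : ℕ) : ℝ := (zeta8 ^ a + zeta8' ^ a).re / √2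

theorem abs_raySign {a : ℕ} (h : Odd a) : |raySign a| ≤ 1 := by
  obtain ⟨k, rfl⟩ := h
  rw [raySign, abs_div, abs_of_nonneg (Real.sqrt_nonneg 2), div_le_one (by positivity)]
  exact abs_re_zeta8_pow k

theorem C_zeta8_mul : C zeta8 * C zeta8' = (1 : ℂ[X]) := by rw [← C_mul, zeta8_mul, C_1]

theorem C_zeta8_sq_add : C zeta8 ^ 2 + C zeta8' ^ 2 = (0 : ℂ[X]) := by
  rw [← C_pow, ← C_pow, zeta8_sq, zeta8'_sq, ← C_add]; simp

theorem raySq_add_two (n : ℕ) : raySq (n + 2) = raySq n + 2 * (rayU zeta8 n + rayU zeta8' n) + 4 +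
    C (4 * ((n : ℂ) + 2) ^ 2) * (X ^ 2 * raySq (n + 1)) + C (2 * ((n : ℂ) + 2)) * rayCross n +
    C (4 * ((n : ℂ) + 2)) *
      (X * (C zeta8 * rayU zeta8 (n + 1) + C zeta8' * rayU zeta8' (n + 1))) := by
  have h := C_zeta8_mul
  simp only [raySq, rayCross, rayU, C_mul, map_ofNat, C_pow]
  linear_combination (4 * C ((n : ℂ) + 2) ^ 2 * X ^ 2 * rayU zeta8 (n + 1) *
    rayU zeta8' (n + 1)) * h

/-- Expanding the factor of index `n + 3` would produce `raySq (n + 2)`, but with the factor ζ² +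
ζ̄² = 0. This cancellation is special to the direction of the eighth root of unity and closes the
system of recursions. -/
theorem rayCross_add_two (n : ℕ) : rayCross (n + 2) = rayCross n +
    C (4 * ((n : ℂ) + 2)) * (X ^ 2 * raySq (n + 1)) +
    2 * (X * (C zeta8 * rayU zeta8 (n + 1) + C zeta8' * rayU zeta8' (n + 1))) +
    2 * (X * (C zeta8 * rayU zeta8' (n + 2) + C zeta8' * rayU zeta8 (n + 2))) := by
  have h1 := C_zeta8_mul
  have h2 := C_zeta8_sq_add
  have e1 : ∀ c, rayU c (n + 2 + 1) =
      rayU c (n + 1) + 2 + C (2 * ((n : ℂ) + 1 + 2) * c) * (X * rayU c (n + 2)) := by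
    intro c; rw [rayU]; push_cast; rfl
  have e2 : ∀ c, rayU c (n + 2) =
      rayU c n + 2 + C (2 * ((n : ℂ) + 2) * c) * (X * rayU c (n + 1)) := by
    intro c; rw [rayU]
  simp only [raySq, rayCross, e1]
  have e3 := e2 zeta8
  have e4 := e2 zeta8'
  simp only [C_mul, map_ofNat] at *
  linear_combination (2 * C ((n : ℂ) + 1 + 2) * X ^ 2 * rayU zeta8 (n + 2) *
    rayU zeta8' (n + 2)) * h2 + X * C zeta8 * rayU zeta8 (n + 1) * e4 +
    X * C zeta8' * rayU zeta8' (n + 1) * e3 +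
    4 * X ^ 2 * C ((n : ℂ) + 2) * rayU zeta8 (n + 1) * rayU zeta8' (n + 1) * h1

theorem coeff_linear (n a : ℕ) :
    ((rayU zeta8 n + rayU zeta8' n).coeff a).re = √2 * (raySign a * derivU n a) := by
  have : √2 ≠ 0 := by positivity
  rw [coeff_add, coeff_rayU, coeff_rayU, ← add_mul, Complex.re_mul_ofReal, raySign]
  field_simp

theorem coeff_linear_shift (n a : ℕ) :
    ((C zeta8 * rayU zeta8 n + C zeta8' * rayU zeta8' n).coeff a).re =
      √2 * (raySign (a + 1) * derivU n a) := by
  have : √2 ≠ 0 := by positivity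
  rw [coeff_add, coeff_C_mul, coeff_C_mul, coeff_rayU, coeff_rayU, ← mul_assoc, ← mul_assoc,
    ← add_mul, Complex.re_mul_ofReal, raySign, ← pow_succ', ← pow_succ']
  field_simp

theorem coeff_linear_unshift (n a : ℕ) :
    ((C zeta8 * rayU zeta8' n + C zeta8' * rayU zeta8 n).coeff (a + 1)).re =
      √2 * (raySign a * derivU n (a + 1)) := by
  have : √2 ≠ 0 := by positivity
  have h : zeta8 * zeta8' ^ (a + 1) + zeta8' * zeta8 ^ (a + 1) = zeta8 ^ a + zeta8' ^ a := by
    rw [pow_succ, pow_succ]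
    linear_combination (zeta8' ^ a + zeta8 ^ a) * zeta8_mul
  rw [coeff_add, coeff_C_mul, coeff_C_mul, coeff_rayU, coeff_rayU, ← mul_assoc, ← mul_assoc,
    ← add_mul, Complex.re_mul_ofReal, raySign, h]
  field_simp

theorem sqCoeff_add_two (n a : ℕ) : sqCoeff (n + 2) (a + 2) = sqCoeff n (a + 2) +
    2 * (raySign (a + 2) * derivU n (a + 2)) + 4 * (n + 2) ^ 2 * sqCoeff (n + 1) a +
    4 * (n + 2) * crossCoeff n (a + 2) +
    4 * (n + 2) * (raySign (a + 2) * derivU (n + 1) (a + 1)) := by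
  have h0 : √2 ≠ 0 := by positivity
  have h1 := coeff_linear n (a + 2)
  have h2 := coeff_linear_shift (n + 1) (a + 1)
  have e2 : (2 : ℂ[X]) = C ((2 : ℝ) : ℂ) := by
    rw [Complex.ofReal_ofNat]; exact (map_ofNat C 2).symm
  have e4 : (4 : ℂ[X]).coeff (a + 2) = 0 := by rw [show a + 2 = (a + 1) + 1 from rfl, coeff_ofNat_succ]
  have e3 : (4 * ((n : ℂ) + 2) ^ 2) = ((4 * (n + 2) ^ 2 : ℝ) : ℂ) := by push_cast; rfl
  have e5 : (2 * ((n : ℂ) + 2)) = ((2 * (n + 2) : ℝ) : ℂ) := by push_cast; rfl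
  have e6 : (4 * ((n : ℂ) + 2)) = ((4 * (n + 2) : ℝ) : ℂ) := by push_cast; rfl
  rw [sqCoeff, raySq_add_two, e2, e3, e5, e6]
  simp only [coeff_add, coeff_C_mul, e4, Complex.add_re, Complex.re_ofReal_mul, coeff_X_pow_mul] at *
  rw [show a + 2 = (a + 1) + 1 from rfl, coeff_X_mul] at *
  simp only [coeff_add, coeff_C_mul, Complex.add_re] at *
  rw [h1, h2, sqCoeff, sqCoeff, crossCoeff]
  simp only [Complex.zero_re]
  field_simp
  ring

theorem crossCoeff_add_two (n a : ℕ) : crossCoeff (n + 2) (a + 2) = crossCoeff n (a + 2) +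
    2 * (n + 2) * sqCoeff (n + 1) a + raySign (a + 2) * derivU (n + 1) (a + 1) +
    raySign a * derivU (n + 2) (a + 1) := by
  have h0 : √2 ≠ 0 := by positivity
  have h2 := coeff_linear_shift (n + 1) (a + 1)
  have h3 := coeff_linear_unshift (n + 2) a
  have e2 : (2 : ℂ[X]) = C ((2 : ℝ) : ℂ) := by
    rw [Complex.ofReal_ofNat]; exact (map_ofNat C 2).symm
  have e6 : (4 * ((n : ℂ) + 2)) = ((4 * (n + 2) : ℝ) : ℂ) := by push_cast; rfl
  rw [crossCoeff, rayCross_add_two, e2, e6]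
  simp only [coeff_add, coeff_C_mul, Complex.add_re, Complex.re_ofReal_mul, coeff_X_pow_mul] at *
  rw [show a + 2 = (a + 1) + 1 from rfl, coeff_X_mul, coeff_X_mul] at *
  simp only [coeff_add, coeff_C_mul, Complex.add_re] at *
  rw [h2, h3, sqCoeff, crossCoeff]
  field_simp
  ring

theorem sqCoeff_one (n : ℕ) : sqCoeff n 1 = (n + 1) * derivU n 1 := by
  have h0 : √2 ≠ 0 := by positivity
  rw [sqCoeff, raySq, coeff_mul, Finset.Nat.sum_antidiagonal_eq_sum_range_succ_mk]
  simp [Finset.sum_range_succ, coeff_rayU, derivU_zero, zeta8, zeta8']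
  field_simp
  ring

theorem sqCoeff_three (n : ℕ) :
    sqCoeff n 3 = derivU n 1 * derivU n 2 - (n + 1) * derivU n 3 := by
  have h0 : √2 ≠ 0 := by positivity
  have e1 : zeta8 ^ 2 = Complex.I := zeta8_sq
  have e2 : zeta8' ^ 2 = -Complex.I := zeta8'_sq
  have e3 : zeta8 ^ 3 = Complex.I * zeta8 := by rw [pow_succ, e1]
  have e4 : zeta8' ^ 3 = -Complex.I * zeta8' := by rw [pow_succ, e2]
  rw [sqCoeff, raySq, coeff_mul, Finset.Nat.sum_antidiagonal_eq_sum_range_succ_mk]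
  simp [Finset.sum_range_succ, coeff_rayU, derivU_zero, e1, e2, e3, e4]
  simp [zeta8, zeta8']
  field_simp
  ring

theorem crossCoeff_one (n : ℕ) : crossCoeff n 1 = (n + 2) * (n + 1) / 2 := by
  have h0 : √2 ≠ 0 := by positivity
  rw [crossCoeff, rayCross, coeff_X_mul]
  simp [mul_coeff_zero, coeff_rayU, derivU_zero, zeta8, zeta8']
  field_simp
  ring

/-! ### Lower bounds for the coefficients of the squared modulus -/

theorem derivU_three_term (n a : ℕ) :
    (2 * a + 3) * derivU n (a + 1) = (n - a) * (n + 1 - a) * derivU (n + 1) a := by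
  have h1 := derivU_succ n a
  have h2 := derivU_adjacent n a
  have h3 : (n + 2 + a : ℝ) ≠ 0 := by positivity
  apply mul_left_cancel₀ h3
  linear_combination (n + 2 + a : ℝ) * h1 - (n - a) * (n + 2 + a) * h2

theorem natDegree_rayU_le (c : ℂ) (n : ℕ) : (rayU c n).natDegree ≤ n := by
  rw [natDegree_le_iff_coeff_eq_zero]
  intro a ha
  rw [coeff_rayU, derivU_eq_zero (by exact_mod_cast ha)]
  simp

theorem sqCoeff_eq_zero {n a : ℕ} (h : 2 * n < a) : sqCoeff n a = 0 := by
  have h1 := natDegree_mul_le (p := rayU zeta8 n) (q := rayU zeta8' n)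
  have h2 := natDegree_rayU_le zeta8 n
  have h3 := natDegree_rayU_le zeta8' n
  rw [sqCoeff, raySq, coeff_eq_zero_of_natDegree_lt (by omega)]
  simp

theorem crossCoeff_eq_zero {n a : ℕ} (h : 2 * n + 1 < a) : crossCoeff n (a + 1) = 0 := by
  have h1 := natDegree_mul_le (p := rayU zeta8 (n + 1)) (q := rayU zeta8' n)
  have h1' := natDegree_mul_le (p := rayU zeta8' (n + 1)) (q := rayU zeta8 n)
  have h2 := natDegree_rayU_le zeta8 n
  have h3 := natDegree_rayU_le zeta8' n
  have h4 := natDegree_rayU_le zeta8 (n + 1)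
  have h5 := natDegree_rayU_le zeta8' (n + 1)
  rw [crossCoeff, rayCross, coeff_X_mul, coeff_add, coeff_C_mul, coeff_C_mul,
    coeff_eq_zero_of_natDegree_lt (by omega), coeff_eq_zero_of_natDegree_lt (by omega)]
  simp

/-- Induction on `n` in steps of two: the increment of the left side is compared with that of
`crossCoeff`. At leading order in `n` the constant could be (2a+2)/(2a+4); the slightly smaller
(2a+1)/(2a+4) leaves room for the lower order terms. -/
theorem crossCoeff_lower {a : ℕ} (ha : Odd a) (ha3 : 3 ≤ a)
    (hG : ∀ n : ℕ, (n + 1) * derivU n a ≤ sqCoeff n a) (n : ℕ) :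
    (2 * a + 1) / (2 * a + 4) * ((n - (a + 1)) * derivU n (a + 1)) ≤ crossCoeff n (a + 2) := by
  have hb : (0 : ℝ) ≤ a := a.cast_nonneg
  induction n using Nat.twoStepInduction with
  | zero => rw [derivU_eq_zero (by omega), crossCoeff_eq_zero (by omega)]; simp
  | one => rw [derivU_eq_zero (by omega), crossCoeff_eq_zero (by omega)]; simp
  | more n ih1 ih2 =>
    rw [crossCoeff_add_two]
    have h1 := abs_le.1 (abs_raySign ha)
    have h2 := abs_le.1 (abs_raySign (a := a + 2) (by simpa [Nat.odd_add] using ha))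
    have hY := derivU_nonneg (n + 1) a
    have e1 := derivU_succ (n + 1) a
    have e2 := derivU_three_term n a
    have e3 := derivU_add_two n a
    have hg := hG (n + 1)
    have n1 := derivU_nonneg (n + 1) (a + 1)
    have n2 := derivU_nonneg (n + 2) (a + 1)
    -- The oscillating signs are estimated by their modulus only; the quadratic term dominates them.
    have l1 : -derivU (n + 1) (a + 1) ≤ raySign (a + 2) * derivU (n + 1) (a + 1) := by nlinarith
    have l2 : -derivU (n + 2) (a + 1) ≤ raySign a * derivU (n + 2) (a + 1) := by nlinarith
    have l3 : 2 * ((n : ℝ) + 2) * ((n + 2) * derivU (n + 1) a) ≤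
        2 * (n + 2) * sqCoeff (n + 1) a := by
      refine mul_le_mul_of_nonneg_left (le_trans (le_of_eq ?_) hg) (by positivity)
      push_cast; ring
    suffices h : (2 * a + 1 : ℝ) / (2 * a + 4) * (((n + 2 : ℕ) - (a + 1)) * derivU (n + 2) (a + 1))
        - (2 * a + 1) / (2 * a + 4) * ((n - (a + 1)) * derivU n (a + 1)) ≤
        2 * ((n : ℝ) + 2) * ((n + 2) * derivU (n + 1) a) - derivU (n + 1) (a + 1) -
        derivU (n + 2) (a + 1) by linarith
    rcases lt_or_ge (n + 1) a with hlt | hge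
    · rw [e3, derivU_eq_zero hlt, derivU_eq_zero (show n < a + 1 by omega),
        derivU_eq_zero (show n + 1 < a + 1 by omega)]
      simp
    -- In the variable t = n + 1 - a all derivatives involved are polynomial multiples of `derivU (n
    -- + 1) a`, so a polynomial inequality in `a` and `t` remains.
    obtain ⟨t, ht⟩ : ∃ t, n + 1 = a + t := ⟨n + 1 - a, by omega⟩
    have htr : (n : ℝ) = a + t - 1 := by have : (n : ℝ) + 1 = a + t := by exact_mod_cast ht
                                         linarith
    have ht0 : (0 : ℝ) ≤ t := t.cast_nonneg
    set Y := derivU (n + 1) a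
    have hd : (2 * (a : ℝ) + 3) ≠ 0 := by positivity
    have hd' : (2 * (a : ℝ) + 4) ≠ 0 := by positivity
    have f1 : derivU (n + 1) (a + 1) = t * (t + 2 * a + 2) * Y / (2 * a + 3) := by
      rw [eq_div_iff hd, mul_comm, e1]; push_cast; rw [htr]; ring
    have f2 : derivU n (a + 1) = (t - 1) * t * Y / (2 * a + 3) := by
      rw [eq_div_iff hd, mul_comm, e2, htr]; ring
    rw [e3, f1, f2]
    push_cast
    rw [htr, ← sub_nonneg]
    have : 0 ≤ (2 * (t : ℝ) ^ 2 + (4 * a ^ 2 + 10 * a + 4) * t + 2 * (a + 1) * (2 * a + 3) * a) * Y /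
        (2 * a + 3) := by positivity
    refine le_of_le_of_eq this ?_
    field_simp
    ring

/-- In `sqCoeff_add_two` the term with `sqCoeff (n + 1) a` is bounded below by the hypothesis at
`a`, the cross term by `crossCoeff_lower`, and `sqCoeff n (a + 2)` by induction on `n`; together
they outweigh the signed terms. -/
theorem derivU_mul_le_sqCoeff_step {a : ℕ} (ha : Odd a) (ha3 : 3 ≤ a)
    (hG : ∀ n : ℕ, (n + 1) * derivU n a ≤ sqCoeff n a) (n : ℕ) :
    (n + 1) * derivU n (a + 2) ≤ sqCoeff n (a + 2) := by
  have ha3' : (3 : ℝ) ≤ a := by exact_mod_cast ha3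
  induction n using Nat.twoStepInduction with
  | zero => rw [derivU_eq_zero (by omega), sqCoeff_eq_zero (by omega)]; simp
  | one => rw [derivU_eq_zero (by omega), sqCoeff_eq_zero (by omega)]; simp
  | more n ih1 ih2 =>
    rw [sqCoeff_add_two]
    have h2 := abs_le.1 (abs_raySign (a := a + 2) (by simpa [Nat.odd_add] using ha))
    have hY := derivU_nonneg (n + 1) a
    have e1 := derivU_succ (n + 1) a
    have e2 := derivU_three_term n a
    have e3 := derivU_add_two n (a + 1)
    have e4 := derivU_succ n (a + 1)
    have hg := hG (n + 1)
    have hc := crossCoeff_lower ha ha3 hG n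
    have n1 := derivU_nonneg (n + 1) (a + 1)
    have n2 := derivU_nonneg n (a + 2)
    have l1 : -derivU (n + 1) (a + 1) ≤ raySign (a + 2) * derivU (n + 1) (a + 1) := by nlinarith
    have l2 : -derivU n (a + 2) ≤ raySign (a + 2) * derivU n (a + 2) := by nlinarith
    have l3 : 4 * ((n : ℝ) + 2) ^ 2 * ((n + 2) * derivU (n + 1) a) ≤
        4 * (n + 2) ^ 2 * sqCoeff (n + 1) a := by
      refine mul_le_mul_of_nonneg_left (le_trans (le_of_eq ?_) hg) (by positivity)
      push_cast; ring
    have l4 := mul_le_mul_of_nonneg_left hc (show 0 ≤ 4 * ((n : ℝ) + 2) by positivity)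
    have l5 := mul_le_mul_of_nonneg_left l1 (show 0 ≤ 4 * ((n : ℝ) + 2) by positivity)
    suffices h : ((n + 2 : ℕ) + 1) * derivU (n + 2) (a + 1 + 1) - (n + 1) * derivU n (a + 2) +
        2 * derivU n (a + 2) + 4 * (n + 2) * derivU (n + 1) (a + 1) ≤
        4 * ((n : ℝ) + 2) ^ 2 * ((n + 2) * derivU (n + 1) a) + 4 * ((n : ℝ) + 2) *
        ((2 * a + 1) / (2 * a + 4) * ((n - (a + 1)) * derivU n (a + 1))) by
      linarith
    rcases lt_or_ge (n + 1) a with hlt | hge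
    · rw [e3, derivU_eq_zero hlt, derivU_eq_zero (show n < a + 1 by omega),
        derivU_eq_zero (show n + 1 < a + 1 by omega), derivU_eq_zero (show n < a + 2 by omega)]
      simp
    obtain ⟨t, ht⟩ : ∃ t, n + 1 = a + t := ⟨n + 1 - a, by omega⟩
    have htr : (n : ℝ) = a + t - 1 := by have : (n : ℝ) + 1 = a + t := by exact_mod_cast ht
                                         linarith
    have ht0 : (0 : ℝ) ≤ t := t.cast_nonneg
    set Y := derivU (n + 1) a
    have hd : (2 * (a : ℝ) + 3) ≠ 0 := by positivity
    have hd4 : (2 * (a : ℝ) + 4) ≠ 0 := by positivity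
    have hd5 : (2 * (a : ℝ) + 5) ≠ 0 := by positivity
    have f1 : derivU (n + 1) (a + 1) = t * (t + 2 * a + 2) * Y / (2 * a + 3) := by
      rw [eq_div_iff hd, mul_comm, e1]; push_cast; rw [htr]; ring
    have f2 : derivU n (a + 1) = (t - 1) * t * Y / (2 * a + 3) := by
      rw [eq_div_iff hd, mul_comm, e2, htr]; ring
    have f3 : derivU n (a + 2) = (t - 2) * (t + 2 * a + 2) * ((t - 1) * t * Y / (2 * a + 3)) /
        (2 * a + 5) := by
      rw [eq_div_iff hd5, mul_comm, ← f2]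
      push_cast at e4
      rw [show (2 * (a : ℝ) + 5) = 2 * (a + 1) + 3 by ring, e4, htr]; ring
    rw [e3, f1, f2, show a + 1 + 1 = a + 2 from rfl, f3]
    push_cast
    rw [htr, ← sub_nonneg]
    -- Expanded at a = 3, the polynomial has nonnegative coefficients except for -112 t³ in the part
    -- free of c, which is absorbed by completing the square in t² (48 (t - 7/6)² + 59204/3).
    obtain ⟨c, hc⟩ : ∃ c : ℝ, (a : ℝ) = c + 3 := ⟨a - 3, by ring⟩
    have hc0 : 0 ≤ c := by linarith
    rw [hc] at hd hd4 hd5 ⊢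
    have key : 0 ≤ ((253440 + 343168 * c ^ 1 + 193056 * c ^ 2 + 57752 * c ^ 3 + 9688 * c ^ 4 + 864 * c ^ 5 + 32 * c ^ 6) * (t : ℝ) ^ 0 +
        (142624 + 160840 * c ^ 1 + 72224 * c ^ 2 + 16152 * c ^ 3 + 1800 * c ^ 4 + 80 * c ^ 5) * (t : ℝ) ^ 1 +
        (18112 * c ^ 1 + 6248 * c ^ 2 + 964 * c ^ 3 + 56 * c ^ 4) * (t : ℝ) ^ 2 +
        (248 * c ^ 1 + 136 * c ^ 2 + 16 * c ^ 3) * (t : ℝ) ^ 3 +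
        (52 * c ^ 1 + 8 * c ^ 2) * (t : ℝ) ^ 4 +
        (t : ℝ) ^ 2 * (48 * (t - 7 / 6) ^ 2 + 59204 / 3)) * Y /
        ((2 * (c + 3) + 3) * (2 * (c + 3) + 4) * (2 * (c + 3) + 5)) := by positivity
    refine le_of_le_of_eq key ?_
    field_simp
    ring

/-- The cases `a = 1` and `a = 3` are explicit; the inductive step starts at 3. -/
theorem derivU_mul_le_sqCoeff {a : ℕ} (ha : Odd a) (n : ℕ) :
    (n + 1) * derivU n a ≤ sqCoeff n a := by
  obtain ⟨k, rfl⟩ := ha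
  rcases k with _ | k
  · exact (sqCoeff_one n).ge
  induction k generalizing n with
  | zero =>
    rw [show 2 * (0 + 1) + 1 = 3 from rfl, sqCoeff_three]
    have h1 := derivU_succ n 0
    have h2 := derivU_succ n 1
    have h3 := derivU_succ n 2
    have h4 := derivU_nonneg n 2
    norm_num at h1 h2 h3
    rw [derivU_zero] at h1
    have e1 : derivU n 1 = ((n + 1) ^ 2 - 1) * (n + 1) / 3 := by linarith
    have e3 : derivU n 3 = ((n + 1) ^ 2 - 3 ^ 2) * derivU n 2 / 7 := by linarith
    rw [e1, e3, ← sub_nonneg]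
    have : 0 ≤ (n + 1 : ℝ) * ((n + 1) ^ 2 + 47) * derivU n 2 / 21 := by positivity
    refine le_of_le_of_eq this ?_
    ring
  | succ k ih =>
    exact derivU_mul_le_sqCoeff_step (a := 2 * (k + 1) + 1) ⟨_, rfl⟩ (by omega) ih n

theorem crossCoeff_nonneg (k n : ℕ) : 0 ≤ crossCoeff n (4 * k + 1) := by
  rcases k with _ | k
  · rw [crossCoeff_one]; positivity
  -- The bound is vacuous or positive: for n ≤ a the derivative vanishes, and beyond that the factor
  -- n - (a + 1) is nonnegative.
  have h := crossCoeff_lower (a := 4 * k + 3) ⟨2 * k + 1, by ring⟩ (by omega)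
    (derivU_mul_le_sqCoeff ⟨2 * k + 1, by ring⟩) n
  refine le_trans ?_ h
  rcases lt_or_ge n (4 * k + 3 + 1) with hn | hn
  · rw [derivU_eq_zero hn]; simp
  · have h1 : ((4 * k + 3 : ℕ) : ℝ) + 1 ≤ n := by exact_mod_cast hn
    exact mul_nonneg (by positivity) (mul_nonneg (by linarith) (derivU_nonneg _ _))

theorem sqCoeff_nonneg {a : ℕ} (ha : Odd a) (n : ℕ) : 0 ≤ sqCoeff n a :=
  le_trans (mul_nonneg (by positivity) (derivU_nonneg n a)) (derivU_mul_le_sqCoeff ha n)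

/-- For `a > n` the lower bound is zero. But then the signed terms of `sqCoeff_add_two` vanish, all
others are nonnegative, and the one with `sqCoeff` at (n - 1, a - 2) is positive by induction, since
a < 2n is preserved. -/
theorem sqCoeff_pos {a : ℕ} (ha : Odd a) {n : ℕ} (h : a < 2 * n) : 0 < sqCoeff n a := by
  induction n using Nat.strong_induction_on generalizing a with
  | _ n ih =>
  rcases le_or_gt a n with han | han
  · exact lt_of_lt_of_le (mul_pos (by positivity) (derivU_pos han)) (derivU_mul_le_sqCoeff ha n)
  obtain ⟨m, rfl⟩ : ∃ m, n = m + 2 := ⟨n - 2, by omega⟩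
  obtain ⟨c, rfl⟩ : ∃ c, a = c + 2 := ⟨a - 2, by omega⟩
  have hc : Odd c := by simpa [Nat.odd_add] using ha
  have hc3 : 3 ≤ c ∨ c = 1 := by rcases hc with ⟨k, rfl⟩; omega
  have h1 : 0 ≤ crossCoeff m (c + 2) := by
    rcases hc3 with h3 | rfl
    · have := crossCoeff_lower hc h3 (derivU_mul_le_sqCoeff hc) m
      rwa [derivU_eq_zero (by omega), mul_zero, mul_zero] at this
    · obtain rfl : m = 0 := by omega
      have := crossCoeff_eq_zero (n := 0) (a := 2) (by omega)
      exact this.ge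
  rw [sqCoeff_add_two, derivU_eq_zero (show m < c + 2 by omega),
    derivU_eq_zero (show m + 1 < c + 1 by omega)]
  have h2 := ih (m + 1) (by omega) hc (by omega)
  have h3 := sqCoeff_nonneg ha m
  have h4 : 0 < 4 * ((m : ℝ) + 2) ^ 2 * sqCoeff (m + 1) c := by positivity
  have h5 : 0 ≤ 4 * ((m : ℝ) + 2) * crossCoeff m (c + 2) := by positivity
  linarith

/-! ### Alternating convolutions as coefficients along the ray -/

/-- The alternating convolution of the even and odd Taylor coefficients. -/
def altConv (f : ℕ → ℝ) (m : ℕ) : ℝ :=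
  ∑ i ∈ Finset.range (2 * m + 1), (-1) ^ (m + i) * (f (2 * i + 1) * f (2 * (2 * m - i)))

theorem sum_range_two_mul {M : Type*} [AddCommMonoid M] (F : ℕ → M) (K : ℕ) :
    ∑ i ∈ Finset.range (2 * K), F i = ∑ s ∈ Finset.range K, (F (2 * s) + F (2 * s + 1)) := by
  induction K with
  | zero => simp
  | succ K ih =>
    rw [show 2 * (K + 1) = 2 * K + 1 + 1 by ring, Finset.sum_range_succ, Finset.sum_range_succ, ih,
      Finset.sum_range_succ, add_assoc]

/-- In degree 4m + 1 exactly one of the two indices is odd. The even powers of ζ and ζ̄ multiply to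
a sign, the remaining ζ or ζ̄ has real part √2/2, and the two placements of the odd index contribute
equally. -/
theorem coeff_ray_mul_re (f : ℕ → ℝ) (P Q : ℂ[X]) (hP : ∀ a, P.coeff a = zeta8 ^ a * f a)
    (hQ : ∀ a, Q.coeff a = zeta8' ^ a * f a) (m : ℕ) :
    ((P * Q).coeff (4 * m + 1)).re = √2 * altConv f m := by
  have key : ∀ s ∈ Finset.range (2 * m + 1), zeta8 ^ (2 * s) * zeta8' ^ (2 * (2 * m - s)) =
      ((-1 : ℝ) ^ (m + s) : ℝ) := by
    intro s hs
    obtain ⟨t, ht⟩ : ∃ t, 2 * m = s + t := ⟨2 * m - s, by have := Finset.mem_range.1 hs; omega⟩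
    rw [ht, Nat.add_sub_cancel_left, pow_mul, pow_mul, zeta8_sq, zeta8'_sq]
    have h1 : Complex.I ^ s * (-Complex.I) ^ t = (Complex.I ^ 2) ^ s * ((-Complex.I) ^ 2) ^ m := by
      have : (Complex.I * (-Complex.I)) ^ s = 1 := by simp
      rw [← pow_mul, ← pow_mul, ht, pow_add, ← mul_assoc, mul_comm 2 s, mul_comm s 2, two_mul,
        pow_add, mul_assoc (Complex.I ^ s), ← mul_pow, this, mul_one]
    rw [h1]; simp [pow_add, mul_comm]
  rw [coeff_mul, Finset.Nat.sum_antidiagonal_eq_sum_range_succ_mk,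
    -- The terms with even index in `P` are reflected so that each meets the term with the same pair
    -- of indices exchanged.
    show (4 * m + 1).succ = 2 * (2 * m + 1) by omega, sum_range_two_mul, Finset.sum_add_distrib,
    ← Finset.sum_range_reflect (fun s => P.coeff (2 * s) * Q.coeff (4 * m + 1 - 2 * s)),
    ← Finset.sum_add_distrib, Complex.re_sum, altConv, Finset.mul_sum]
  refine Finset.sum_congr rfl fun s hs => ?_
  have hs' := Finset.mem_range.1 hs
  have k1 := key s hs
  have k2 := key (2 * m - s) (Finset.mem_range.2 (by omega))
  rw [show 2 * m - (2 * m - s) = s by omega] at k2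
  have k3 : (-1 : ℝ) ^ (m + (2 * m - s)) = (-1) ^ (m + s) := by
    rw [show m + (2 * m - s) = m + s + 2 * (m - s) - 2 * (s - m) by omega]
    rcases le_total s m with h | h
    · rw [Nat.sub_eq_zero_of_le h, mul_zero, Nat.sub_zero, pow_add, pow_mul]; simp
    · obtain ⟨d, rfl⟩ := Nat.exists_eq_add_of_le h
      rw [show m + (m + d) + 2 * (m - (m + d)) - 2 * (m + d - m) = 2 * (m - d) + d by omega,
        show m + (m + d) = 2 * m + d by ring, pow_add, pow_mul, pow_add, pow_mul]; simp
  rw [show 2 * m + 1 - 1 - s = 2 * m - s by omega,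
    show 4 * m + 1 - 2 * (2 * m - s) = 2 * s + 1 by omega,
    show 4 * m + 1 - (2 * s + 1) = 2 * (2 * m - s) by omega, hP, hP, hQ, hQ]
  have e1 : zeta8 ^ (2 * (2 * m - s)) * f (2 * (2 * m - s)) * (zeta8' ^ (2 * s + 1) * f (2 * s + 1))
      = zeta8' * (((-1) ^ (m + s) * (f (2 * s + 1) * f (2 * (2 * m - s))) : ℝ) : ℂ) := by
    rw [← k3]; push_cast; rw [← Complex.ofReal_one, ← Complex.ofReal_neg, ← Complex.ofReal_pow, ← k2]
    ring
  have e2 : zeta8 ^ (2 * s + 1) * f (2 * s + 1) * (zeta8' ^ (2 * (2 * m - s)) * f (2 * (2 * m - s)))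
      = zeta8 * (((-1) ^ (m + s) * (f (2 * s + 1) * f (2 * (2 * m - s))) : ℝ) : ℂ) := by
    push_cast; rw [← Complex.ofReal_one, ← Complex.ofReal_neg, ← Complex.ofReal_pow, ← k1]
    ring
  rw [e1, e2, ← add_mul, Complex.re_mul_ofReal]
  simp [zeta8, zeta8']

theorem altConv_derivU (n m : ℕ) : altConv (derivU n) m = sqCoeff n (4 * m + 1) := by
  have h1 := coeff_ray_mul_re (derivU n) _ _ (coeff_rayU zeta8 n) (coeff_rayU zeta8' n) m
  rw [sqCoeff, raySq, h1]
  field_simp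

/-- Writing A for the polynomial of U_n and A + D for that of U_{n+2}, use |A + D/2|² = |A + D|²/4 +
3|A|²/4 + Re(A D̄)/2. By the recursion the last term consists of a cross term, nonnegative in these
degrees, and a signed term linear in A, which 3|A|²/4 absorbs by `derivU_mul_le_sqCoeff`. -/
theorem sqCoeff_le_altConv_add (n m : ℕ) : 1 / 4 * sqCoeff (n + 2) (4 * m + 1) ≤
    altConv (fun a => (derivU (n + 2) a + derivU n a) / 2) m := by
  have hodd : Odd (4 * m + 1) := ⟨2 * m, by ring⟩
  have h1 := coeff_ray_mul_re (fun a => (derivU (n + 2) a + derivU n a) / 2)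
    (C (((1 / 2 : ℝ)) : ℂ) * (rayU zeta8 (n + 2) + rayU zeta8 n))
    (C (((1 / 2 : ℝ)) : ℂ) * (rayU zeta8' (n + 2) + rayU zeta8' n))
    (fun a => by simp only [coeff_C_mul, coeff_add, coeff_rayU]; push_cast; ring)
    (fun a => by simp only [coeff_C_mul, coeff_add, coeff_rayU]; push_cast; ring) m
  have e : (C (((1 / 2 : ℝ)) : ℂ) * (rayU zeta8 (n + 2) + rayU zeta8 n)) *
      (C (((1 / 2 : ℝ)) : ℂ) * (rayU zeta8' (n + 2) + rayU zeta8' n)) =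
      C (((1 / 4 : ℝ)) : ℂ) * raySq (n + 2) + C (((3 / 4 : ℝ)) : ℂ) * raySq n +
      C (((1 / 2 : ℝ)) : ℂ) * (rayU zeta8 n + rayU zeta8' n) +
      C (((n + 2) / 2 : ℝ) : ℂ) * rayCross n := by
    have hD : C ((1 / 2 : ℝ) : ℂ) * 2 = (1 : ℂ[X]) := by
      rw [← C_ofNat, ← C_mul]; norm_num
    have h4 : C ((1 / 4 : ℝ) : ℂ) = C ((1 / 2 : ℝ) : ℂ) ^ 2 := by
      rw [← C_pow]; congr 1; norm_num
    have h34 : C ((3 / 4 : ℝ) : ℂ) = 3 * C ((1 / 2 : ℝ) : ℂ) ^ 2 := by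
      rw [← C_pow, ← C_ofNat, ← C_mul]; congr 1; norm_num
    have hn : C (((n + 2) / 2 : ℝ) : ℂ) = C ((n : ℂ) + 2) * C ((1 / 2 : ℝ) : ℂ) := by
      rw [← C_mul]; congr 1; push_cast; ring
    have e1 : ∀ c, rayU c (n + 2) =
        rayU c n + 2 + 2 * C ((n : ℂ) + 2) * C c * (X * rayU c (n + 1)) := by
      intro c; rw [rayU, C_mul, C_mul, C_ofNat]
    rw [h4, h34, hn, rayCross, raySq, raySq]
    set D := C ((1 / 2 : ℝ) : ℂ)
    have e2 := e1 zeta8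
    have e3 := e1 zeta8'
    linear_combination D ^ 2 * rayU zeta8' n * e2 + D ^ 2 * rayU zeta8 n * e3 +
      (D * (rayU zeta8 n + rayU zeta8' n) + D * C ((n : ℂ) + 2) * (X * (C zeta8 *
      (rayU zeta8 (n + 1) * rayU zeta8' n) + C zeta8' * (rayU zeta8' (n + 1) * rayU zeta8 n)))) * hD
  rw [e] at h1
  simp only [coeff_add (_ + _), coeff_C_mul, Complex.add_re, Complex.re_ofReal_mul] at h1
  rw [coeff_add, Complex.add_re, coeff_C_mul, coeff_C_mul, Complex.re_ofReal_mul,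
    Complex.re_ofReal_mul, coeff_linear] at h1
  have h2 := sqCoeff_nonneg hodd n
  have h3 := derivU_mul_le_sqCoeff hodd n
  have h4 := crossCoeff_nonneg m n
  have h5 := abs_le.1 (abs_raySign hodd)
  have h6 := derivU_nonneg n (4 * m + 1)
  have h7 : (0 : ℝ) < √2 := by positivity
  have q1 : ((raySq (n + 2)).coeff (4 * m + 1)).re = √2 * sqCoeff (n + 2) (4 * m + 1) := by
    rw [sqCoeff]; field_simp
  have q2 : ((raySq n).coeff (4 * m + 1)).re = √2 * sqCoeff n (4 * m + 1) := by
    rw [sqCoeff]; field_simp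
  have q3 : ((rayCross n).coeff (4 * m + 1)).re = √2 * (2 * crossCoeff n (4 * m + 1)) := by
    rw [crossCoeff]; field_simp
  rw [q1, q2, q3] at h1
  have h8 : altConv (fun a => (derivU (n + 2) a + derivU n a) / 2) m =
      1 / 4 * sqCoeff (n + 2) (4 * m + 1) + 3 / 4 * sqCoeff n (4 * m + 1) +
      1 / 2 * (raySign (4 * m + 1) * derivU n (4 * m + 1)) +
      (n + 2) * crossCoeff n (4 * m + 1) := by
    apply mul_left_cancel₀ h7.ne'
    rw [← h1]; ring
  have h9 : -derivU n (4 * m + 1) ≤ raySign (4 * m + 1) * derivU n (4 * m + 1) := by nlinarith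
  have h10 : derivU n (4 * m + 1) ≤ (n + 1) * derivU n (4 * m + 1) := by nlinarith
  rw [h8]
  have h11 : 0 ≤ ((n : ℝ) + 2) * crossCoeff n (4 * m + 1) := by positivity
  linarith

/-! ### The symmetric solution of the two-step antidiagonal recursion -/

/-- Right-hand side of the recursion for `kypForm`. -/
def kypRhs (f : ℕ → ℝ) (i j : ℕ) : ℝ :=
  2 * (f (2 * i) * f (2 * j + 1) + f (2 * i + 1) * f (2 * j)) -
    if i = j then 4 * altConv f i else 0

/-- The solution of `b (i + 1) j + b i (j + 1) = kypRhs f i j`, `b 0 j = 0`. -/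
def kypForm (f : ℕ → ℝ) : ℕ → ℕ → ℝ
  | 0, _ => 0
  | i + 1, j => kypRhs f i j - kypForm f i (j + 1)

theorem kypRhs_comm (f : ℕ → ℝ) (i j : ℕ) : kypRhs f i j = kypRhs f j i := by
  simp only [kypRhs]
  by_cases h : i = j
  · subst h; ring
  · rw [if_neg h, if_neg (Ne.symm h)]; ring

theorem kypForm_eq_sum (f : ℕ → ℝ) (i j : ℕ) : kypForm f (i + 1) j =
    ∑ t ∈ Finset.range (i + 1), (-1) ^ (i + t) * kypRhs f t (i + j - t) := by
  induction i generalizing j with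
  | zero => simp [kypForm]
  | succ i ih =>
    rw [kypForm, ih, Finset.sum_range_succ _ (i + 1), ← two_mul (i + 1), pow_mul]
    rw [show i + 1 + j - (i + 1) = j by omega, neg_one_sq, one_pow, one_mul, sub_eq_neg_add,
      ← Finset.sum_neg_distrib]
    congr 1
    refine Finset.sum_congr rfl fun t _ => ?_
    rw [show i + 1 + j - t = i + (j + 1) - t by omega]
    ring

/-- This is the solvability condition for a recursion along antidiagonals with zero values at both
ends. For odd `s` it holds by symmetry of `kypRhs`. For s = 2m the two products give alternating
convolutions, and the diagonal term of `kypRhs` is exactly what cancels them. -/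
theorem sum_kypRhs_antidiagonal (f : ℕ → ℝ) (s : ℕ) :
    ∑ t ∈ Finset.range (s + 1), (-1) ^ (s + t) * kypRhs f t (s - t) = 0 := by
  rcases Nat.even_or_odd' s with ⟨m, rfl | rfl⟩
  · have h1 : ∑ t ∈ Finset.range (2 * m + 1), (-1 : ℝ) ^ (2 * m + t) *
        (f (2 * t) * f (2 * (2 * m - t) + 1)) = (-1) ^ m * altConv f m := by
      rw [altConv, Finset.mul_sum, ← Finset.sum_range_reflect]
      refine Finset.sum_congr rfl fun t ht => ?_
      have ht' := Finset.mem_range.1 ht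
      rw [show 2 * m + 1 - 1 - t = 2 * m - t by omega, show 2 * m - (2 * m - t) = t by omega,
        ← mul_assoc ((-1) ^ m), ← pow_add]
      rw [show (-1 : ℝ) ^ (2 * m + (2 * m - t)) = (-1) ^ (m + (m + t)) from ?_]; · ring
      obtain ⟨d, hd⟩ : ∃ d, 2 * m = t + d := ⟨2 * m - t, by omega⟩
      rw [show m + (m + t) = t + d + t by omega, hd, Nat.add_sub_cancel_left,
        show t + d + d = t + 2 * d by ring, show t + d + t = 2 * t + d by ring, pow_add, pow_add,
        pow_mul, pow_mul]
      have : (-1 : ℝ) ^ t = (-1) ^ d := by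
        have : (-1 : ℝ) ^ (t + d) = 1 := by rw [← hd, pow_mul]; simp
        rw [pow_add] at this
        rcases neg_one_pow_eq_or ℝ t with h | h <;> rcases neg_one_pow_eq_or ℝ d with h' | h' <;>
          rw [h, h'] at this ⊢ <;> norm_num at this
      rw [this]; simp
    have h2 : ∑ t ∈ Finset.range (2 * m + 1), (-1 : ℝ) ^ (2 * m + t) *
        (f (2 * t + 1) * f (2 * (2 * m - t))) = (-1) ^ m * altConv f m := by
      rw [altConv, Finset.mul_sum]
      refine Finset.sum_congr rfl fun t _ => ?_
      rw [← mul_assoc ((-1) ^ m), ← pow_add, ← add_assoc, two_mul]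
    have h3 : ∑ t ∈ Finset.range (2 * m + 1), (-1 : ℝ) ^ (2 * m + t) *
        (if t = 2 * m - t then 4 * altConv f t else 0) = (-1) ^ m * (4 * altConv f m) := by
      rw [Finset.sum_eq_single_of_mem m (Finset.mem_range.2 (by omega))]
      · rw [if_pos (by omega), pow_add, pow_mul]; simp
      · intro t ht htm
        rw [if_neg (by have := Finset.mem_range.1 ht; omega), mul_zero]
    simp only [kypRhs, mul_sub, mul_add, Finset.sum_sub_distrib, Finset.sum_add_distrib]
    have e : ∀ g : ℕ → ℝ, ∑ t ∈ Finset.range (2 * m + 1), (-1 : ℝ) ^ (2 * m + t) * (2 * g t) =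
        2 * ∑ t ∈ Finset.range (2 * m + 1), (-1 : ℝ) ^ (2 * m + t) * g t := by
      intro g; rw [Finset.mul_sum]; exact Finset.sum_congr rfl fun _ _ => by ring
    rw [e, e, h1, h2, h3]; ring
  · have h : ∀ S : ℝ, S = -S → S = 0 := fun S hS => by linarith
    apply h
    conv_lhs => rw [← Finset.sum_range_reflect]
    rw [← Finset.sum_neg_distrib]
    refine Finset.sum_congr rfl fun t ht => ?_
    have ht' := Finset.mem_range.1 ht
    obtain ⟨d, hd⟩ : ∃ d, 2 * m + 1 = t + d := ⟨2 * m + 1 - t, by omega⟩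
    rw [show 2 * m + 1 + 1 - 1 - t = 2 * m + 1 - t by omega,
      show 2 * m + 1 - (2 * m + 1 - t) = t by omega, kypRhs_comm, ← neg_mul]
    congr 1
    rw [hd, Nat.add_sub_cancel_left, show t + d + d = t + 2 * d by ring,
      show t + d + t = 2 * t + d by ring, pow_add, pow_add, pow_mul, pow_mul]
    have : (-1 : ℝ) ^ (t + d) = -1 := by rw [← hd, pow_succ, pow_mul]; simp
    rw [pow_add] at this
    rcases neg_one_pow_eq_or ℝ t with h | h <;> rcases neg_one_pow_eq_or ℝ d with h' | h' <;>
      rw [h, h'] at this ⊢ <;> norm_num at this <;> simp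

theorem kypForm_zero_right (f : ℕ → ℝ) (i : ℕ) : kypForm f i 0 = 0 := by
  cases i with
  | zero => rfl
  | succ i => rw [kypForm_eq_sum]; simpa using sum_kypRhs_antidiagonal f i

theorem kypForm_comm (f : ℕ → ℝ) (i j : ℕ) : kypForm f i j = kypForm f j i := by
  induction i generalizing j with
  | zero => rw [kypForm_zero_right]; rfl
  | succ i ih =>
    rw [kypForm, ih, kypRhs_comm, kypForm]; ring

theorem kypForm_add (f : ℕ → ℝ) (i j : ℕ) :
    kypForm f i (j + 1) + kypForm f (i + 1) j = kypRhs f i j := by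
  rw [kypForm]; ring

/-- The form does not see coordinates belonging to derivatives that vanish. For i ≤ j the recursion
stays strictly off the diagonal, so the convolution term never enters. -/
theorem kypForm_eq_zero {f : ℕ → ℝ} {n : ℕ} (hf : ∀ a, n < a → f a = 0) {i j : ℕ}
    (hj : n < 2 * j) : kypForm f i j = 0 := by
  have key : ∀ i j, i ≤ j → n < 2 * j → kypForm f i j = 0 := by
    intro i
    induction i with
    | zero => intros; rfl
    | succ i ih =>
      intro j hij hj
      rw [kypForm, ih (j + 1) (by omega) (by omega), kypRhs, if_neg (by omega), hf (2 * j) hj,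
        hf (2 * j + 1) (by omega)]
      ring
  rcases le_total i j with h | h
  · exact key i j h hj
  · rw [kypForm_comm]; exact key j i h (by omega)

/-! ### A basis adapted to collocation at the interior Chebyshev nodes -/

/-- The polynomial of degree `N - 1` vanishing at the interior Chebyshev nodes. -/
def interiorPoly (N : ℕ) : ℝ[X] := Chebyshev.U ℝ ((N - 1 : ℕ) : ℤ)

/-- The generators of degree `N` and `N - 1`. -/
def tauGen (N k : ℕ) : ℝ[X] := if k % 2 = 0 then X * interiorPoly N else interiorPoly N

/-- The basis of the polynomials of degree at most `N` given by the even derivatives of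
`tauGen N 0` and `tauGen N 1`. -/
def tauBasis (N k : ℕ) : ℝ[X] := derivative^[2 * (k / 2)] (tauGen N k)

theorem tauBasis_add_two (N k : ℕ) :
    tauBasis N (k + 2) = derivative (derivative (tauBasis N k)) := by
  rw [tauBasis, tauBasis, show 2 * ((k + 2) / 2) = 2 * (k / 2) + 1 + 1 by omega,
    Function.iterate_succ_apply', Function.iterate_succ_apply', tauGen, tauGen, Nat.add_mod_right]

theorem natDegree_interiorPoly (N : ℕ) : (interiorPoly N).natDegree = N - 1 :=
  Chebyshev.natDegree_U_natCast ℝ _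

theorem interiorPoly_ne_zero (N : ℕ) : interiorPoly N ≠ 0 := by
  rw [interiorPoly]
  exact Chebyshev.U_ne_zero ℝ _ (by omega)

theorem natDegree_tauGen {N : ℕ} (hN : 1 ≤ N) (k : ℕ) : (tauGen N k).natDegree = N - k % 2 := by
  rw [tauGen]
  split_ifs with h
  · rw [natDegree_X_mul (interiorPoly_ne_zero N), natDegree_interiorPoly]; omega
  · rw [natDegree_interiorPoly]; omega

theorem tauGen_ne_zero (N k : ℕ) : tauGen N k ≠ 0 := by
  rw [tauGen]; split_ifs
  · exact mul_ne_zero X_ne_zero (interiorPoly_ne_zero N)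
  · exact interiorPoly_ne_zero N

theorem natDegree_tauBasis_le {N : ℕ} (hN : 1 ≤ N) (k : ℕ) :
    (tauBasis N k).natDegree ≤ N - k := by
  refine (natDegree_iterate_derivative _ _).trans ?_
  rw [natDegree_tauGen hN]; omega

theorem coeff_tauBasis_ne_zero {N : ℕ} (hN : 1 ≤ N) {k : ℕ} (hk : k ≤ N) :
    (tauBasis N k).coeff (N - k) ≠ 0 := by
  rw [tauBasis, coeff_iterate_derivative, show N - k + 2 * (k / 2) = N - k % 2 by omega,
    ← natDegree_tauGen hN]
  refine smul_ne_zero ?_ (leadingCoeff_ne_zero.2 (tauGen_ne_zero N k))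
  rw [Ne, Nat.descFactorial_eq_zero_iff_lt, natDegree_tauGen hN]; omega

theorem tauBasis_eq_zero {N : ℕ} (hN : 1 ≤ N) {k : ℕ} (hk : N < k) : tauBasis N k = 0 := by
  rw [tauBasis]
  apply iterate_derivative_eq_zero
  rw [natDegree_tauGen hN]; omega

/-- The derivatives at `1` of the generator of parity class `k`. -/
def genSeq (N k a : ℕ) : ℝ := (derivative^[a] (tauGen N k)).eval 1

theorem genSeq_congr (N : ℕ) {k l : ℕ} (h : k % 2 = l % 2) : genSeq N k = genSeq N l := by
  funext a; rw [genSeq, genSeq, tauGen, tauGen, h]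

theorem eval_one_tauBasis (N k : ℕ) : (tauBasis N k).eval 1 = genSeq N k (2 * (k / 2)) := rfl

theorem eval_one_derivative_tauBasis (N k : ℕ) :
    (derivative (tauBasis N k)).eval 1 = genSeq N k (2 * (k / 2) + 1) := by
  rw [genSeq, Function.iterate_succ_apply', tauBasis]

theorem genSeq_eq_zero {N : ℕ} (hN : 1 ≤ N) (k : ℕ) {a : ℕ} (ha : N - k % 2 < a) :
    genSeq N k a = 0 := by
  rw [genSeq, iterate_derivative_eq_zero (by rwa [natDegree_tauGen hN]), eval_zero]

theorem genSeq_odd {N k : ℕ} (hk : k % 2 = 1) : genSeq N k = derivU (N - 1) := by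
  funext a; rw [genSeq, tauGen, if_neg (by omega), interiorPoly, derivU]

theorem genSeq_even {N k : ℕ} (hN : 2 ≤ N) (hk : k % 2 = 0) :
    genSeq N k = fun a => (derivU (N - 2 + 2) a + derivU (N - 2) a) / 2 := by
  funext a
  -- The three-term recursion gives 2 X U_{N-1} = U_N + U_{N-2}, which is the combination treated in
  -- `sqCoeff_le_altConv_add`.
  have h : tauGen N k = C (1 / 2) * (Chebyshev.U ℝ ((N - 2 + 2 : ℕ) : ℤ) +
      Chebyshev.U ℝ ((N - 2 : ℕ) : ℤ)) := by
    have h1 := Chebyshev.U_add_two ℝ ((N - 2 : ℕ) : ℤ)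
    have h2 : C (1 / 2 : ℝ) * 2 = (1 : ℝ[X]) := by rw [← C_ofNat, ← C_mul]; norm_num
    rw [tauGen, if_pos hk, interiorPoly, show N - 1 = N - 2 + 1 by omega]
    push_cast
    rw [h1]
    linear_combination (-X * Chebyshev.U ℝ (((N - 2 : ℕ) : ℤ) + 1)) * h2
  rw [genSeq, h, iterate_derivative_C_mul, iterate_map_add, eval_mul, eval_C, eval_add, derivU,
    derivU]
  ring

/-! ### The Lyapunov equation in coordinates -/

/-- The dissipation coefficients. -/
def dissip (N k : ℕ) : ℝ := altConv (genSeq N k) (k / 2)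

theorem dissip_nonneg {N : ℕ} (hN : 2 ≤ N) (k : ℕ) : 0 ≤ dissip N k := by
  rw [dissip]
  rcases Nat.mod_two_eq_zero_or_one k with h | h
  · rw [genSeq_even hN h]
    exact le_trans (mul_nonneg (by norm_num) (sqCoeff_nonneg ⟨2 * (k / 2), by ring⟩ _))
      (sqCoeff_le_altConv_add _ _)
  · rw [genSeq_odd h, altConv_derivU]
    exact sqCoeff_nonneg ⟨2 * (k / 2), by ring⟩ _

theorem dissip_pos {N : ℕ} (hN : 2 ≤ N) {k : ℕ} (hk : k < N) : 0 < dissip N k := by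
  rw [dissip]
  rcases Nat.mod_two_eq_zero_or_one k with h | h
  · rw [genSeq_even hN h]
    exact lt_of_lt_of_le (mul_pos (by norm_num)
      (sqCoeff_pos ⟨2 * (k / 2), by ring⟩ (by omega))) (sqCoeff_le_altConv_add _ _)
  · rw [genSeq_odd h, altConv_derivU]
    exact sqCoeff_pos ⟨2 * (k / 2), by ring⟩ (by omega)

/-- The boundary form `[u v']`. -/
def bdryForm (u v : ℝ[X]) : ℝ :=
  u.eval 1 * (derivative v).eval 1 - u.eval (-1) * (derivative v).eval (-1)

theorem bdryForm_sum (s : Finset ℕ) (a b : ℕ → ℝ) (e : ℕ → ℝ[X]) :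
    bdryForm (∑ k ∈ s, C (a k) * e k) (∑ l ∈ s, C (b l) * e l) =
      ∑ k ∈ s, ∑ l ∈ s, a k * b l * bdryForm (e k) (e l) := by
  simp only [bdryForm, derivative_sum, derivative_C_mul, eval_finsetSum, eval_mul, eval_C,
    Finset.sum_mul_sum, ← Finset.sum_sub_distrib]
  exact Finset.sum_congr rfl fun _ _ => Finset.sum_congr rfl fun _ _ => by ring

theorem derivative_eval_neg {p : ℝ[X]} {s : ℝ} (h : ∀ x, p.eval (-x) = s * p.eval x) (x : ℝ) :
    (derivative p).eval (-x) = -s * (derivative p).eval x := by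
  have h1 : p.comp (-X) = C s * p := by
    apply Polynomial.funext; intro r; simpa using h r
  have h2 := congrArg (fun q => (derivative q).eval x) h1
  simp only [derivative_comp, derivative_neg, derivative_X, derivative_C_mul, eval_mul, eval_comp,
    eval_neg, eval_X, eval_one, eval_C] at h2
  linarith

theorem iterate_derivative_eval_neg {p : ℝ[X]} {s : ℝ} (h : ∀ x, p.eval (-x) = s * p.eval x)
    (m : ℕ) (x : ℝ) :
    (derivative^[2 * m] p).eval (-x) = s * (derivative^[2 * m] p).eval x := by
  induction m generalizing x with
  | zero => exact h x
  | succ m ih =>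
    rw [show 2 * (m + 1) = 2 * m + 1 + 1 by ring, Function.iterate_succ_apply',
      Function.iterate_succ_apply', derivative_eval_neg (derivative_eval_neg ih)]
    ring

theorem tauBasis_eval_neg {N : ℕ} (hN : 1 ≤ N) (k : ℕ) (x : ℝ) :
    (tauBasis N k).eval (-x) = (-1) ^ (N + k % 2) * (tauBasis N k).eval x := by
  refine iterate_derivative_eval_neg (fun x => ?_) _ x
  obtain ⟨n, rfl⟩ : ∃ n, N = n + 1 := ⟨N - 1, by omega⟩
  have h := Chebyshev.U_eval_neg ℝ n x
  rw [Int.negOnePow_def] at h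
  rcases Nat.mod_two_eq_zero_or_one k with hk | hk
  · rw [tauGen, hk, if_pos rfl, interiorPoly, eval_mul, eval_mul, Nat.add_sub_cancel, h, eval_X,
      eval_X]
    simp [pow_succ]
    ring
  · rw [tauGen, hk, if_neg (by omega), interiorPoly, Nat.add_sub_cancel, h]
    simp [pow_succ]

/-- The basis polynomials are even or odd: the end contributions double for equal parity and cancel
otherwise. So the form splits into two independent arrays. -/
theorem bdryForm_tauBasis {N : ℕ} (hN : 1 ≤ N) (k l : ℕ) :
    bdryForm (tauBasis N k) (tauBasis N l) = if k % 2 = l % 2 then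
      2 * ((tauBasis N k).eval 1 * (derivative (tauBasis N l)).eval 1) else 0 := by
  rw [bdryForm, tauBasis_eval_neg hN k, derivative_eval_neg (tauBasis_eval_neg hN l)]
  rcases Nat.mod_two_eq_zero_or_one k with hk | hk <;>
  rcases Nat.mod_two_eq_zero_or_one l with hl | hl <;>
  rcases neg_one_pow_eq_or ℝ N with hs | hs <;> simp [hk, hl, pow_succ, hs] <;> ring

/-- The bilinear form on coordinates. -/
def coordForm (N k l : ℕ) : ℝ := if k % 2 = l % 2 then kypForm (genSeq N k) (k / 2) (l / 2) else 0

theorem coordForm_comm (N k l : ℕ) : coordForm N k l = coordForm N l k := by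
  rw [coordForm, coordForm]
  by_cases h : k % 2 = l % 2
  · rw [if_pos h, if_pos h.symm, kypForm_comm, genSeq_congr N h]
  · rw [if_neg h, if_neg (Ne.symm h)]

theorem coordForm_of_lt_two (N : ℕ) {k : ℕ} (hk : k < 2) (l : ℕ) : coordForm N k l = 0 := by
  rw [coordForm, show k / 2 = 0 by omega]; simp [kypForm]

theorem coordForm_eq_zero {N : ℕ} (hN : 1 ≤ N) (k : ℕ) {l : ℕ} (hl : N < l) :
    coordForm N k l = 0 := by
  rw [coordForm]
  split_ifs with h
  · exact kypForm_eq_zero (n := N - k % 2) (fun a ha => genSeq_eq_zero hN k ha) (by omega)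
  · rfl

theorem coordForm_add {N : ℕ} (hN : 1 ≤ N) (k l : ℕ) :
    coordForm N k (l + 2) + coordForm N l (k + 2) = bdryForm (tauBasis N k) (tauBasis N l) +
      bdryForm (tauBasis N l) (tauBasis N k) - if k = l then 4 * dissip N k else 0 := by
  rw [coordForm_comm N l (k + 2), bdryForm_tauBasis hN, bdryForm_tauBasis hN, coordForm, coordForm]
  simp only [Nat.add_mod_right, show (l + 2) / 2 = l / 2 + 1 by omega,
    show (k + 2) / 2 = k / 2 + 1 by omega]
  by_cases h : k % 2 = l % 2
  · rw [if_pos h, if_pos h, if_pos h, if_pos h.symm, genSeq_congr N (show (k + 2) % 2 = k % 2 by omega),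
      kypForm_add, kypRhs, eval_one_tauBasis, eval_one_tauBasis, eval_one_derivative_tauBasis,
      eval_one_derivative_tauBasis, genSeq_congr N h.symm, dissip]
    have : (k / 2 = l / 2) ↔ k = l := by omega
    simp only [this]
    ring
  · rw [if_neg h, if_neg h, if_neg h, if_neg (Ne.symm h), if_neg (by rintro rfl; exact h rfl)]
    ring

/-- Since u'' has the coordinates of u shifted by two, the left side is the form evaluated at (u,
u''). Symmetrizing in `k` and `l` reduces it to `coordForm_add`. -/
theorem sum_coordForm {N : ℕ} (hN : 1 ≤ N) (a : ℕ → ℝ) :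
    ∑ k ∈ Finset.range (N + 1), ∑ l ∈ Finset.range (N + 1), a k * a l * coordForm N k (l + 2) =
      bdryForm (∑ k ∈ Finset.range (N + 1), C (a k) * tauBasis N k)
        (∑ k ∈ Finset.range (N + 1), C (a k) * tauBasis N k) -
      ∑ k ∈ Finset.range (N + 1), 2 * dissip N k * a k ^ 2 := by
  rw [bdryForm_sum]
  set s := Finset.range (N + 1)
  have h1 : ∑ k ∈ s, ∑ l ∈ s, a k * a l * coordForm N k (l + 2) =
      ∑ k ∈ s, ∑ l ∈ s, a k * a l * coordForm N l (k + 2) := by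
    rw [Finset.sum_comm]
    exact Finset.sum_congr rfl fun _ _ => Finset.sum_congr rfl fun _ _ => by ring
  have h2 : ∑ k ∈ s, ∑ l ∈ s, a k * a l * bdryForm (tauBasis N k) (tauBasis N l) =
      ∑ k ∈ s, ∑ l ∈ s, a k * a l * bdryForm (tauBasis N l) (tauBasis N k) := by
    rw [Finset.sum_comm]
    exact Finset.sum_congr rfl fun _ _ => Finset.sum_congr rfl fun _ _ => by ring
  have h3 : ∑ k ∈ s, ∑ l ∈ s, a k * a l * (coordForm N k (l + 2) + coordForm N l (k + 2)) =
      ∑ k ∈ s, ∑ l ∈ s, a k * a l * (bdryForm (tauBasis N k) (tauBasis N l) +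
      bdryForm (tauBasis N l) (tauBasis N k)) - ∑ k ∈ s, 4 * dissip N k * a k ^ 2 := by
    rw [← Finset.sum_sub_distrib]
    refine Finset.sum_congr rfl fun k hk => ?_
    have : 4 * dissip N k * a k ^ 2 = ∑ l ∈ s, a k * a l * (if k = l then 4 * dissip N k else 0) := by
      rw [Finset.sum_eq_single_of_mem k hk]
      · rw [if_pos rfl]; ring
      · intro l _ hl; rw [if_neg hl.symm, mul_zero]
    rw [this, ← Finset.sum_sub_distrib]
    refine Finset.sum_congr rfl fun l _ => ?_
    rw [coordForm_add hN]; ring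
  simp only [mul_add, Finset.sum_add_distrib] at h3
  have h4 : ∑ k ∈ s, 4 * dissip N k * a k ^ 2 = 2 * ∑ k ∈ s, 2 * dissip N k * a k ^ 2 := by
    rw [Finset.mul_sum]; exact Finset.sum_congr rfl fun _ _ => by ring
  linarith

/-! ### Coordinates -/

theorem exists_coords {N : ℕ} (hN : 1 ≤ N) {u : ℝ[X]} (hu : u.natDegree ≤ N) :
    ∃ a : ℕ → ℝ, u = ∑ k ∈ Finset.range (N + 1), C (a k) * tauBasis N k := by
  have key : ∀ d ≤ N + 1, ∀ u : ℝ[X], u.degree < d →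
      ∃ a : ℕ → ℝ, u = ∑ k ∈ Finset.range (N + 1), C (a k) * tauBasis N k := by
    intro d
    induction d with
    | zero =>
      intro _ u hu
      refine ⟨0, ?_⟩
      have : u = 0 := degree_eq_bot.1 (by simpa [Nat.WithBot.lt_zero_iff] using hu)
      simp [this]
    | succ d ih =>
      intro hd u hu
      have h0 := coeff_tauBasis_ne_zero hN (k := N - d) (by omega)
      rw [show N - (N - d) = d by omega] at h0
      set c := u.coeff d / (tauBasis N (N - d)).coeff d
      have h1 : (u - C c * tauBasis N (N - d)).degree < d := by
        rw [degree_lt_iff_coeff_zero] at hu ⊢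
        intro m hm
        rcases Nat.eq_or_lt_of_le hm with rfl | hm
        · rw [coeff_sub, coeff_C_mul, div_mul_cancel₀ _ h0, sub_self]
        · rw [coeff_sub, coeff_C_mul, hu m (by exact_mod_cast hm), coeff_eq_zero_of_natDegree_lt,
            mul_zero, sub_zero]
          exact lt_of_le_of_lt (natDegree_tauBasis_le hN _) (by omega)
      obtain ⟨a, ha⟩ := ih (by omega) _ h1
      refine ⟨fun k => a k + if k = N - d then c else 0, ?_⟩
      simp only [C_add, add_mul, Finset.sum_add_distrib, ← ha]
      rw [Finset.sum_eq_single_of_mem (N - d) (Finset.mem_range.2 (by omega))]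
      · simp
      · intro b _ hb; simp [hb]
  exact key (N + 1) le_rfl u (by
    rw [degree_lt_iff_coeff_zero]; intro m hm
    exact coeff_eq_zero_of_natDegree_lt (by omega))

theorem coords_eq_zero {N : ℕ} (hN : 1 ≤ N) {a : ℕ → ℝ}
    (h : ∑ k ∈ Finset.range (N + 1), C (a k) * tauBasis N k = 0) {k : ℕ} (hk : k ≤ N) :
    a k = 0 := by
  induction k using Nat.strong_induction_on with
  | _ k ih =>
  have h1 := congrArg (fun q => q.coeff (N - k)) h
  simp only [finsetSum_coeff, coeff_C_mul, coeff_zero] at h1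
  rw [Finset.sum_eq_single_of_mem k (Finset.mem_range.2 (by omega))] at h1
  · exact (mul_eq_zero.1 h1).resolve_right (coeff_tauBasis_ne_zero hN hk)
  · intro l hl hlk
    rcases Nat.lt_or_gt_of_ne hlk with hl' | hl'
    · rw [ih l hl' (by omega), zero_mul]
    · rw [coeff_eq_zero_of_natDegree_lt, mul_zero]
      have := natDegree_tauBasis_le hN l
      have := Finset.mem_range.1 hl
      omega

/-! ### The weight of the second kind -/

/-- Integration against the weight `√(1 - x²)`. -/
def intU (f : ℝ[X]) : ℝ := ∫ θ in (0 : ℝ)..Real.pi, f.eval (Real.cos θ) * Real.sin θ ^ 2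

theorem intU_integrable (f : ℝ[X]) : IntervalIntegrable
    (fun θ => f.eval (Real.cos θ) * Real.sin θ ^ 2) MeasureTheory.volume 0 Real.pi :=
  Continuous.intervalIntegrable (by fun_prop) _ _

theorem intU_add (f g : ℝ[X]) : intU (f + g) = intU f + intU g := by
  rw [intU, intU, intU, ← intervalIntegral.integral_add (intU_integrable f) (intU_integrable g)]
  congr 1; funext θ; rw [eval_add]; ring

theorem intU_C_mul (c : ℝ) (f : ℝ[X]) : intU (C c * f) = c * intU f := by
  rw [intU, intU, ← intervalIntegral.integral_const_mul]
  congr 1; funext θ; rw [eval_mul, eval_C]; ring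

theorem intU_sum {ι : Type*} (s : Finset ι) (f : ι → ℝ[X]) :
    intU (∑ i ∈ s, f i) = ∑ i ∈ s, intU (f i) := by
  classical
  induction s using Finset.induction_on with
  | empty => simp [intU]
  | insert i s hi ih => rw [Finset.sum_insert hi, Finset.sum_insert hi, intU_add, ih]

theorem intU_sq_pos {f : ℝ[X]} (hf : f ≠ 0) : 0 < intU (f * f) := by
  obtain ⟨x, hx, hfx⟩ : ∃ x ∈ Set.Ioo (-1 : ℝ) 1, f.eval x ≠ 0 := by
    by_contra! h
    apply hf
    apply Polynomial.eq_zero_of_infinite_isRoot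
    exact (Set.Ioo_infinite (by norm_num : (-1 : ℝ) < 1)).mono fun x hx => h x hx
  rw [intU]
  have hpi := Real.pi_pos
  refine intervalIntegral.integral_pos hpi (by fun_prop)
    (fun θ _ => by rw [eval_mul]; exact mul_nonneg (mul_self_nonneg _) (sq_nonneg _)) ?_
  have h0 : 0 < Real.arccos x := Real.arccos_pos.2 hx.2
  have h1 : Real.arccos x < Real.pi := by
    rw [Real.arccos]; have := Real.neg_pi_div_two_lt_arcsin.2 hx.1; linarith
  refine ⟨Real.arccos x, ⟨h0.le, h1.le⟩, ?_⟩
  rw [Real.cos_arccos hx.1.le hx.2.le, eval_mul]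
  have h2 := Real.sin_pos_of_pos_of_lt_pi h0 h1
  have h3 := mul_self_pos.2 hfx
  positivity

/-- By U_n(cos θ) sin² θ = (cos nθ - cos (n+2)θ)/2, orthogonality follows from that of the
polynomials of the first kind. -/
theorem intU_interiorPoly_mul {N : ℕ} {q : ℝ[X]} (hq : q.degree < ((N - 1 : ℕ) : WithBot ℕ)) :
    intU (interiorPoly N * q) = 0 := by
  have hmem : q ∈ degreeLT ℝ (N - 1) := by rwa [mem_degreeLT]
  rw [← Sequence.span_degreeLT (Chebyshev.chebyshevTsequence ℝ) (by simp),
    show Set.Iio (N - 1) = Finset.range (N - 1) by simp,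
    Submodule.mem_span_image_finset_iff_exists_fun'] at hmem
  obtain ⟨c, rfl⟩ := hmem
  simp only [Finset.mul_sum, intU_sum]
  refine Finset.sum_eq_zero fun m hm => ?_
  have hm' := Finset.mem_range.1 hm
  have h1 := Chebyshev.integral_eval_T_real_mul_eval_T_real_measureT_of_ne
    (show N - 1 ≠ m by omega)
  have h2 := Chebyshev.integral_eval_T_real_mul_eval_T_real_measureT_of_ne
    (show N - 1 + 2 ≠ m by omega)
  rw [Chebyshev.integral_measureT_eq_integral_cos
    (f := fun x => (Chebyshev.T ℝ ((N - 1 : ℕ) : ℤ)).eval x * (Chebyshev.T ℝ m).eval x)] at h1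
  rw [Chebyshev.integral_measureT_eq_integral_cos
    (f := fun x => (Chebyshev.T ℝ ((N - 1 + 2 : ℕ) : ℤ)).eval x * (Chebyshev.T ℝ m).eval x)] at h2
  have h3 : interiorPoly N * c m • Chebyshev.chebyshevTsequence ℝ m =
      C (c m) * (interiorPoly N * Chebyshev.T ℝ m) := by
    rw [smul_eq_C_mul, Chebyshev.chebyshevTsequence]; ring
  have h4 : intU (interiorPoly N * Chebyshev.T ℝ m) = 1 / 2 * ((∫ θ in (0 : ℝ)..Real.pi,
      (Chebyshev.T ℝ ((N - 1 : ℕ) : ℤ)).eval (Real.cos θ) * (Chebyshev.T ℝ m).eval (Real.cos θ)) -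
      ∫ θ in (0 : ℝ)..Real.pi, (Chebyshev.T ℝ ((N - 1 + 2 : ℕ) : ℤ)).eval (Real.cos θ) *
      (Chebyshev.T ℝ m).eval (Real.cos θ)) := by
    rw [intU, ← intervalIntegral.integral_sub (Continuous.intervalIntegrable (by fun_prop) _ _)
      (Continuous.intervalIntegrable (by fun_prop) _ _), ← intervalIntegral.integral_const_mul]
    congr 1
    funext θ
    have hU := Chebyshev.U_real_cos θ ((N - 1 : ℕ) : ℤ)
    rw [eval_mul, interiorPoly, Chebyshev.T_real_cos _ ((N - 1 : ℕ) : ℤ),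
      Chebyshev.T_real_cos _ ((N - 1 + 2 : ℕ) : ℤ)]
    push_cast at hU ⊢
    set n := ((N - 1 : ℕ) : ℝ)
    have e1 : Real.cos (n * θ) = Real.cos ((n + 1) * θ) * Real.cos θ +
        Real.sin ((n + 1) * θ) * Real.sin θ := by
      rw [← Real.cos_sub]; congr 1; ring
    have e2 : Real.cos ((n + 2) * θ) = Real.cos ((n + 1) * θ) * Real.cos θ -
        Real.sin ((n + 1) * θ) * Real.sin θ := by
      rw [← Real.cos_add]; congr 1; ring
    rw [e1, e2]
    linear_combination (Chebyshev.T ℝ m).eval (Real.cos θ) * Real.sin θ * hU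
  rw [h3, intU_C_mul, h4, h1, h2]
  simp

/-- With y = (1 - x²) q, integration by parts gives ∫ y y'' w = -∫ (y'² + q²/2) w for the weight w =
√(1 - x²). -/
theorem intU_mul_derivative_lt {y : ℝ[X]} (h0 : y ≠ 0) (h1 : y.eval 1 = 0) (h2 : y.eval (-1) = 0) :
    intU (y * derivative (derivative y)) < 0 := by
  obtain ⟨q, hq⟩ : ∃ q, y = (1 - X ^ 2) * q := by
    obtain ⟨r, hr⟩ := dvd_iff_isRoot.2 (show y.IsRoot 1 from h1)
    have h3 : r.eval (-1) = 0 := by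
      have := h2
      rw [hr, eval_mul, eval_sub, eval_X, eval_C] at this
      exact (mul_eq_zero.1 this).resolve_left (by norm_num)
    obtain ⟨t, ht⟩ := dvd_iff_isRoot.2 (show r.IsRoot (-1) from h3)
    refine ⟨-t, ?_⟩
    rw [hr, ht, C_neg, C_1]; ring
  have hq0 : q ≠ 0 := by rintro rfl; simp at hq; exact h0 hq
  have hy1 : derivative y = -(2 * X) * q + (1 - X ^ 2) * derivative q := by
    rw [hq]; simp only [derivative_mul, derivative_sub, derivative_one, derivative_X_pow]
    simp only [Nat.cast_ofNat, C_ofNat]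
    ring
  -- An antiderivative of (y y'' + y'² + q²/2) sin² θ which vanishes at 0 and π.
  set F : ℝ → ℝ := fun θ => -Real.sin θ * (y.eval (Real.cos θ) * (derivative y).eval (Real.cos θ)) -
    1 / 2 * (Real.sin θ ^ 3 * Real.cos θ * q.eval (Real.cos θ) ^ 2)
  set G : ℝ → ℝ := fun θ => (y * derivative (derivative y)).eval (Real.cos θ) * Real.sin θ ^ 2 +
    (derivative y * derivative y + C (1 / 2) * (q * q)).eval (Real.cos θ) * Real.sin θ ^ 2
  have hev : ∀ (p : ℝ[X]) (θ : ℝ), HasDerivAt (fun θ => p.eval (Real.cos θ))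
      ((derivative p).eval (Real.cos θ) * -Real.sin θ) θ := fun p θ =>
    (p.hasDerivAt (Real.cos θ)).comp θ (Real.hasDerivAt_cos θ)
  have hF : ∀ θ, HasDerivAt F (G θ) θ := by
    intro θ
    have d1 := (Real.hasDerivAt_sin θ).neg.mul ((hev y θ).mul (hev (derivative y) θ))
    have d2 := ((((Real.hasDerivAt_sin θ).pow 3).mul (Real.hasDerivAt_cos θ)).mul
      ((hev q θ).pow 2)).const_mul (1 / 2 : ℝ)
    refine (d1.sub d2).congr_deriv ?_
    have hs := Real.sin_sq_add_cos_sq θ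
    have e1 : y.eval (Real.cos θ) = (1 - Real.cos θ ^ 2) * q.eval (Real.cos θ) := by
      rw [hq]; simp
    have e2 : (derivative y).eval (Real.cos θ) = -(2 * Real.cos θ) * q.eval (Real.cos θ) +
      (1 - Real.cos θ ^ 2) * (derivative q).eval (Real.cos θ) := by rw [hy1]; simp
    have hc : 1 - Real.cos θ ^ 2 = Real.sin θ ^ 2 := by linarith
    rw [hc] at e1 e2
    simp only [G, Pi.mul_apply, Pi.pow_apply, Pi.neg_apply, eval_mul, eval_add, eval_C]
    rw [e1, e2]
    norm_num
    linear_combination (1 / 2 * Real.sin θ ^ 2 * q.eval (Real.cos θ) ^ 2) * hs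
  have hint : ∫ θ in (0 : ℝ)..Real.pi, G θ = F Real.pi - F 0 :=
    intervalIntegral.integral_eq_sub_of_hasDerivAt (fun θ _ => hF θ)
      (Continuous.intervalIntegrable (by fun_prop) _ _)
  have hF0 : F Real.pi - F 0 = 0 := by simp [F]
  have hsplit : ∫ θ in (0 : ℝ)..Real.pi, G θ = intU (y * derivative (derivative y)) +
      intU (derivative y * derivative y + C (1 / 2) * (q * q)) :=
    intervalIntegral.integral_add (intU_integrable _) (intU_integrable _)
  rw [hint, hF0, intU_add, intU_C_mul] at hsplit
  have hq1 := intU_sq_pos hq0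
  have hy0 : derivative y ≠ 0 := by
    intro h
    have := derivative_eq_zero.1 h
    rw [eq_C_of_natDegree_eq_zero this, eval_C] at h1
    apply h0; rw [eq_C_of_natDegree_eq_zero this, h1, C_0]
  have hy2 := intU_sq_pos hy0
  linarith

/-- Replacing y by its interpolant F at the interior nodes only improves the sign of ∫ y y'' w: the
U_{N-1} component is orthogonal to y'', and the X U_{N-1} component contributes a nonnegative
multiple of N (N - 1) a₀² to ∫ y y'' w, by comparison of leading coefficients. -/
theorem intU_collocation_lt {N : ℕ} (hN : 2 ≤ N) {y F : ℝ[X]} {a₀ a₁ : ℝ} (hy : y ≠ 0)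
    (h1 : y.eval 1 = 0) (h2 : y.eval (-1) = 0)
    (hF : F.natDegree ≤ N - 2)
    (hyF : y = C a₀ * (X * interiorPoly N) + C a₁ * interiorPoly N + F) :
    intU (F * derivative (derivative y)) < 0 := by
  have hω := natDegree_interiorPoly N
  have hdeg : y.natDegree ≤ N := by
    rw [hyF]
    refine natDegree_add_le_of_degree_le (natDegree_add_le_of_degree_le ?_ ?_) (by omega)
    · refine (natDegree_C_mul_le _ _).trans ((natDegree_mul_le).trans ?_)
      rw [natDegree_X, hω]; omega
    · refine (natDegree_C_mul_le _ _).trans ?_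
      omega
  set ω := interiorPoly N
  set y2 := derivative (derivative y)
  have hy2 : y2.natDegree ≤ N - 2 :=
    (natDegree_derivative_le _).trans (by have := natDegree_derivative_le y; omega)
  have hlead : 0 < ω.coeff (N - 1) ^ 2 := by
    have : ω.coeff (N - 1) ≠ 0 := by
      have := leadingCoeff_ne_zero.2 (interiorPoly_ne_zero N)
      rwa [leadingCoeff, natDegree_interiorPoly] at this
    positivity
  have hl0 : ω.coeff (N - 1) ≠ 0 := by rintro h; rw [h] at hlead; simp at hlead
  have hyN : y.coeff N = a₀ * ω.coeff (N - 1) := by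
    obtain ⟨n, rfl⟩ : ∃ n, N = n + 1 := ⟨N - 1, by omega⟩
    rw [hyF, coeff_add, coeff_add, coeff_C_mul, coeff_X_mul, coeff_C_mul,
      coeff_eq_zero_of_natDegree_lt (p := F) (by omega),
      coeff_eq_zero_of_natDegree_lt (p := ω) (show ω.natDegree < n + 1 by omega)]
    simp
  have hyc : (X * y2).coeff (N - 1) = N * (N - 1) * y.coeff N := by
    obtain ⟨n, rfl⟩ : ∃ n, N = n + 2 := ⟨N - 2, by omega⟩
    rw [show n + 2 - 1 = n + 1 by omega, coeff_X_mul, coeff_derivative, coeff_derivative]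
    push_cast; ring
  set κ := (X * y2).coeff (N - 1) / ω.coeff (N - 1)
  have hr : intU (ω * (X * y2 - C κ * ω)) = 0 := by
    apply intU_interiorPoly_mul
    rw [degree_lt_iff_coeff_zero]
    intro m hm
    rcases Nat.eq_or_lt_of_le hm with rfl | hm
    · rw [coeff_sub, coeff_C_mul, div_mul_cancel₀ _ hl0, sub_self]
    · have : (X * y2).natDegree ≤ N - 1 := natDegree_mul_le.trans (by rw [natDegree_X]; omega)
      rw [coeff_sub, coeff_C_mul, coeff_eq_zero_of_natDegree_lt (by omega),
        coeff_eq_zero_of_natDegree_lt (p := ω) (by omega)]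
      simp
  have hr2 : intU (ω * y2) = 0 := by
    apply intU_interiorPoly_mul
    rw [degree_lt_iff_coeff_zero]
    intro m hm
    exact coeff_eq_zero_of_natDegree_lt (by omega)
  have e1 : ω * (X * y2) = ω * (X * y2 - C κ * ω) + C κ * (ω * ω) := by ring
  have e2 : y * y2 = F * y2 + C a₀ * (ω * (X * y2)) + C a₁ * (ω * y2) := by
    conv_lhs => rw [hyF]
    ring
  have h3 := intU_mul_derivative_lt hy h1 h2
  change intU (y * y2) < 0 at h3
  rw [e2, intU_add, intU_add, intU_C_mul, intU_C_mul, hr2, e1, intU_add, hr, intU_C_mul] at h3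
  have h4 := intU_sq_pos (interiorPoly_ne_zero N)
  have h5 : 0 ≤ a₀ * κ := by
    have : a₀ * κ = N * (N - 1) * a₀ ^ 2 := by
      simp only [κ]; rw [hyc, hyN]; field_simp
    rw [this]
    have : (2 : ℝ) ≤ N := by exact_mod_cast hN
    have : 0 ≤ (N : ℝ) - 1 := by linarith
    positivity
  have h6 := mul_nonneg h5 h4.le
  change 0 ≤ a₀ * κ * intU (ω * ω) at h6
  linarith

open Matrix in
/-- A Lyapunov criterion for positive definiteness. -/
theorem posDef_of_dissipative {n : Type*} [Fintype n] {A H : Matrix n n ℝ} (hA : A.PosDef)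
    (hH : H.IsHermitian)
    (h : ∀ f : n → ℝ, f ≠ 0 → ∃ g : n → ℝ, f ⬝ᵥ A *ᵥ g < 0 ∧ f ⬝ᵥ H *ᵥ g < 0) : H.PosDef := by
  classical
  have hApos : ∀ f : n → ℝ, f ≠ 0 → 0 < f ⬝ᵥ A *ᵥ f := fun f hf => by
    simpa using hA.dotProduct_mulVec_pos hf
  refine PosDef.of_dotProduct_mulVec_pos hH fun f hf => ?_
  rw [star_trivial]
  have hcont : ∀ M : Matrix n n ℝ, Continuous fun f : n → ℝ => f ⬝ᵥ M *ᵥ f := fun M => by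
    simp only [dotProduct, mulVec]; fun_prop
  have hS : (Metric.sphere (0 : n → ℝ) 1).Nonempty :=
    ⟨‖f‖⁻¹ • f, by simp [norm_smul, norm_ne_zero_iff.2 hf]⟩
  -- The minimum `b` of the Rayleigh quotient is the least generalized eigenvalue, so H f₀ = b A f₀.
  -- Testing with `g` gives two negative numbers with ratio `b`, so `b` is positive.
  obtain ⟨f₀, hf₀, hmin⟩ := (isCompact_sphere (0 : n → ℝ) 1).exists_isMinOn hS
    (f := fun f => (f ⬝ᵥ H *ᵥ f) / (f ⬝ᵥ A *ᵥ f))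
    ((hcont H).continuousOn.div (hcont A).continuousOn fun g hg =>
      (hApos g (by rintro rfl; simp at hg)).ne')
  have hf₀0 : f₀ ≠ 0 := by rintro rfl; simp at hf₀
  set b := (f₀ ⬝ᵥ H *ᵥ f₀) / (f₀ ⬝ᵥ A *ᵥ f₀)
  have hge : ∀ g : n → ℝ, b * (g ⬝ᵥ A *ᵥ g) ≤ g ⬝ᵥ H *ᵥ g := by
    intro g
    rcases eq_or_ne g 0 with rfl | hg
    · simp
    have hn := norm_ne_zero_iff.2 hg
    have h1 := hmin (show ‖g‖⁻¹ • g ∈ Metric.sphere (0 : n → ℝ) 1 by simp [norm_smul, hn])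
    change b ≤ _ at h1
    simp only [mulVec_smul, dotProduct_smul, smul_dotProduct, smul_eq_mul] at h1
    have h2 := hApos g hg
    rw [mul_div_mul_left _ _ (inv_ne_zero hn), mul_div_mul_left _ _ (inv_ne_zero hn),
      le_div_iff₀ h2] at h1
    exact h1
  have hK : (H - b • A).PosSemidef := by
    refine PosSemidef.of_dotProduct_mulVec_nonneg (hH.sub ?_) fun g => ?_
    · rw [IsHermitian, conjTranspose_smul, hA.1.eq, star_trivial]
    · rw [star_trivial, sub_mulVec, dotProduct_sub, smul_mulVec, dotProduct_smul, smul_eq_mul]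
      linarith [hge g]
  have hK0 : (H - b • A) *ᵥ f₀ = 0 := by
    rw [← hK.dotProduct_mulVec_zero_iff, star_trivial, sub_mulVec, dotProduct_sub, smul_mulVec,
      dotProduct_smul, smul_eq_mul, div_mul_cancel₀ _ (hApos f₀ hf₀0).ne', sub_self]
  obtain ⟨g, hg1, hg2⟩ := h f₀ hf₀0
  have hsymm : ∀ M : Matrix n n ℝ, M.IsHermitian → f₀ ⬝ᵥ M *ᵥ g = g ⬝ᵥ M *ᵥ f₀ := by
    intro M hM
    rw [dotProduct_mulVec, ← mulVec_transpose, (isHermitian_iff_isSymm.1 hM).eq, dotProduct_comm]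
  have hb : f₀ ⬝ᵥ H *ᵥ g = b * (f₀ ⬝ᵥ A *ᵥ g) := by
    rw [hsymm H hH, hsymm A hA.1]
    have := congrArg (fun v => g ⬝ᵥ v) hK0
    simp only [sub_mulVec, dotProduct_sub, smul_mulVec, dotProduct_smul, smul_eq_mul,
      dotProduct_zero] at this
    linarith
  have hbpos : 0 < b := by
    rw [hb] at hg2
    by_contra hb0
    nlinarith
  exact lt_of_lt_of_le (mul_pos hbpos (hApos f hf)) (hge f)

/-! ### The interior Chebyshev nodes -/

/-- The interior Chebyshev nodes. -/
def inode (N : ℕ) (j : Fin (N - 1)) : ℝ := node (N + 1) (j + 1)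

theorem node_eq_cos (N j : ℕ) :
    node (N + 1) j = Real.cos (Real.pi - Real.pi * j / N) := by
  rw [node, Real.cos_pi_sub]; push_cast; simp

theorem node_injOn {N : ℕ} (hN : 1 ≤ N) {i j : ℕ} (hi : i ≤ N) (hj : j ≤ N)
    (h : node (N + 1) i = node (N + 1) j) : i = j := by
  have hN' : (0 : ℝ) < N := by exact_mod_cast hN
  have hpi := Real.pi_pos
  have hmem : ∀ k : ℕ, k ≤ N → Real.pi * k / N ∈ Set.Icc 0 Real.pi := by
    intro k hk
    have : (k : ℝ) ≤ N := by exact_mod_cast hk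
    refine ⟨by positivity, ?_⟩
    rw [div_le_iff₀ hN']; gcongr
  rw [node, node, neg_inj] at h
  push_cast at h
  rw [add_sub_cancel_right] at h
  have := Real.injOn_cos (hmem i hi) (hmem j hj) h
  field_simp at this
  exact_mod_cast this

theorem inode_injective (N : ℕ) : Function.Injective (inode N) := by
  intro i j h
  have hi := i.2
  have hj := j.2
  have := node_injOn (N := N) (i := (i : ℕ) + 1) (j := (j : ℕ) + 1) (by omega) (by omega) (by omega) h
  exact Fin.ext (by omega)

theorem interiorPoly_eval_inode (N : ℕ) (j : Fin (N - 1)) :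
    (interiorPoly N).eval (inode N j) = 0 := by
  have hj := j.2
  have hN' : (0 : ℝ) < N := by have : 0 < N := by omega
                               exact_mod_cast this
  rw [inode, node_eq_cos]
  set θ := Real.pi - Real.pi * ((j : ℕ) + 1 : ℕ) / N with hθ
  have h := Chebyshev.U_real_cos θ ((N - 1 : ℕ) : ℤ)
  have hpi := Real.pi_pos
  have hs : 0 < Real.sin θ := by
    have hj' : (((j : ℕ) + 1 : ℕ) : ℝ) < N := by exact_mod_cast (by omega : (j : ℕ) + 1 < N)
    apply Real.sin_pos_of_pos_of_lt_pi
    · rw [hθ, sub_pos, div_lt_iff₀ hN']; gcongr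
    · rw [hθ]
      have : 0 < Real.pi * (((j : ℕ) + 1 : ℕ) : ℝ) / N := by positivity
      linarith
  have hN1 : (((N - 1 : ℕ) : ℤ) : ℝ) + 1 = N := by
    push_cast [Nat.cast_sub (show 1 ≤ N by omega)]; ring
  rw [hN1, show (N : ℝ) * θ = ((N : ℤ) - ((j : ℕ) + 1 : ℕ) : ℤ) * Real.pi by
    rw [hθ]; push_cast; field_simp, Real.sin_int_mul_pi] at h
  exact (mul_eq_zero.1 h).resolve_right hs.ne'

theorem eq_zero_of_inode {N : ℕ} {q : ℝ[X]} (hq : q.natDegree < N - 1)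
    (h : ∀ j, q.eval (inode N j) = 0) : q = 0 := by
  refine Polynomial.eq_zero_of_degree_lt_of_eval_index_eq_zero (s := Finset.univ) (v := inode N)
    (fun i _ j _ hij => inode_injective N hij) ?_ (fun j _ => h j)
  rw [Finset.card_univ, Fintype.card_fin]
  exact lt_of_le_of_lt degree_le_natDegree (by exact_mod_cast hq)

/-- Values at the interior Chebyshev nodes. -/
def nodal (N : ℕ) (u : ℝ[X]) (j : Fin (N - 1)) : ℝ := u.eval (inode N j)

/-- Values of the higher basis polynomials at the interior nodes. -/
def vander (N : ℕ) : Matrix (Fin (N - 1)) (Fin (N - 1)) ℝ :=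
  fun j k => (tauBasis N (k + 2)).eval (inode N j)

theorem tauBasis_zero (N : ℕ) : tauBasis N 0 = X * interiorPoly N := by simp [tauBasis, tauGen]

theorem tauBasis_one (N : ℕ) : tauBasis N 1 = interiorPoly N := by simp [tauBasis, tauGen]

/-- The first two basis polynomials vanish at the interior nodes. -/
theorem vander_mulVec_tail {N : ℕ} (hN : 1 ≤ N) (a : ℕ → ℝ) :
    (vander N).mulVec (fun k => a (k + 2)) =
      nodal N (∑ k ∈ Finset.range (N + 1), C (a k) * tauBasis N k) := by
  funext j
  have h := interiorPoly_eval_inode N j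
  rw [nodal, show N + 1 = (N - 1) + 1 + 1 by omega, Finset.sum_range_succ', Finset.sum_range_succ',
    tauBasis_zero, zero_add, tauBasis_one, eval_add, eval_add, eval_mul, eval_mul, eval_mul, h,
    mul_zero, mul_zero, mul_zero, add_zero, add_zero, eval_finsetSum, Finset.sum_range,
    Matrix.mulVec, dotProduct]
  exact Finset.sum_congr rfl fun k _ => by rw [vander, eval_mul, eval_C, mul_comm]

/-- Differentiating twice moves coordinate `k` to `k + 2` and kills the last two. So the same matrix
serves u and u'', applied to the tail and to the head of the coordinates. -/
theorem vander_mulVec_head {N : ℕ} (hN : 1 ≤ N) (a : ℕ → ℝ) :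
    (vander N).mulVec (fun k => a k) =
      nodal N (derivative (derivative (∑ k ∈ Finset.range (N + 1), C (a k) * tauBasis N k))) := by
  funext j
  rw [nodal, show N + 1 = (N - 1) + 1 + 1 by omega, Finset.sum_range_succ, Finset.sum_range_succ]
  simp only [derivative_add, derivative_sum, derivative_C_mul, ← tauBasis_add_two]
  rw [tauBasis_eq_zero hN (show N < N - 1 + 2 by omega),
    tauBasis_eq_zero hN (show N < N - 1 + 1 + 2 by omega), mul_zero, add_zero, mul_zero, add_zero,
    eval_finsetSum, Finset.sum_range,
    Matrix.mulVec, dotProduct]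
  exact Finset.sum_congr rfl fun k _ => by rw [vander, eval_mul, eval_C, mul_comm]

theorem isUnit_vander {N : ℕ} (hN : 1 ≤ N) : IsUnit (vander N) := by
  rw [← Matrix.mulVec_injective_iff_isUnit]
  rw [← Matrix.coe_mulVecLin]
  rw [← LinearMap.ker_eq_bot, LinearMap.ker_eq_bot']
  intro α hα
  rw [Matrix.mulVecLin_apply] at hα
  set a : ℕ → ℝ := fun k => if h : 2 ≤ k ∧ k - 2 < N - 1 then α ⟨k - 2, h.2⟩ else 0 with ha
  have h1 : (fun k : Fin (N - 1) => a (k + 2)) = α := by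
    funext k; simp [ha]
  have h2 := vander_mulVec_tail hN a
  rw [h1, hα] at h2
  set q := ∑ k ∈ Finset.range (N + 1), C (a k) * tauBasis N k with hq
  have hz : q = 0 := by
    rcases Nat.lt_or_ge N 2 with hN2 | hN2
    · refine Finset.sum_eq_zero fun k hk => ?_
      have := Finset.mem_range.1 hk
      rw [show a k = 0 from dif_neg (by omega), C_0, zero_mul]
    refine eq_zero_of_inode (N := N) ?_ fun j => (congrFun h2 j).symm
    refine lt_of_le_of_lt (natDegree_sum_le_of_forall_le (n := N - 2) _ _ fun k _ => ?_) (by omega)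
    rcases Nat.lt_or_ge k 2 with hk | hk
    · rw [show a k = 0 from dif_neg (by omega), C_0, zero_mul, natDegree_zero]; omega
    · exact (natDegree_C_mul_le _ _).trans ((natDegree_tauBasis_le hN k).trans (by omega))
  funext k
  rw [← h1]
  exact coords_eq_zero hN hz (by omega)

/-! ### The dissipative form on interior nodal values -/

/-- The matrix of `coordForm` on the higher coordinates. -/
def coordMat (N : ℕ) : Matrix (Fin (N - 1)) (Fin (N - 1)) ℝ :=
  fun k l => coordForm N (k + 2) (l + 2)

/-- The symmetric form on interior nodal values. -/
def nodalMat (N : ℕ) : Matrix (Fin (N - 1)) (Fin (N - 1)) ℝ :=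
  ((vander N)⁻¹).transpose * coordMat N * (vander N)⁻¹

open Matrix in
theorem nodalMat_isHermitian (N : ℕ) : (nodalMat N).IsHermitian := by
  rw [isHermitian_iff_isSymm, nodalMat, Matrix.IsSymm]
  have : (coordMat N)ᵀ = coordMat N := by
    ext k l; exact coordForm_comm N _ _
  rw [transpose_mul, transpose_mul, transpose_transpose, this, Matrix.mul_assoc]

-- The two factors `vander` undo the passage to nodal values. Restricting `sum_coordForm` to the
-- remaining indices loses nothing, because the first two rows and the columns beyond `N` of
-- `coordForm` vanish.
open Matrix in
theorem nodalMat_apply {N : ℕ} (hN : 1 ≤ N) (a : ℕ → ℝ) {u : ℝ[X]}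
    (hu : u = ∑ k ∈ Finset.range (N + 1), C (a k) * tauBasis N k) :
    nodal N u ⬝ᵥ nodalMat N *ᵥ nodal N (derivative (derivative u)) =
      bdryForm u u - ∑ k ∈ Finset.range (N + 1), 2 * dissip N k * a k ^ 2 := by
  have hdet := (Matrix.isUnit_iff_isUnit_det _).1 (isUnit_vander hN)
  have h1 := sum_coordForm hN a
  rw [← hu] at h1
  have h2 := vander_mulVec_tail hN a
  have h3 := vander_mulVec_head hN a
  rw [← hu] at h2 h3
  rw [← h1, ← h2, ← h3, nodalMat, mulVec_mulVec, Matrix.mul_assoc, Matrix.mul_assoc,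
    nonsing_inv_mul _ hdet, Matrix.mul_one, ← mulVec_mulVec, dotProduct_mulVec, vecMul_transpose,
    mulVec_mulVec, nonsing_inv_mul _ hdet, one_mulVec]
  rw [show N + 1 = (N - 1) + 1 + 1 by omega, Finset.sum_range_succ', Finset.sum_range_succ']
  simp only [coordForm_of_lt_two N (show 0 < 2 by omega),
    coordForm_of_lt_two N (show 0 + 1 < 2 by omega), mul_zero, Finset.sum_const_zero, add_zero]
  rw [Finset.sum_range, dotProduct]
  refine Finset.sum_congr rfl fun k _ => ?_
  rw [Finset.sum_range_succ, Finset.sum_range_succ, coordForm_eq_zero hN _ (show N < N - 1 + 2 by omega),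
    coordForm_eq_zero hN _ (show N < N - 1 + 1 + 2 by omega), mul_zero, add_zero, mul_zero, add_zero,
    Finset.sum_range, mulVec, dotProduct, Finset.mul_sum]
  refine Finset.sum_congr rfl fun l _ => ?_
  rw [coordMat]; ring

/-- The Gram matrix of the Lagrange basis for the weight of the second kind. -/
def gramU (N : ℕ) : Matrix (Fin (N - 1)) (Fin (N - 1)) ℝ :=
  fun i j => intU (Lagrange.basis Finset.univ (inode N) i * Lagrange.basis Finset.univ (inode N) j)

open Matrix in
theorem gramU_apply (N : ℕ) (f g : Fin (N - 1) → ℝ) : f ⬝ᵥ gramU N *ᵥ g =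
    intU (Lagrange.interpolate Finset.univ (inode N) f *
      Lagrange.interpolate Finset.univ (inode N) g) := by
  rw [Lagrange.interpolate_apply, Lagrange.interpolate_apply, Finset.sum_mul_sum, intU_sum,
    dotProduct]
  refine Finset.sum_congr rfl fun i _ => ?_
  rw [intU_sum, mulVec, dotProduct, Finset.mul_sum]
  refine Finset.sum_congr rfl fun j _ => ?_
  rw [show C (f i) * Lagrange.basis Finset.univ (inode N) i *
    (C (g j) * Lagrange.basis Finset.univ (inode N) j) = C (f i) * (C (g j) *
    (Lagrange.basis Finset.univ (inode N) i * Lagrange.basis Finset.univ (inode N) j)) by ring,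
    intU_C_mul, intU_C_mul, gramU]
  ring

theorem interpolate_nodal {N : ℕ} {q : ℝ[X]} (hq : q.natDegree < N - 1) :
    Lagrange.interpolate Finset.univ (inode N) (nodal N q) = q := by
  refine (Lagrange.eq_interpolate_of_eval_eq _ (fun i _ j _ hij => inode_injective N hij) ?_
    fun _ _ => rfl).symm
  rw [Finset.card_univ, Fintype.card_fin]
  exact lt_of_le_of_lt degree_le_natDegree (by exact_mod_cast hq)

theorem gramU_posDef (N : ℕ) : (gramU N).PosDef := by
  refine Matrix.PosDef.of_dotProduct_mulVec_pos ?_ fun f hf => ?_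
  · rw [Matrix.isHermitian_iff_isSymm]
    ext i j
    rw [Matrix.transpose_apply, gramU, gramU, mul_comm]
  · rw [star_trivial, gramU_apply]
    apply intU_sq_pos
    intro h
    apply hf
    funext j
    have := Lagrange.eval_interpolate_at_node f (s := Finset.univ) (v := inode N)
      (fun i _ j _ hij => inode_injective N hij) (Finset.mem_univ j)
    rw [h, eval_zero] at this
    exact this.symm

/-- Interpolation at the interior nodes with zero boundary values. -/
theorem exists_dirichlet {N : ℕ} (hN : 1 ≤ N) (f : Fin (N - 1) → ℝ) :
    ∃ y : ℝ[X], y.natDegree ≤ N ∧ y.eval 1 = 0 ∧ y.eval (-1) = 0 ∧ nodal N y = f := by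
  have hne : ∀ j, (1 - inode N j ^ 2) ≠ 0 := by
    intro j h
    have h0 : (inode N j - 1) * (inode N j + 1) = 0 := by linarith
    have hN' : (N : ℝ) ≠ 0 := by have : N ≠ 0 := by omega
                                 exact_mod_cast this
    rcases mul_eq_zero.1 h0 with h1 | h1
    · have : node (N + 1) (j + 1) = node (N + 1) N := by
        rw [show node (N + 1) (j + 1) = inode N j from rfl, node_eq_cos N N, mul_div_assoc,
          div_self hN']; simp; linarith
      have := node_injOn hN (by omega) le_rfl this
      omega
    · have : node (N + 1) (j + 1) = node (N + 1) 0 := by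
        rw [show node (N + 1) (j + 1) = inode N j from rfl, node_eq_cos N 0]; simp; linarith
      have := node_injOn hN (by omega) (by omega) this
      omega
  refine ⟨(1 - X ^ 2) * Lagrange.interpolate Finset.univ (inode N)
    (fun j => f j / (1 - inode N j ^ 2)), ?_, by simp, by simp, ?_⟩
  · rcases Nat.lt_or_ge N 2 with h2 | h2
    · have : IsEmpty (Fin (N - 1)) := by
        rw [show N - 1 = 0 by omega]; infer_instance
      simp [Lagrange.interpolate_apply]
    have h1 := Lagrange.degree_interpolate_lt (s := Finset.univ) (v := inode N)
      (fun j => f j / (1 - inode N j ^ 2)) (fun i _ j _ hij => inode_injective N hij)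
    rw [Finset.card_univ, Fintype.card_fin] at h1
    have h3 : (Lagrange.interpolate Finset.univ (inode N)
        (fun j => f j / (1 - inode N j ^ 2))).natDegree ≤ N - 2 := by
      rw [natDegree_le_iff_coeff_eq_zero]
      intro m hm
      exact (degree_lt_iff_coeff_zero _ _).1 h1 m (by exact_mod_cast (by omega : N - 1 ≤ m))
    have h4 : (1 - X ^ 2 : ℝ[X]).natDegree ≤ 2 := by compute_degree
    exact natDegree_mul_le.trans (by omega)
  · funext j
    rw [nodal, eval_mul, Lagrange.eval_interpolate_at_node _
      (fun i _ j _ hij => inode_injective N hij) (Finset.mem_univ j)]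
    simp only [eval_sub, eval_one, eval_pow, eval_X]
    exact mul_div_cancel₀ _ (hne j)

/-- Apply the Lyapunov criterion with the Dirichlet interpolant y of the given values and the values
of y''. For `nodalMat` the boundary form drops out; zero dissipation would leave only the last
coordinate, hence a constant y, which vanishes at the ends. -/
theorem nodalMat_posDef {N : ℕ} (hN : 2 ≤ N) : (nodalMat N).PosDef := by
  have hN1 : 1 ≤ N := by omega
  refine posDef_of_dissipative (gramU_posDef N) (nodalMat_isHermitian N) fun f hf => ?_
  obtain ⟨y, hy, h1, h2, rfl⟩ := exists_dirichlet hN1 f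
  have hy0 : y ≠ 0 := by
    rintro rfl; apply hf; funext j; simp [nodal]
  obtain ⟨a, ha⟩ := exists_coords hN1 hy
  refine ⟨nodal N (derivative (derivative y)), ?_, ?_⟩
  · have hs : y = C (a 0) * (X * interiorPoly N) + C (a 1) * interiorPoly N +
        ∑ k ∈ Finset.range (N - 1), C (a (k + 2)) * tauBasis N (k + 2) := by
      rw [ha, show N + 1 = (N - 1) + 1 + 1 by omega, Finset.sum_range_succ',
        Finset.sum_range_succ', tauBasis_zero, zero_add, tauBasis_one]
      ring
    set F := ∑ k ∈ Finset.range (N - 1), C (a (k + 2)) * tauBasis N (k + 2)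
    have hF : F.natDegree ≤ N - 2 := natDegree_sum_le_of_forall_le _ _ fun k _ =>
      (natDegree_C_mul_le _ _).trans ((natDegree_tauBasis_le hN1 _).trans (by omega))
    have hFy : nodal N y = nodal N F := by
      funext j
      rw [nodal, nodal, hs]
      simp [interiorPoly_eval_inode]
    have hd : (derivative (derivative y)).natDegree < N - 1 := by
      have e1 := natDegree_derivative_le y
      have e2 := natDegree_derivative_le (derivative y)
      omega
    rw [gramU_apply, hFy, interpolate_nodal (by omega), interpolate_nodal hd]
    exact intU_collocation_lt hN hy0 h1 h2 hF hs
  · rw [nodalMat_apply hN1 a ha]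
    have hb : bdryForm y y = 0 := by rw [bdryForm, h1, h2]; ring
    rw [hb, zero_sub, neg_lt_zero]
    have hnn : ∀ k ∈ Finset.range (N + 1), 0 ≤ 2 * dissip N k * a k ^ 2 := fun k _ => by
      have := dissip_nonneg hN k; positivity
    refine lt_of_le_of_ne (Finset.sum_nonneg hnn) fun h => ?_
    have hz := (Finset.sum_eq_zero_iff_of_nonneg hnn).1 h.symm
    have ha0 : ∀ k < N, a k = 0 := by
      intro k hk
      have h3 := hz k (Finset.mem_range.2 (by omega))
      have h4 := dissip_pos hN hk
      by_contra h5
      have : 0 < 2 * dissip N k * a k ^ 2 := by positivity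
      linarith
    rw [Finset.sum_range_succ, Finset.sum_eq_zero (fun k hk => by
      rw [ha0 k (Finset.mem_range.1 hk), C_0, zero_mul]), zero_add] at ha
    have hdeg : y.natDegree = 0 := by
      have := (natDegree_C_mul_le (a N) (tauBasis N N)).trans (natDegree_tauBasis_le hN1 N)
      rw [← ha] at this; omega
    rw [eq_C_of_natDegree_eq_zero hdeg, eval_C] at h1
    apply hy0; rw [eq_C_of_natDegree_eq_zero hdeg, h1, C_0]

open Matrix in
/-- There is a symmetric positive definite form on the interior nodal values for which the
one-dimensional collocated second derivative is dissipative up to the boundary terms. -/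
theorem exists_rows {N : ℕ} (hN : 2 ≤ N) : ∃ (m : ℕ) (L : Fin m → Fin (N - 1) → ℝ),
    (∀ f : Fin (N - 1) → ℝ, (∀ s, L s ⬝ᵥ f = 0) → f = 0) ∧
    ∀ u : ℝ[X], u.natDegree ≤ N →
      ∑ s, (L s ⬝ᵥ nodal N u) * (L s ⬝ᵥ nodal N (derivative (derivative u))) ≤ bdryForm u u := by
  have hB := nodalMat_posDef hN
  -- As a sum of squares of functionals the form can be tensorized, by applying one functional in
  -- each direction.
  obtain ⟨m, L, hL⟩ := posSemidef_iff_eq_sum_vecMulVec.1 hB.posSemidef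
  have hform : ∀ f g : Fin (N - 1) → ℝ, f ⬝ᵥ nodalMat N *ᵥ g = ∑ s, (L s ⬝ᵥ f) * (L s ⬝ᵥ g) := by
    intro f g
    rw [hL, sum_mulVec, dotProduct_sum]
    refine Finset.sum_congr rfl fun s _ => ?_
    rw [star_trivial, vecMulVec_mulVec, dotProduct_smul, dotProduct_comm f]
    simp
  refine ⟨m, L, fun f hf => ?_, fun u hu => ?_⟩
  · by_contra h
    have := hB.dotProduct_mulVec_pos h
    rw [star_trivial, hform] at this
    simp [hf] at this
  · obtain ⟨a, ha⟩ := exists_coords (by omega) hu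
    rw [← hform, nodalMat_apply (by omega) a ha]
    have : 0 ≤ ∑ k ∈ Finset.range (N + 1), 2 * dissip N k * a k ^ 2 :=
      Finset.sum_nonneg fun k _ => by have := dissip_nonneg hN k; positivity
    linarith

/-! ### Control of the end values -/

theorem sq_sum_mul_le {ι : Type*} (s : Finset ι) (f b : ι → ℝ) {K : ℝ} (h : ∑ j ∈ s, b j ^ 2 ≤ K) :
    (∑ j ∈ s, f j * b j) ^ 2 ≤ K * ∑ j ∈ s, f j ^ 2 := by
  refine (Finset.sum_mul_sq_le_sq_mul_sq s f b).trans ?_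
  rw [mul_comm]
  exact mul_le_mul_of_nonneg_right h (Finset.sum_nonneg fun j _ => sq_nonneg _)

/-- The end values and end slopes of a polynomial of low degree are controlled by its values at
the interior nodes. -/
theorem exists_end_bound (N : ℕ) : ∃ K : ℝ, 0 ≤ K ∧ ∀ F : ℝ[X], F.natDegree < N - 1 →
    ∀ x : ℝ, x = 1 ∨ x = -1 → F.eval x ^ 2 ≤ K * ∑ j, nodal N F j ^ 2 ∧
      (derivative F).eval x ^ 2 ≤ K * ∑ j, nodal N F j ^ 2 := by
  set l := Lagrange.basis Finset.univ (inode N) with hl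
  -- The Cauchy–Schwarz constant of the Lagrange representation at the end point `x`.
  set k : ℝ → ℝ := fun x => ∑ j, (l j).eval x ^ 2 + ∑ j, (derivative (l j)).eval x ^ 2 with hk
  have h1 : ∀ x, 0 ≤ ∑ j, (l j).eval x ^ 2 := fun x => Finset.sum_nonneg fun j _ => sq_nonneg _
  have h2 : ∀ x, 0 ≤ ∑ j, (derivative (l j)).eval x ^ 2 :=
    fun x => Finset.sum_nonneg fun j _ => sq_nonneg _
  have hk0 : ∀ x, 0 ≤ k x := fun x => add_nonneg (h1 x) (h2 x)
  refine ⟨k 1 + k (-1), add_nonneg (hk0 _) (hk0 _), fun F hF x hx => ?_⟩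
  have hle : k x ≤ k 1 + k (-1) := by
    rcases hx with rfl | rfl
    · linarith [hk0 (-1)]
    · linarith [hk0 1]
  have hs : F = ∑ j, C (nodal N F j) * l j := by
    rw [← Lagrange.interpolate_apply, interpolate_nodal hF]
  have e1 : F.eval x = ∑ j, nodal N F j * (l j).eval x := by
    conv_lhs => rw [hs]
    rw [eval_finsetSum]; simp
  have e2 : (derivative F).eval x = ∑ j, nodal N F j * (derivative (l j)).eval x := by
    conv_lhs => rw [hs]
    rw [derivative_sum, eval_finsetSum]; simp
  rw [e1, e2]
  exact ⟨sq_sum_mul_le _ _ _ (by linarith [h2 x]), sq_sum_mul_le _ _ _ (by linarith [h1 x])⟩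

theorem exists_interior_decomp {N : ℕ} (hN : 2 ≤ N) {u : ℝ[X]} (hu : u.natDegree ≤ N) :
    ∃ (a b : ℝ) (F : ℝ[X]), F.natDegree < N - 1 ∧ nodal N F = nodal N u ∧
      u = C a * (X * interiorPoly N) + C b * interiorPoly N + F := by
  obtain ⟨a, ha⟩ := exists_coords (by omega) hu
  have hs : u = C (a 0) * (X * interiorPoly N) + C (a 1) * interiorPoly N +
      ∑ k ∈ Finset.range (N - 1), C (a (k + 2)) * tauBasis N (k + 2) := by
    rw [ha, show N + 1 = (N - 1) + 1 + 1 by omega, Finset.sum_range_succ',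
      Finset.sum_range_succ', tauBasis_zero, zero_add, tauBasis_one]
    ring
  refine ⟨a 0, a 1, _, ?_, ?_, hs⟩
  · refine lt_of_le_of_lt (natDegree_sum_le_of_forall_le (n := N - 2) _ _ fun k _ => ?_) (by omega)
    exact (natDegree_C_mul_le _ _).trans ((natDegree_tauBasis_le (by omega) _).trans (by omega))
  · funext j
    conv_rhs => rw [nodal, hs]
    rw [nodal]
    simp [interiorPoly_eval_inode]

theorem neg_mul_le_of_sq {x p δ : ℝ} (hδ : 0 < δ) : -(x * p) ≤ δ * x ^ 2 + p ^ 2 / (4 * δ) := by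
  have : δ * x ^ 2 + p ^ 2 / (4 * δ) + x * p = (2 * δ * x + p) ^ 2 / (4 * δ) := by
    field_simp; ring
  have h2 : 0 ≤ (2 * δ * x + p) ^ 2 / (4 * δ) := by positivity
  linarith

/-- For (aX + b)ω with ω = U_{N-1}, w = ω(1), w' = ω'(1), the boundary form is 2a²w² + 2(a² +
b²)ww', which is coercive in (a, b). The end values `p` and end slopes `q` of the remainder F are
absorbed by Young's inequality. -/
theorem end_bound_aux {w w' s K₀ S a b p₁ p₂ q₁ q₂ δ D₀ M : ℝ} (hw0 : 0 < w) (hw'0 : 0 < w')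
    (hs2 : s ^ 2 = 1) (hK₀ : 0 ≤ K₀) (hS0 : 0 ≤ S) (hδ : δ = w * w' / 5)
    (hD₀ : D₀ = 2 * w ^ 2 + 2 * w' ^ 2) (hM : M = 3 * (D₀ / (4 * δ) + 1))
    (f1 : p₁ ^ 2 ≤ K₀ * S) (f2 : q₁ ^ 2 ≤ K₀ * S) (f3 : p₂ ^ 2 ≤ K₀ * S) (f4 : q₂ ^ 2 ≤ K₀ * S) :
    ((a + b) * w + p₁) ^ 2 + ((b - a) * (s * w) + p₂) ^ 2 ≤
      4 * w / w' * (((a + b) * w + p₁) * (a * w + (a + b) * w' + q₁) -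
      ((b - a) * (s * w) + p₂) * (a * (s * w) - (b - a) * (s * w') + q₂)) +
      (4 * w / w' * (4 * M * K₀) + 8 * K₀) * S := by
  have hδ0 : 0 < δ := by rw [hδ]; positivity
  obtain ⟨P, hP⟩ : ∃ P, P = w * q₁ + w' * p₁ := ⟨_, rfl⟩
  obtain ⟨Q, hQ⟩ : ∃ Q, Q = w * p₁ - s * w * p₂ := ⟨_, rfl⟩
  obtain ⟨R, hR⟩ : ∃ R, R = s * w' * p₂ - s * w * q₂ := ⟨_, rfl⟩
  have hcalc : ((a + b) * w + p₁) * (a * w + (a + b) * w' + q₁) -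
      ((b - a) * (s * w) + p₂) * (a * (s * w) - (b - a) * (s * w') + q₂) =
      2 * a ^ 2 * w ^ 2 + 2 * (a ^ 2 + b ^ 2) * (w * w') + ((a + b) * P + a * Q + (b - a) * R) +
        (p₁ * q₁ - p₂ * q₂) := by
    have : ((a + b) * w + p₁) * (a * w + (a + b) * w' + q₁) -
      ((b - a) * (s * w) + p₂) * (a * (s * w) - (b - a) * (s * w') + q₂) =
      (a + b) * w * (a * w + (a + b) * w') - s ^ 2 * ((b - a) * w * (a * w - (b - a) * w')) +
       ((a + b) * P + a * Q + (b - a) * R) + (p₁ * q₁ - p₂ * q₂) := by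
      rw [hP, hQ, hR]; ring
    rw [this, hs2]; ring
  rw [hcalc]
  have hD₀D : D₀ * (2 * K₀ * S) = (2 * w ^ 2 + 2 * w' ^ 2) * (2 * K₀ * S) := by rw [hD₀]
  have hPb : P ^ 2 ≤ D₀ * (2 * K₀ * S) := by
    have : P ^ 2 + (w * p₁ - w' * q₁) ^ 2 = (w ^ 2 + w' ^ 2) * (p₁ ^ 2 + q₁ ^ 2) := by rw [hP]; ring
    have h2 : (w ^ 2 + w' ^ 2) * (p₁ ^ 2 + q₁ ^ 2) ≤ (w ^ 2 + w' ^ 2) * (2 * (K₀ * S)) :=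
      mul_le_mul_of_nonneg_left (by linarith) (by positivity)
    have h3 : 0 ≤ (w ^ 2 + w' ^ 2) * (K₀ * S) := by positivity
    linarith only [this, h2, h3, hD₀D, sq_nonneg (w * p₁ - w' * q₁)]
  have hRb : R ^ 2 ≤ D₀ * (2 * K₀ * S) := by
    have : R ^ 2 + s ^ 2 * (w * p₂ + w' * q₂) ^ 2 = s ^ 2 * ((w ^ 2 + w' ^ 2) * (p₂ ^ 2 + q₂ ^ 2)) := by
      rw [hR]; ring
    rw [hs2] at this
    have h2 : (w ^ 2 + w' ^ 2) * (p₂ ^ 2 + q₂ ^ 2) ≤ (w ^ 2 + w' ^ 2) * (2 * (K₀ * S)) :=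
      mul_le_mul_of_nonneg_left (by linarith) (by positivity)
    have h3 : 0 ≤ (w ^ 2 + w' ^ 2) * (K₀ * S) := by positivity
    linarith only [this, h2, h3, hD₀D, sq_nonneg (w * p₂ + w' * q₂)]
  have hQb : Q ^ 2 ≤ D₀ * (2 * K₀ * S) := by
    have : Q ^ 2 + w ^ 2 * (s * p₁ + p₂) ^ 2 = w ^ 2 * (1 + s ^ 2) * (p₁ ^ 2 + p₂ ^ 2) := by
      rw [hQ]; ring
    rw [hs2] at this
    have h2 : w ^ 2 * (p₁ ^ 2 + p₂ ^ 2) ≤ w ^ 2 * (2 * (K₀ * S)) :=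
      mul_le_mul_of_nonneg_left (by linarith) (by positivity)
    have h3 : 0 ≤ w' ^ 2 * (K₀ * S) := by positivity
    have h4 : 0 ≤ w ^ 2 * (s * p₁ + p₂) ^ 2 := by positivity
    rw [hD₀]; linarith
  have hdiv : ∀ Z : ℝ, Z ^ 2 ≤ D₀ * (2 * K₀ * S) → Z ^ 2 / (4 * δ) ≤ D₀ / (4 * δ) * (2 * K₀ * S) := by
    intro Z hZ
    rw [div_mul_eq_mul_div]; gcongr
  have c1 := neg_mul_le_of_sq (x := a + b) (p := P) hδ0
  have c2 := neg_mul_le_of_sq (x := a) (p := Q) hδ0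
  have c3 := neg_mul_le_of_sq (x := b - a) (p := R) hδ0
  have d1 := hdiv P hPb
  have d2 := hdiv Q hQb
  have d3 := hdiv R hRb
  have e1 : -(p₁ * q₁ - p₂ * q₂) ≤ 2 * (K₀ * S) := by
    linarith only [sq_nonneg (p₁ + q₁), sq_nonneg (p₂ - q₂), f1, f2, f3, f4]
  -- The sum of squares is 3a² + 2b², so the 5 in `δ` makes the absorbed terms cost at most half of
  -- 2(a² + b²)ww'.
  have hδA : δ * ((a + b) ^ 2 + a ^ 2 + (b - a) ^ 2) ≤ w * w' * (a ^ 2 + b ^ 2) := by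
    rw [hδ]
    have : 0 < w * w' := by positivity
    linarith only [mul_nonneg this.le (sq_nonneg b), mul_nonneg this.le (sq_nonneg a)]
  obtain ⟨A, hA⟩ : ∃ A, A = a ^ 2 + b ^ 2 := ⟨_, rfl⟩
  rw [← hA] at hδA ⊢
  obtain ⟨T, hT⟩ : ∃ T, T = 2 * a ^ 2 * w ^ 2 + 2 * A * (w * w') + ((a + b) * P + a * Q + (b - a) * R) +
        (p₁ * q₁ - p₂ * q₂) := ⟨_, rfl⟩
  rw [← hT]
  have hmain : w * w' * A ≤ T + 4 * M * K₀ * S := by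
    have h0 : 0 ≤ 2 * a ^ 2 * w ^ 2 := by positivity
    have h1 : 0 ≤ D₀ / (4 * δ) * (K₀ * S) := by rw [hD₀]; positivity
    have h2 : 0 ≤ K₀ * S := by positivity
    have h3 : 4 * M * K₀ * S = 12 * (D₀ / (4 * δ) * (K₀ * S)) + 12 * (K₀ * S) := by rw [hM]; ring
    have a1 : D₀ / (4 * δ) * (2 * K₀ * S) = D₀ / (4 * δ) * (2 * (K₀ * S)) := by ring
    rw [a1] at d1 d2 d3
    generalize D₀ / (4 * δ) = E at *
    generalize K₀ * S = G at *
    generalize P ^ 2 / (4 * δ) = P' at *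
    generalize Q ^ 2 / (4 * δ) = Q' at *
    generalize R ^ 2 / (4 * δ) = R' at *
    have d1' : P' ≤ 2 * (E * G) := by linarith only [d1]
    have d2' : Q' ≤ 2 * (E * G) := by linarith only [d2]
    have d3' : R' ≤ 2 * (E * G) := by linarith only [d3]
    linarith only [h0, h1, h2, h3, c1, c2, c3, d1', d2', d3', e1, hδA, hT]
  have hends : ((a + b) * w + p₁) ^ 2 + ((b - a) * (s * w) + p₂) ^ 2 ≤
      4 * w ^ 2 * A + 4 * (K₀ * S) := by
    have h1 : ((a + b) * w + p₁) ^ 2 ≤ 2 * ((a + b) * w) ^ 2 + 2 * p₁ ^ 2 := by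
      linarith only [sq_nonneg ((a + b) * w - p₁)]
    have h2 : ((b - a) * (s * w) + p₂) ^ 2 ≤ 2 * ((b - a) ^ 2 * (s ^ 2 * w ^ 2)) + 2 * p₂ ^ 2 := by
      linarith only [sq_nonneg ((b - a) * (s * w) - p₂)]
    rw [hs2] at h2
    rw [hA]; linarith only [h1, h2, f1, f3]
  have hscale : 4 * w ^ 2 * A ≤ 4 * w / w' * (T + 4 * M * K₀ * S) := by
    have : 4 * w ^ 2 * A = 4 * w / w' * (w * w' * A) := by field_simp
    rw [this]
    exact mul_le_mul_of_nonneg_left hmain (by positivity)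
  have : 0 ≤ K₀ * S := by positivity
  linarith only [this, hscale, hends]

/-- The end values of a polynomial are controlled by the boundary form and its values at the
interior nodes. -/
theorem exists_edge_bound {N : ℕ} (hN : 2 ≤ N) : ∃ K C : ℝ, 0 ≤ K ∧ 0 ≤ C ∧
    ∀ u : ℝ[X], u.natDegree ≤ N →
      u.eval 1 ^ 2 + u.eval (-1) ^ 2 ≤ K * bdryForm u u + C * ∑ j, nodal N u j ^ 2 := by
  obtain ⟨K₀, hK₀, hK⟩ := exists_end_bound N
  set w := (interiorPoly N).eval 1 with hw
  set w' := (derivative (interiorPoly N)).eval 1 with hw'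
  have hw0 : 0 < w := by
    rw [hw, interiorPoly, Chebyshev.U_eval_one]; positivity
  have hw'0 : 0 < w' := by
    have h := Chebyshev.derivative_U_eval_one (R := ℝ) ((N - 1 : ℕ) : ℤ)
    have hc : (((N - 1 : ℕ) : ℤ) : ℝ) = N - 1 := by
      push_cast [Nat.cast_sub (show 1 ≤ N by omega)]; ring
    rw [hc] at h
    have h2 : (2 : ℝ) ≤ N := by exact_mod_cast hN
    have h3 : 0 < 3 * w' := by
      rw [hw', interiorPoly, h]
      have : (0 : ℝ) < N - 1 := by linarith
      have : (0 : ℝ) < N := by linarith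
      nlinarith [mul_pos this ‹(0:ℝ) < N - 1›]
    linarith
  obtain ⟨s, hs, hs2⟩ : ∃ s : ℝ, (∀ x, (interiorPoly N).eval (-x) = s * (interiorPoly N).eval x) ∧
      s ^ 2 = 1 := by
    refine ⟨(-1) ^ (N + 1), fun x => ?_, by rw [← pow_mul, mul_comm, pow_mul]; simp⟩
    have := tauBasis_eval_neg (show 1 ≤ N by omega) 1 x
    rwa [tauBasis_one] at this
  have hm : (interiorPoly N).eval (-1) = s * w := hs 1
  have hm' : (derivative (interiorPoly N)).eval (-1) = -s * w' := derivative_eval_neg hs 1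
  set δ := w * w' / 5 with hδ
  have hδ0 : 0 < δ := by positivity
  set D₀ := (2 * w ^ 2 + 2 * w' ^ 2) with hD₀
  set M := 3 * (D₀ / (4 * δ) + 1) with hM
  refine ⟨4 * w / w', 4 * w / w' * (4 * M * K₀) + 8 * K₀, by positivity, by positivity, fun u hu => ?_⟩
  obtain ⟨a, b, F, hF, hFu, rfl⟩ := exists_interior_decomp hN hu
  rw [← hFu]
  set S := ∑ j, nodal N F j ^ 2 with hS
  obtain ⟨f1, f2⟩ := hK F hF 1 (Or.inl rfl)
  obtain ⟨f3, f4⟩ := hK F hF (-1) (Or.inr rfl)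
  rw [← hS] at f1 f2 f3 f4
  have hbd : bdryForm (C a * (X * interiorPoly N) + C b * interiorPoly N + F)
      (C a * (X * interiorPoly N) + C b * interiorPoly N + F) =
      ((a + b) * w + F.eval 1) * (a * w + (a + b) * w' + (derivative F).eval 1) -
      ((b - a) * (s * w) + F.eval (-1)) * (a * (s * w) - (b - a) * (s * w') +
        (derivative F).eval (-1)) := by
    rw [bdryForm]
    simp only [derivative_add, derivative_mul, derivative_X, eval_add, eval_mul,
      eval_C, eval_X, eval_one, hm, hm', ← hw, ← hw', derivative_C]
    simp only [eval_zero]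
    ring
  have he1 : (C a * (X * interiorPoly N) + C b * interiorPoly N + F).eval 1 =
      (a + b) * w + F.eval 1 := by
    simp only [eval_add, eval_mul, eval_C, eval_X, ← hw]; ring
  have he2 : (C a * (X * interiorPoly N) + C b * interiorPoly N + F).eval (-1) =
      (b - a) * (s * w) + F.eval (-1) := by
    simp only [eval_add, eval_mul, eval_C, eval_X, hm]; ring
  rw [hbd, he1, he2]
  generalize F.eval 1 = p₁ at *
  generalize F.eval (-1) = p₂ at *
  generalize (derivative F).eval 1 = q₁ at *
  generalize (derivative F).eval (-1) = q₂ at *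
  exact end_bound_aux hw0 hw'0 hs2 hK₀ (Finset.sum_nonneg fun j _ => sq_nonneg _) hδ hD₀ hM f1 f2 f3 f4

/-! ### Nodal vectors -/

/-- First derivative of the interpolant of `φ` at the node `k`. -/
def slope (N k : ℕ) (φ : ℕ → ℝ) : ℝ := ∑ l : Fin (N + 1), diff1 (N + 1) k l * φ l

/-- Second derivative of the interpolant of `φ` at the node `k`. -/
def curv (N k : ℕ) (φ : ℕ → ℝ) : ℝ := ∑ l : Fin (N + 1), diff2 (N + 1) k l * φ l

/-- The interpolant of `φ`. -/
def nodalPoly (N : ℕ) (φ : ℕ → ℝ) : ℝ[X] :=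
  Lagrange.interpolate Finset.univ (fun m : Fin (N + 1) => node (N + 1) m) fun l => φ l

theorem nodalPoly_eq (N : ℕ) (φ : ℕ → ℝ) :
    nodalPoly N φ = ∑ l : Fin (N + 1), C (φ l) * cardinal (N + 1) l := by
  rw [nodalPoly, Lagrange.interpolate_apply]; rfl

theorem node_injective {N : ℕ} (hN : 1 ≤ N) :
    Set.InjOn (fun m : Fin (N + 1) => node (N + 1) m) (Finset.univ : Finset (Fin (N + 1))) := by
  intro i _ j _ h
  exact Fin.ext (node_injOn hN (Nat.lt_succ_iff.1 i.2) (Nat.lt_succ_iff.1 j.2) h)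

theorem natDegree_nodalPoly_le {N : ℕ} (hN : 1 ≤ N) (φ : ℕ → ℝ) :
    (nodalPoly N φ).natDegree ≤ N := by
  have h := Lagrange.degree_interpolate_lt (fun l : Fin (N + 1) => φ l) (node_injective hN)
  rw [Finset.card_univ, Fintype.card_fin] at h
  rw [natDegree_le_iff_coeff_eq_zero]
  intro m hm
  exact (degree_lt_iff_coeff_zero _ _).1 h m (by exact_mod_cast hm)

theorem nodalPoly_eval {N : ℕ} (hN : 1 ≤ N) (φ : ℕ → ℝ) {k : ℕ} (hk : k ≤ N) :
    (nodalPoly N φ).eval (node (N + 1) k) = φ k := by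
  have h := Lagrange.eval_interpolate_at_node (s := Finset.univ)
    (v := fun m : Fin (N + 1) => node (N + 1) m) (i := ⟨k, Nat.lt_succ_of_le hk⟩)
    (fun l : Fin (N + 1) => φ l) (node_injective hN) (Finset.mem_univ _)
  exact h

theorem derivative_nodalPoly_eval (N k : ℕ) (φ : ℕ → ℝ) :
    (derivative (nodalPoly N φ)).eval (node (N + 1) k) = slope N k φ := by
  rw [nodalPoly_eq, derivative_sum, eval_finsetSum, slope]
  exact Finset.sum_congr rfl fun l _ => by rw [derivative_C_mul, eval_C_mul, diff1, mul_comm]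

theorem derivative2_nodalPoly_eval (N k : ℕ) (φ : ℕ → ℝ) :
    (derivative (derivative (nodalPoly N φ))).eval (node (N + 1) k) = curv N k φ := by
  rw [nodalPoly_eq, derivative_sum, derivative_sum, eval_finsetSum, curv]
  exact Finset.sum_congr rfl fun l _ => by
    rw [derivative_C_mul, derivative_C_mul, eval_C_mul, diff2, mul_comm]

theorem node_zero (N : ℕ) : node (N + 1) 0 = -1 := by simp [node]

theorem node_last {N : ℕ} (hN : 1 ≤ N) : node (N + 1) N = 1 := by
  have hN' : (N : ℝ) ≠ 0 := by have : N ≠ 0 := by omega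
                               exact_mod_cast this
  rw [node_eq_cos, mul_div_assoc, div_self hN']; simp

/-- The boundary form of a nodal vector. -/
def endForm (N : ℕ) (φ : ℕ → ℝ) : ℝ := φ N * slope N N φ - φ 0 * slope N 0 φ

theorem bdryForm_nodalPoly {N : ℕ} (hN : 1 ≤ N) (φ : ℕ → ℝ) :
    bdryForm (nodalPoly N φ) (nodalPoly N φ) = endForm N φ := by
  rw [bdryForm, endForm, ← node_zero N, ← node_last hN, nodalPoly_eval hN φ le_rfl,
    nodalPoly_eval hN φ (Nat.zero_le N), derivative_nodalPoly_eval, derivative_nodalPoly_eval]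

theorem nodal_nodalPoly {N : ℕ} (φ : ℕ → ℝ) (j : Fin (N - 1)) :
    nodal N (nodalPoly N φ) j = φ (j + 1) := by
  have := j.2
  exact nodalPoly_eval (by omega) φ (by omega)

theorem nodal_derivative2_nodalPoly {N : ℕ} (φ : ℕ → ℝ) (j : Fin (N - 1)) :
    nodal N (derivative (derivative (nodalPoly N φ))) j = curv N (j + 1) φ :=
  derivative2_nodalPoly_eval N (j + 1) φ

/-- The functionals of the dissipative form on nodal vectors, with a left inverse. -/
theorem exists_rows_nodal {N : ℕ} (hN : 2 ≤ N) :
    ∃ (m : ℕ) (L : Fin m → Fin (N - 1) → ℝ) (R : Fin (N - 1) → Fin m → ℝ),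
    (∀ (f : Fin (N - 1) → ℝ) (k), f k = ∑ s, R k s * ∑ j, L s j * f j) ∧
    ∀ φ : ℕ → ℝ, ∑ s, (∑ j, L s j * φ (j + 1)) * (∑ j, L s j * curv N (j + 1) φ) ≤
      endForm N φ := by
  obtain ⟨m, L, hL, hd⟩ := exists_rows hN
  -- Definiteness of the form means that the functionals jointly separate points; `R` is the matrix
  -- of a left inverse.
  obtain ⟨T, hT⟩ := (Matrix.mulVecLin (Matrix.of L)).exists_leftInverse_of_injective
    (LinearMap.ker_eq_bot'.2 fun f hf => hL f fun s => congrFun hf s)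
  refine ⟨m, L, LinearMap.toMatrix' T, fun f k => ?_, fun φ => ?_⟩
  · have h := congrFun (LinearMap.congr_fun hT f) k
    rw [LinearMap.comp_apply, LinearMap.id_apply, ← LinearMap.toMatrix'_mulVec T] at h
    exact h.symm
  · have h := hd _ (natDegree_nodalPoly_le (by omega) φ)
    rw [bdryForm_nodalPoly (by omega)] at h
    simpa only [dotProduct, nodal_nodalPoly, nodal_derivative2_nodalPoly] using h

theorem exists_edge_bound_nodal {N : ℕ} (hN : 2 ≤ N) : ∃ K C : ℝ, 0 ≤ C ∧
    ∀ φ : ℕ → ℝ, φ N ^ 2 + φ 0 ^ 2 ≤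
      K * endForm N φ + C * ∑ j : Fin (N - 1), φ (j + 1) ^ 2 := by
  obtain ⟨K, C, -, hC, h⟩ := exists_edge_bound hN
  refine ⟨K, C, hC, fun φ => ?_⟩
  have h1 := h _ (natDegree_nodalPoly_le (by omega) φ)
  rw [bdryForm_nodalPoly (by omega), ← node_zero N, ← node_last (show 1 ≤ N by omega),
    nodalPoly_eval (by omega) φ le_rfl, nodalPoly_eval (by omega) φ (Nat.zero_le N)] at h1
  simpa only [nodal_nodalPoly] using h1

/-! ### Lines of squares -/

theorem slope_add (N k : ℕ) (φ ψ : ℕ → ℝ) :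
    slope N k (fun l => φ l + ψ l) = slope N k φ + slope N k ψ := by
  simp only [slope, mul_add, Finset.sum_add_distrib]

theorem slope_smul (N k : ℕ) (c : ℝ) (φ : ℕ → ℝ) :
    slope N k (fun l => c * φ l) = c * slope N k φ := by
  simp only [slope, Finset.mul_sum]
  exact Finset.sum_congr rfl fun l _ => by ring

/-- Nodal values along the squares `a, …, b - 1` of a line which vanish at both ends and have
matching slopes at the interfaces. -/
def admissible (N a b : ℕ) : Submodule ℝ (ℕ → ℝ) where
  carrier := {ψ | ψ (N * a) = 0 ∧ ψ (N * b) = 0 ∧ ∀ m, a ≤ m → m + 1 < b →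
    slope N N (fun l => ψ (N * m + l)) = slope N 0 fun l => ψ (N * (m + 1) + l)}
  add_mem' := by
    rintro φ ψ ⟨h1, h2, h3⟩ ⟨g1, g2, g3⟩
    refine ⟨by simp [h1, g1], by simp [h2, g2], fun m h h' => ?_⟩
    simp only [Pi.add_apply, slope_add, h3 m h h', g3 m h h']
  zero_mem' := ⟨rfl, rfl, fun m _ _ => by simp [slope]⟩
  smul_mem' := by
    rintro c φ ⟨h1, h2, h3⟩
    refine ⟨by simp [h1], by simp [h2], fun m h h' => ?_⟩
    simp only [Pi.smul_apply, smul_eq_mul, slope_smul, h3 m h h']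

/-- The sum telescopes through the matching slopes, and the two outer terms vanish with the values
there. -/
theorem sum_endForm_eq_zero {N a b : ℕ} (hab : a ≤ b) {ψ : ℕ → ℝ} (h : ψ ∈ admissible N a b) :
    ∑ e ∈ Finset.Ico a b, endForm N (fun l => ψ (N * e + l)) = 0 := by
  obtain ⟨h1, h2, h3⟩ := h
  set F : ℕ → ℝ := fun e => ψ (N * e) * slope N 0 (fun l => ψ (N * e + l)) with hF
  have h4 : ∀ e ∈ Finset.Ico a b, endForm N (fun l => ψ (N * e + l)) = F (e + 1) - F e := by
    intro e he
    obtain ⟨he1, he2⟩ := Finset.mem_Ico.1 he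
    rw [endForm, hF, Nat.add_zero, show N * e + N = N * (e + 1) by ring]
    rcases Nat.lt_or_ge (e + 1) b with h5 | h5
    · rw [h3 e he1 h5]
    -- At the last end no slopes need to match: `F b` involves nodes beyond the line, but its factor
    -- ψ vanishes.
    · simp only [show e + 1 = b by omega, h2]; ring
  rw [Finset.sum_congr rfl h4, Finset.sum_Ico_sub F hab]
  simp only [hF, h1, h2]; ring

/-! ### Energy on arrays of squares -/

/-- Quadratic bound for a linear map given by a matrix. -/
theorem sum_sq_le_of_eq_sum {ι κ : Type*} [Fintype ι] [Fintype κ] {A : ι → κ → ℝ} {W : ι → ℝ}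
    {T : κ → ℝ} (h : ∀ i, W i = ∑ j, A i j * T j) :
    ∑ i, W i ^ 2 ≤ (∑ i, ∑ j, A i j ^ 2) * ∑ j, T j ^ 2 := by
  rw [Finset.sum_mul]
  refine Finset.sum_le_sum fun i _ => ?_
  rw [h i]
  exact Finset.sum_mul_sq_le_sq_mul_sq _ _ _

/-- The coefficients of an array of nodal values for a pair of functionals. -/
def coef {N m : ℕ} (L : Fin m → Fin (N - 1) → ℝ) (W : Fin (N - 1) → Fin (N - 1) → ℝ)
    (s t : Fin m) : ℝ :=
  ∑ k, L s k * ∑ k', L t k' * W k k'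

theorem coef_swap {N m : ℕ} (L : Fin m → Fin (N - 1) → ℝ) (W : Fin (N - 1) → Fin (N - 1) → ℝ)
    (s t : Fin m) : coef L (fun k k' => W k' k) t s = coef L W s t := by
  simp only [coef, Finset.mul_sum]
  rw [Finset.sum_comm]
  exact Finset.sum_congr rfl fun k _ => Finset.sum_congr rfl fun k' _ => by ring

theorem coef_add {N m : ℕ} (L : Fin m → Fin (N - 1) → ℝ) (W Z : Fin (N - 1) → Fin (N - 1) → ℝ)
    (s t : Fin m) : coef L (fun k k' => W k k' + Z k k') s t = coef L W s t + coef L Z s t := by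
  simp only [coef, mul_add, Finset.sum_add_distrib]

theorem coef_smul {N m : ℕ} (L : Fin m → Fin (N - 1) → ℝ) (c : ℝ)
    (W : Fin (N - 1) → Fin (N - 1) → ℝ) (s t : Fin m) :
    coef L (fun k k' => c * W k k') s t = c * coef L W s t := by
  simp only [coef, Finset.mul_sum]
  exact Finset.sum_congr rfl fun k _ => Finset.sum_congr rfl fun k' _ => by ring

theorem exists_coef_le {N m : ℕ} (L : Fin m → Fin (N - 1) → ℝ) : ∃ C : ℝ, 0 ≤ C ∧
    ∀ W, ∑ s, ∑ t, coef L W s t ^ 2 ≤ C * ∑ k, ∑ k', W k k' ^ 2 := by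
  refine ⟨∑ q : Fin m × Fin m, ∑ r : Fin (N - 1) × Fin (N - 1), (L q.1 r.1 * L q.2 r.2) ^ 2,
    Finset.sum_nonneg fun _ _ => Finset.sum_nonneg fun _ _ => sq_nonneg _, fun W => ?_⟩
  have h := sum_sq_le_of_eq_sum (W := fun q : Fin m × Fin m => coef L W q.1 q.2)
    (T := fun r : Fin (N - 1) × Fin (N - 1) => W r.1 r.2)
    (A := fun q r => L q.1 r.1 * L q.2 r.2) fun q => by
      rw [Fintype.sum_prod_type, coef]
      refine Finset.sum_congr rfl fun k _ => ?_
      rw [Finset.mul_sum]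
      exact Finset.sum_congr rfl fun k' _ => by ring
  rwa [Fintype.sum_prod_type, Fintype.sum_prod_type (f := fun r => W r.1 r.2 ^ 2)] at h

theorem exists_le_coef {N m : ℕ} {L : Fin m → Fin (N - 1) → ℝ} {R : Fin (N - 1) → Fin m → ℝ}
    (hR : ∀ (f : Fin (N - 1) → ℝ) (k), f k = ∑ s, R k s * ∑ j, L s j * f j) : ∃ C : ℝ, 0 ≤ C ∧
    ∀ W, ∑ k, ∑ k', W k k' ^ 2 ≤ C * ∑ s, ∑ t, coef L W s t ^ 2 := by
  refine ⟨∑ q : Fin (N - 1) × Fin (N - 1), ∑ r : Fin m × Fin m, (R q.1 r.1 * R q.2 r.2) ^ 2,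
    Finset.sum_nonneg fun _ _ => Finset.sum_nonneg fun _ _ => sq_nonneg _, fun W => ?_⟩
  have h := sum_sq_le_of_eq_sum (T := fun q : Fin m × Fin m => coef L W q.1 q.2)
    (W := fun r : Fin (N - 1) × Fin (N - 1) => W r.1 r.2)
    (A := fun q r => R q.1 r.1 * R q.2 r.2) fun q => by
      have e1 : W q.1 q.2 = ∑ t, R q.2 t * ∑ k', L t k' * W q.1 k' := hR (W q.1) q.2
      have e2 : ∀ t, ∑ k', L t k' * W q.1 k' = ∑ s, R q.1 s * coef L W s t := fun t =>
        hR (fun k => ∑ k', L t k' * W k k') q.1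
      rw [e1, Fintype.sum_prod_type, Finset.sum_comm]
      refine Finset.sum_congr rfl fun t _ => ?_
      rw [e2, Finset.mul_sum]
      exact Finset.sum_congr rfl fun s _ => by ring
  rwa [Fintype.sum_prod_type, Fintype.sum_prod_type (f := fun q => coef L W q.1 q.2 ^ 2)] at h

/-- Values at the interior nodes of the square `(e₁, e₂)`. -/
def cell (N : ℕ) (V : ℕ → ℕ → ℝ) (e₁ e₂ : ℕ) (k k' : Fin (N - 1)) : ℝ :=
  V (N * e₁ + (k + 1)) (N * e₂ + (k' + 1))

/-- Second differences in the first direction at the interior nodes of the square `(e₁, e₂)`. -/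
def cellX (N : ℕ) (V : ℕ → ℕ → ℝ) (e₁ e₂ : ℕ) (k k' : Fin (N - 1)) : ℝ :=
  curv N (k + 1) fun l => V (N * e₁ + l) (N * e₂ + (k' + 1))

/-- Second differences in the second direction at the interior nodes of the square `(e₁, e₂)`. -/
def cellY (N : ℕ) (V : ℕ → ℕ → ℝ) (e₁ e₂ : ℕ) (k k' : Fin (N - 1)) : ℝ :=
  curv N (k' + 1) fun l => V (N * e₁ + (k + 1)) (N * e₂ + l)

/-- The lines through the interior nodes of the squares are admissible in the first direction. -/
def AdmissibleX (N a b c d : ℕ) (V : ℕ → ℕ → ℝ) : Prop :=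
  ∀ e ∈ Finset.Ico c d, ∀ k : Fin (N - 1), (fun i => V i (N * e + (k + 1))) ∈ admissible N a b

/-- The functionals `L` make the one-dimensional second derivative dissipative. -/
def Dissipative (N : ℕ) {m : ℕ} (L : Fin m → Fin (N - 1) → ℝ) : Prop :=
  ∀ φ : ℕ → ℝ, ∑ s, (∑ j, L s j * φ (j + 1)) * (∑ j, L s j * curv N (j + 1) φ) ≤ endForm N φ

theorem curv_sum {N k : ℕ} {ι : Type*} (s : Finset ι) (c : ι → ℝ) (φ : ι → ℕ → ℝ) :
    curv N k (fun l => ∑ i ∈ s, c i * φ i l) = ∑ i ∈ s, c i * curv N k (φ i) := by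
  simp only [curv, Finset.mul_sum]
  rw [Finset.sum_comm]
  exact Finset.sum_congr rfl fun i _ => Finset.sum_congr rfl fun l _ => by ring

/-- Applying a functional `L t` across the lines first yields a single line, admissible because
`admissible` is a subspace. On it the one-dimensional dissipation applies square by square and the
boundary terms telescope. -/
theorem sum_coef_cellX_nonpos {N m a b c d : ℕ} (hab : a ≤ b) {L : Fin m → Fin (N - 1) → ℝ}
    (hL : Dissipative N L) {V : ℕ → ℕ → ℝ} (hV : AdmissibleX N a b c d V) :
    ∑ e₁ ∈ Finset.Ico a b, ∑ e₂ ∈ Finset.Ico c d, ∑ s, ∑ t,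
      coef L (cell N V e₁ e₂) s t * coef L (cellX N V e₁ e₂) s t ≤ 0 := by
  rw [Finset.sum_comm]
  refine Finset.sum_nonpos fun e₂ he₂ => ?_
  have h1 : ∀ t : Fin m, ∑ e₁ ∈ Finset.Ico a b, ∑ s,
      coef L (cell N V e₁ e₂) s t * coef L (cellX N V e₁ e₂) s t ≤ 0 := by
    intro t
    set ψ : ℕ → ℝ := fun i => ∑ k', L t k' * V i (N * e₂ + (k' + 1)) with hψ
    have hadm : ψ ∈ admissible N a b := by
      have : ψ = ∑ k', L t k' • fun i => V i (N * e₂ + (k' + 1)) := by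
        funext i; simp [hψ]
      rw [this]
      exact Submodule.sum_mem _ fun k' _ => Submodule.smul_mem _ _ (hV e₂ he₂ k')
    rw [← sum_endForm_eq_zero hab hadm]
    refine Finset.sum_le_sum fun e₁ _ => ?_
    refine le_trans (le_of_eq ?_) (hL fun l => ψ (N * e₁ + l))
    refine Finset.sum_congr rfl fun s _ => ?_
    congr 1
    refine Finset.sum_congr rfl fun k _ => ?_
    rw [hψ, curv_sum]; rfl
  calc _ = ∑ t, ∑ e₁ ∈ Finset.Ico a b, ∑ s,
        coef L (cell N V e₁ e₂) s t * coef L (cellX N V e₁ e₂) s t :=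
        (Finset.sum_congr rfl fun e₁ _ => Finset.sum_comm).trans Finset.sum_comm
    _ ≤ 0 := Finset.sum_nonpos fun t _ => h1 t

theorem sum_coef_cellY_nonpos {N m a b c d : ℕ} (hcd : c ≤ d) {L : Fin m → Fin (N - 1) → ℝ}
    (hL : Dissipative N L) {V : ℕ → ℕ → ℝ} (hV : AdmissibleX N c d a b fun j i => V i j) :
    ∑ e₁ ∈ Finset.Ico a b, ∑ e₂ ∈ Finset.Ico c d, ∑ s, ∑ t,
      coef L (cell N V e₁ e₂) s t * coef L (cellY N V e₁ e₂) s t ≤ 0 := by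
  refine le_trans (le_of_eq ?_) (sum_coef_cellX_nonpos hcd hL hV)
  rw [Finset.sum_comm]
  refine Finset.sum_congr rfl fun e₂ _ => Finset.sum_congr rfl fun e₁ _ => ?_
  rw [Finset.sum_comm]
  refine Finset.sum_congr rfl fun t _ => Finset.sum_congr rfl fun s _ => ?_
  rw [← coef_swap L (cell N V e₁ e₂), ← coef_swap L (cellY N V e₁ e₂)]
  rfl

/-- The energy of the squares of a rectangle. -/
def energy {N m : ℕ} (L : Fin m → Fin (N - 1) → ℝ) (a b c d : ℕ) (V : ℕ → ℕ → ℝ) : ℝ :=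
  ∑ e₁ ∈ Finset.Ico a b, ∑ e₂ ∈ Finset.Ico c d, ∑ s, ∑ t, coef L (cell N V e₁ e₂) s t ^ 2

/-- The usual test of v = u + η Δv against v in the energy product: the two directions contribute
nonpositive terms, and vu ≤ (v² + u²)/2. Only interior nodes of the squares enter. -/
theorem energy_le {N m a b c d : ℕ} (hab : a ≤ b) (hcd : c ≤ d) {L : Fin m → Fin (N - 1) → ℝ}
    (hL : Dissipative N L) {U V : ℕ → ℕ → ℝ} {η : ℝ} (hη : 0 ≤ η)
    (hX : AdmissibleX N a b c d V) (hY : AdmissibleX N c d a b fun j i => V i j)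
    (h : ∀ e₁ ∈ Finset.Ico a b, ∀ e₂ ∈ Finset.Ico c d, ∀ k k',
      cell N V e₁ e₂ k k' = cell N U e₁ e₂ k k' +
        η * (cellX N V e₁ e₂ k k' + cellY N V e₁ e₂ k k')) :
    energy L a b c d V ≤ energy L a b c d U := by
  have h1 := sum_coef_cellX_nonpos hab hL hX
  have h2 := sum_coef_cellY_nonpos hcd hL hY
  have h3 : energy L a b c d V ≤ ∑ e₁ ∈ Finset.Ico a b, ∑ e₂ ∈ Finset.Ico c d, ∑ s, ∑ t,
      (1 / 2 * coef L (cell N V e₁ e₂) s t ^ 2 + 1 / 2 * coef L (cell N U e₁ e₂) s t ^ 2 +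
        η * (coef L (cell N V e₁ e₂) s t * coef L (cellX N V e₁ e₂) s t) +
        η * (coef L (cell N V e₁ e₂) s t * coef L (cellY N V e₁ e₂) s t)) := by
    refine Finset.sum_le_sum fun e₁ he₁ => Finset.sum_le_sum fun e₂ he₂ =>
      Finset.sum_le_sum fun s _ => Finset.sum_le_sum fun t _ => ?_
    have h4 : coef L (cell N V e₁ e₂) s t = coef L (cell N U e₁ e₂) s t +
        η * (coef L (cellX N V e₁ e₂) s t + coef L (cellY N V e₁ e₂) s t) := by
      rw [← coef_add, ← coef_smul, ← coef_add]
      congr 1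
      funext k k'
      exact h e₁ he₁ e₂ he₂ k k'
    generalize coef L (cellX N V e₁ e₂) s t = x at *
    generalize coef L (cellY N V e₁ e₂) s t = y at *
    generalize coef L (cell N U e₁ e₂) s t = u at *
    generalize coef L (cell N V e₁ e₂) s t = v at *
    have h5 : v ^ 2 = v * u + η * (v * x) + η * (v * y) := by
      rw [sq]; nth_rw 2 [h4]; ring
    linarith only [h5, sq_nonneg (v - u)]
  simp only [Finset.sum_add_distrib, ← Finset.mul_sum] at h3
  rw [energy, energy] at *
  have h6 := mul_nonpos_of_nonneg_of_nonpos hη h1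
  have h7 := mul_nonpos_of_nonneg_of_nonpos hη h2
  linarith only [h3, h6, h7]

section

/-- The interface values of a line are controlled by its interior values. -/
def EdgeBound (N : ℕ) (C : ℝ) : Prop :=
  ∀ (a b : ℕ) (ψ : ℕ → ℝ), a ≤ b → ψ ∈ admissible N a b →
    ∑ e ∈ Finset.Ico a b, (ψ (N * (e + 1)) ^ 2 + ψ (N * e) ^ 2) ≤
      C * ∑ e ∈ Finset.Ico a b, ∑ k : Fin (N - 1), ψ (N * e + (k + 1)) ^ 2

/-- Summed over the line, the multiple `K` of the boundary forms disappears by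
`sum_endForm_eq_zero`. -/
theorem exists_edgeBound {N : ℕ} (hN : 2 ≤ N) : ∃ C : ℝ, 0 ≤ C ∧ EdgeBound N C := by
  obtain ⟨K, C, hC, h⟩ := exists_edge_bound_nodal hN
  refine ⟨C, hC, fun a b ψ hab hψ => ?_⟩
  have h0 := sum_endForm_eq_zero hab hψ
  rw [Finset.mul_sum, ← zero_add (∑ e ∈ Finset.Ico a b, C * _), ← mul_zero K, ← h0,
    Finset.mul_sum, ← Finset.sum_add_distrib]
  exact Finset.sum_le_sum fun e _ => h fun l => ψ (N * e + l)

theorem interface_eq_zero {N a b : ℕ} {C : ℝ} (hC : EdgeBound N C) {ψ : ℕ → ℝ}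
    (hψ : ψ ∈ admissible N a b)
    (h : ∀ e ∈ Finset.Ico a b, ∀ k : Fin (N - 1), ψ (N * e + (k + 1)) = 0) {e : ℕ}
    (hae : a ≤ e) (heb : e ≤ b) : ψ (N * e) = 0 := by
  rcases heb.eq_or_lt with rfl | heb
  · exact hψ.2.1
  have h1 := hC a b ψ (by omega) hψ
  rw [Finset.sum_eq_zero (s := Finset.Ico a b)
    (f := fun e => ∑ k : Fin (N - 1), ψ (N * e + (k + 1)) ^ 2) fun e he =>
      Finset.sum_eq_zero fun k _ => by rw [h e he k]; ring, mul_zero] at h1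
  have h2 := (Finset.single_le_sum (f := fun e => ψ (N * (e + 1)) ^ 2 + ψ (N * e) ^ 2)
    (fun e _ => by positivity) (Finset.mem_Ico.2 ⟨hae, heb⟩)).trans h1
  have h3 := sq_nonneg (ψ (N * (e + 1)))
  exact pow_eq_zero_iff (two_ne_zero) |>.1 (le_antisymm (by linarith) (sq_nonneg _))

theorem cell_eq_zero {N m a b c d : ℕ} (hab : a ≤ b) (hcd : c ≤ d) {L : Fin m → Fin (N - 1) → ℝ}
    (hL : Dissipative N L) {R : Fin (N - 1) → Fin m → ℝ}
    (hR : ∀ (f : Fin (N - 1) → ℝ) (k), f k = ∑ s, R k s * ∑ j, L s j * f j)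
    {V : ℕ → ℕ → ℝ} {η : ℝ} (hη : 0 ≤ η)
    (hX : AdmissibleX N a b c d V) (hY : AdmissibleX N c d a b fun j i => V i j)
    (h : ∀ e₁ ∈ Finset.Ico a b, ∀ e₂ ∈ Finset.Ico c d, ∀ k k',
      cell N V e₁ e₂ k k' = η * (cellX N V e₁ e₂ k k' + cellY N V e₁ e₂ k k')) :
    ∀ e₁ ∈ Finset.Ico a b, ∀ e₂ ∈ Finset.Ico c d, ∀ k k', cell N V e₁ e₂ k k' = 0 := by
  intro e₁ he₁ e₂ he₂ k k'
  obtain ⟨C, hC, hCW⟩ := exists_le_coef hR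
  have h1 := energy_le (U := fun _ _ => 0) hab hcd hL hη hX hY fun e₁ he₁ e₂ he₂ k k' => by
    rw [h e₁ he₁ e₂ he₂ k k', cell, zero_add]
  have h0 : energy L a b c d (fun _ _ => 0) = 0 := by
    simp [energy, coef, cell]
  rw [h0, energy] at h1
  have h2 : ∑ s, ∑ t, coef L (cell N V e₁ e₂) s t ^ 2 ≤ 0 := by
    refine le_trans ?_ h1
    have h3 : ∀ e₁ e₂, 0 ≤ ∑ s, ∑ t, coef L (cell N V e₁ e₂) s t ^ 2 := fun e₁ e₂ =>
      Finset.sum_nonneg fun _ _ => Finset.sum_nonneg fun _ _ => sq_nonneg _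
    refine le_trans ?_ (Finset.single_le_sum (f := fun e₁ => ∑ e₂ ∈ Finset.Ico c d, ∑ s, ∑ t,
      coef L (cell N V e₁ e₂) s t ^ 2) (fun e _ => Finset.sum_nonneg fun e' _ => h3 e e') he₁)
    exact Finset.single_le_sum (f := fun e₂ => ∑ s, ∑ t, coef L (cell N V e₁ e₂) s t ^ 2)
      (fun e _ => h3 e₁ e) he₂
  have h3 := (hCW (cell N V e₁ e₂)).trans (mul_nonpos_of_nonneg_of_nonpos hC h2)
  have h4 : cell N V e₁ e₂ k k' ^ 2 ≤ 0 := by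
    refine le_trans ?_ h3
    refine le_trans ?_ (Finset.single_le_sum (f := fun k => ∑ k', cell N V e₁ e₂ k k' ^ 2)
      (fun e _ => Finset.sum_nonneg fun e' _ => sq_nonneg _) (Finset.mem_univ k))
    exact Finset.single_le_sum (f := fun k' => cell N V e₁ e₂ k k' ^ 2)
      (fun e _ => sq_nonneg _) (Finset.mem_univ k')
  exact pow_eq_zero_iff (two_ne_zero) |>.1 (le_antisymm h4 (sq_nonneg _))

/-! ### Grid functions -/

variable {N n₁ n₂ : ℕ}

theorem val_self {p : ℕ} (u : Grid p n₁ n₂ → ℝ) (x : Grid p n₁ n₂) : val u x.i x.j = u x := by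
  rw [val, dif_pos ⟨⟨x.1.1.2, x.1.2.2⟩, x.2⟩]; rfl

theorem Grid.not_dvd (x : Grid (N + 1) n₁ n₂) : ¬ (N ∣ x.i ∧ N ∣ x.j) := x.2

theorem Grid.i_le (x : Grid (N + 1) n₁ n₂) : x.i ≤ n₁ * N := Nat.lt_succ_iff.1 x.1.1.2

theorem Grid.j_le (x : Grid (N + 1) n₁ n₂) : x.j ≤ n₂ * N := Nat.lt_succ_iff.1 x.1.2.2

theorem exists_grid {i j : ℕ} (hi : i ≤ n₁ * N) (hj : j ≤ n₂ * N) (h : ¬ (N ∣ i ∧ N ∣ j)) :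
    ∃ x : Grid (N + 1) n₁ n₂, x.i = i ∧ x.j = j :=
  ⟨⟨(⟨i, Nat.lt_succ_of_le hi⟩, ⟨j, Nat.lt_succ_of_le hj⟩), h⟩, rfl, rfl⟩

theorem not_dvd_interior (e : ℕ) (k : Fin (N - 1)) : ¬ N ∣ N * e + (k + 1) := by
  have := k.2
  intro h
  have := Nat.le_of_dvd (by omega) ((Nat.dvd_add_right (Dvd.intro e rfl)).1 h)
  omega

theorem exists_interior {i a : ℕ} (h1 : N * a < i) (h2 : i < N * (a + 1)) :
    ∃ k : Fin (N - 1), i = N * a + (k + 1) := by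
  rw [Nat.mul_succ] at h2
  exact ⟨⟨i - N * a - 1, by omega⟩, by simp only; omega⟩

theorem exists_strip {i a b : ℕ} (h1 : N * a ≤ i) (h2 : i ≤ N * b) (h : ¬ N ∣ i) :
    ∃ e ∈ Finset.Ico a b, ∃ k : Fin (N - 1), i = N * e + (k + 1) := by
  have hN : 0 < N := Nat.pos_of_ne_zero fun h0 => h (by subst h0; simp at h1 h2; simp [h2])
  have h3 := Nat.div_add_mod i N
  have h4 := Nat.mod_lt i hN
  have h5 : i % N ≠ 0 := fun h0 => h (Nat.dvd_of_mod_eq_zero h0)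
  refine ⟨i / N, Finset.mem_Ico.2 ⟨?_, ?_⟩, ⟨i % N - 1, by omega⟩, ?_⟩
  · exact (Nat.le_div_iff_mul_le hN).2 (by rwa [mul_comm])
  · refine (Nat.div_lt_iff_lt_mul hN).2 (lt_of_le_of_ne (by rwa [mul_comm b]) ?_)
    rintro rfl; exact h (Dvd.intro_left b rfl)
  · simp only; omega

/-! ### The discrete boundary value problem on a rectangle -/

/-- Points of the closed rectangle. -/
def Closed (a b c d : ℕ) (x : Grid (N + 1) n₁ n₂) : Prop :=
  (N * a ≤ x.i ∧ x.i ≤ N * b) ∧ N * c ≤ x.j ∧ x.j ≤ N * d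

/-- Points of the open rectangle. -/
def Inside (a b c d : ℕ) (x : Grid (N + 1) n₁ n₂) : Prop :=
  (N * a < x.i ∧ x.i < N * b) ∧ N * c < x.j ∧ x.j < N * d

/-- The collocation equations in the squares of a rectangle and the matching of the fluxes at its
interior interfaces. -/
structure Solves (ℓ h : ℝ) (a b c d : ℕ) (g v : Grid (N + 1) n₁ n₂ → ℝ) : Prop where
  colloc : ∀ e₁ ∈ Finset.Ico a b, ∀ e₂ ∈ Finset.Ico c d, ∀ x, InLeaf (N + 1) n₁ n₂ e₁ e₂ x →
    euler ℓ h v x = g x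
  matchX : ∀ m, a < m → m < b → ∀ x, OnX (N + 1) n₁ n₂ m c d x → dxLeft ℓ v x = dxRight ℓ v x
  matchY : ∀ m, c < m → m < d → ∀ x, OnY (N + 1) n₁ n₂ m a b x → dyBelow ℓ v x = dyAbove ℓ v x

theorem interior_mul_lt {c d e : ℕ} (he : e ∈ Finset.Ico c d) (k : Fin (N - 1)) :
    N * c < N * e + (k + 1) ∧ N * e + (k + 1) < N * d := by
  obtain ⟨h1, h2⟩ := Finset.mem_Ico.1 he
  have h3 := Nat.mul_le_mul_left N h1
  have h4 := Nat.mul_le_mul_left N (show e + 1 ≤ d from h2)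
  rw [Nat.mul_succ] at h4
  have := k.2
  omega

theorem lap_eq (ℓ : ℝ) (v : Grid (N + 1) n₁ n₂ → ℝ) (x : Grid (N + 1) n₁ n₂) {e₁ e₂ : ℕ}
    {k k' : Fin (N - 1)} (hi : x.i = N * e₁ + (k + 1)) (hj : x.j = N * e₂ + (k' + 1)) :
    lap ℓ v x = (2 / ℓ) ^ 2 * (cellX N (val v) e₁ e₂ k k' + cellY N (val v) e₁ e₂ k k') := by
  have h1 := k.2
  have h2 := k'.2
  rw [lap, cellX, cellY, curv, curv]
  simp only [Nat.add_sub_cancel]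
  rw [hi, hj, Nat.mul_add_mod, Nat.mul_add_mod, Nat.mod_eq_of_lt (by omega),
    Nat.mod_eq_of_lt (by omega), Nat.mul_add_div (by omega), Nat.mul_add_div (by omega),
    Nat.div_eq_of_lt (show (k : ℕ) + 1 < N by omega),
    Nat.div_eq_of_lt (show (k' : ℕ) + 1 < N by omega), add_zero, add_zero]

theorem Solves.cell_eq {ℓ h : ℝ} {a b c d : ℕ} {g v : Grid (N + 1) n₁ n₂ → ℝ}
    (hv : Solves ℓ h a b c d g v) (hb : b ≤ n₁) (hd : d ≤ n₂) :
    ∀ e₁ ∈ Finset.Ico a b, ∀ e₂ ∈ Finset.Ico c d, ∀ k k',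
      cell N (val v) e₁ e₂ k k' = cell N (val g) e₁ e₂ k k' +
        h * (2 / ℓ) ^ 2 * (cellX N (val v) e₁ e₂ k k' + cellY N (val v) e₁ e₂ k k') := by
  intro e₁ he₁ e₂ he₂ k k'
  obtain ⟨x, hxi, hxj⟩ := exists_grid (n₁ := n₁) (n₂ := n₂) (i := N * e₁ + (k + 1))
    (j := N * e₂ + (k' + 1))
    (by rw [mul_comm n₁]; exact (interior_mul_lt he₁ k).2.le.trans (Nat.mul_le_mul_left N hb))
    (by rw [mul_comm n₂]; exact (interior_mul_lt he₂ k').2.le.trans (Nat.mul_le_mul_left N hd))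
    fun H => not_dvd_interior e₁ k H.1
  have h1 := hv.colloc e₁ he₁ e₂ he₂ x ⟨by
    have := interior_mul_lt (N := N) (Finset.mem_Ico.2 ⟨le_rfl, Nat.lt_succ_self e₁⟩) k
    rw [hxi]; exact this, by
    have := interior_mul_lt (N := N) (Finset.mem_Ico.2 ⟨le_rfl, Nat.lt_succ_self e₂⟩) k'
    rw [hxj]; exact this⟩
  rw [euler, lap_eq ℓ v x hxi hxj, ← val_self v x, ← val_self g x, hxi, hxj] at h1
  rw [cell, cell]
  linarith

theorem Solves.admissibleX {ℓ h : ℝ} (hℓ : 0 < ℓ) {a b c d : ℕ} {g v : Grid (N + 1) n₁ n₂ → ℝ}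
    (hv : Solves ℓ h a b c d g v) (hab : a ≤ b) (hb : b ≤ n₁) (hd : d ≤ n₂)
    (h0 : ∀ x, Closed a b c d x → ¬ Inside a b c d x → v x = 0) :
    AdmissibleX N a b c d (val v) := by
  intro e he k
  obtain ⟨hj1, hj2⟩ := interior_mul_lt (N := N) he k
  have hpt : ∀ m, m ≤ n₁ → ∃ x : Grid (N + 1) n₁ n₂, x.i = N * m ∧ x.j = N * e + (k + 1) :=
    fun m hm => exists_grid (by rw [mul_comm]; exact Nat.mul_le_mul_right N hm)
      (by rw [mul_comm n₂]; exact hj2.le.trans (Nat.mul_le_mul_left N hd))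
      fun H => not_dvd_interior e k H.2
  have hz : ∀ m, m = a ∨ m = b → val v (N * m) (N * e + (k + 1)) = 0 := by
    intro m hm
    obtain ⟨x, hxi, hxj⟩ := hpt m (by omega)
    rw [← hxi, ← hxj, val_self]
    have e1 := Nat.mul_le_mul_left N hab
    refine h0 x ⟨?_, ?_⟩ fun H => ?_
    · rw [hxi]; rcases hm with rfl | rfl <;> simp [e1]
    · rw [hxj]; exact ⟨hj1.le, hj2.le⟩
    · have := H.1
      rw [hxi] at this
      rcases hm with rfl | rfl <;> omega
  refine ⟨hz a (Or.inl rfl), hz b (Or.inr rfl), fun m hm hm' => ?_⟩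
  obtain ⟨x, hxi, hxj⟩ := hpt (m + 1) (by omega)
  have h1 := hv.matchX (m + 1) (by omega) hm' x ⟨hxi, by rw [hxj]; exact hj1, by
    rw [hxj]; exact hj2⟩
  have h2 : (2 / ℓ) ≠ 0 := by positivity
  rw [dxLeft, dxRight] at h1
  have h3 := mul_left_cancel₀ h2 h1
  simp only [Nat.add_sub_cancel] at h3
  rw [hxi, hxj, Nat.mul_succ, Nat.add_sub_cancel] at h3
  exact h3

theorem Solves.admissibleY {ℓ h : ℝ} (hℓ : 0 < ℓ) {a b c d : ℕ} {g v : Grid (N + 1) n₁ n₂ → ℝ}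
    (hv : Solves ℓ h a b c d g v) (hcd : c ≤ d) (hb : b ≤ n₁) (hd : d ≤ n₂)
    (h0 : ∀ x, Closed a b c d x → ¬ Inside a b c d x → v x = 0) :
    AdmissibleX N c d a b fun j i => val v i j := by
  intro e he k
  obtain ⟨hj1, hj2⟩ := interior_mul_lt (N := N) he k
  have hpt : ∀ m, m ≤ n₂ → ∃ x : Grid (N + 1) n₁ n₂, x.i = N * e + (k + 1) ∧ x.j = N * m :=
    fun m hm => exists_grid
      (by rw [mul_comm n₁]; exact hj2.le.trans (Nat.mul_le_mul_left N hb))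
      (by rw [mul_comm]; exact Nat.mul_le_mul_right N hm)
      fun H => not_dvd_interior e k H.1
  have hz : ∀ m, m = c ∨ m = d → val v (N * e + (k + 1)) (N * m) = 0 := by
    intro m hm
    obtain ⟨x, hxi, hxj⟩ := hpt m (by omega)
    rw [← hxi, ← hxj, val_self]
    have e1 := Nat.mul_le_mul_left N hcd
    refine h0 x ⟨?_, ?_⟩ fun H => ?_
    · rw [hxi]; exact ⟨hj1.le, hj2.le⟩
    · rw [hxj]; rcases hm with rfl | rfl <;> simp [e1]
    · have := H.2
      rw [hxj] at this
      rcases hm with rfl | rfl <;> omega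
  refine ⟨hz c (Or.inl rfl), hz d (Or.inr rfl), fun m hm hm' => ?_⟩
  obtain ⟨x, hxi, hxj⟩ := hpt (m + 1) (by omega)
  have h1 := hv.matchY (m + 1) (by omega) hm' x ⟨hxj, by rw [hxi]; exact hj1, by
    rw [hxi]; exact hj2⟩
  have h2 : (2 / ℓ) ≠ 0 := by positivity
  rw [dyBelow, dyAbove] at h1
  have h3 := mul_left_cancel₀ h2 h1
  simp only [Nat.add_sub_cancel] at h3
  rw [hxi, hxj, Nat.mul_succ, Nat.add_sub_cancel] at h3
  exact h3

/-- For `p = 2` every node is a corner of a square, so that case is vacuous. -/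
theorem isEmpty_grid (hN : N < 2) : IsEmpty (Grid (N + 1) n₁ n₂) := by
  refine ⟨fun x => x.not_dvd ?_⟩
  have h1 := x.i_le
  have h2 := x.j_le
  rcases (show N = 0 ∨ N = 1 by omega) with rfl | rfl
  · simp at h1 h2; simp [h1, h2]
  · exact ⟨one_dvd _, one_dvd _⟩

/-- A solution with zero data vanishes. -/
theorem Solves.eq_zero {ℓ h : ℝ} (hℓ : 0 < ℓ) (hh : 0 < h) {a b c d : ℕ}
    {v : Grid (N + 1) n₁ n₂ → ℝ} (hv : Solves ℓ h a b c d 0 v) (hab : a ≤ b) (hcd : c ≤ d)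
    (hb : b ≤ n₁) (hd : d ≤ n₂) (h0 : ∀ x, Closed a b c d x → ¬ Inside a b c d x → v x = 0) :
    ∀ x, Closed a b c d x → v x = 0 := by
  intro x hx
  rcases Nat.lt_or_ge N 2 with hN | hN
  · exact (isEmpty_grid hN).elim x
  obtain ⟨m, L, R, hR, hL⟩ := exists_rows_nodal hN
  obtain ⟨C, -, hC⟩ := exists_edgeBound hN
  have hX := hv.admissibleX hℓ hab hb hd h0
  have hY := hv.admissibleY hℓ hcd hb hd h0
  -- The energy vanishes, so do the interior values; `interface_eq_zero` then handles the edges line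
  -- by line.
  have hcell := cell_eq_zero hab hcd hL hR (by positivity : 0 ≤ h * (2 / ℓ) ^ 2) hX hY
    fun e₁ he₁ e₂ he₂ k k' => by
      have h1 := hv.cell_eq hb hd e₁ he₁ e₂ he₂ k k'
      rwa [show cell N (val (0 : Grid (N + 1) n₁ n₂ → ℝ)) e₁ e₂ k k' = 0 by simp [cell, val],
        zero_add] at h1
  obtain ⟨⟨hi1, hi2⟩, hj1, hj2⟩ := hx
  have hN0 : 0 < N := by omega
  rw [← val_self v x]
  by_cases hi : N ∣ x.i
  · have hj : ¬ N ∣ x.j := fun hj => x.not_dvd ⟨hi, hj⟩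
    obtain ⟨e₂, he₂, k', hk'⟩ := exists_strip hj1 hj2 hj
    obtain ⟨e₁, he₁⟩ := hi
    rw [he₁] at hi1 hi2 ⊢
    rw [hk']
    exact interface_eq_zero hC (hX e₂ he₂ k') (fun e he k => hcell e he e₂ he₂ k k')
      (Nat.le_of_mul_le_mul_left hi1 hN0) (Nat.le_of_mul_le_mul_left hi2 hN0)
  · obtain ⟨e₁, he₁, k, hk⟩ := exists_strip hi1 hi2 hi
    rw [hk]
    by_cases hj : N ∣ x.j
    · obtain ⟨e₂, he₂⟩ := hj
      rw [he₂] at hj1 hj2 ⊢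
      exact interface_eq_zero hC (hY e₁ he₁ k) (fun e he k' => hcell e₁ he₁ e he k k')
        (Nat.le_of_mul_le_mul_left hj1 hN0) (Nat.le_of_mul_le_mul_left hj2 hN0)
    · obtain ⟨e₂, he₂, k', hk'⟩ := exists_strip hj1 hj2 hj
      rw [hk']
      exact hcell e₁ he₁ e₂ he₂ k k'

end

section

/-! ### Linearity -/

section Linear

variable {p n₁ n₂ : ℕ}

theorem val_add (u v : Grid p n₁ n₂ → ℝ) (i j : ℕ) : val (u + v) i j = val u i j + val v i j := by
  simp only [val]; split_ifs <;> simp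

theorem val_smul (c : ℝ) (u : Grid p n₁ n₂ → ℝ) (i j : ℕ) : val (c • u) i j = c * val u i j := by
  simp only [val]; split_ifs <;> simp

theorem isLinearMap_of_val {F : (Grid p n₁ n₂ → ℝ) → Grid p n₁ n₂ → ℝ}
    (r : ℝ) (w : Grid p n₁ n₂ → Fin p → ℝ) (i j : Grid p n₁ n₂ → Fin p → ℕ)
    (h : ∀ u x, F u x = r * ∑ l, w x l * val u (i x l) (j x l)) : IsLinearMap ℝ F := by
  refine ⟨fun u v => ?_, fun c u => ?_⟩ <;> funext x
  · simp only [h, Pi.add_apply, val_add, mul_add, Finset.sum_add_distrib]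
  · simp only [h, Pi.smul_apply, smul_eq_mul, val_smul, Finset.mul_sum]
    exact Finset.sum_congr rfl fun l _ => by ring

theorem isLinearMap_dxLeft (ℓ : ℝ) : IsLinearMap ℝ (dxLeft (p := p) (n₁ := n₁) (n₂ := n₂) ℓ) :=
  isLinearMap_of_val _ (fun _ l => diff1 p (p - 1) l) (fun x l => x.i - (p - 1) + l)
    (fun x _ => x.j) fun _ _ => rfl

theorem isLinearMap_dxRight (ℓ : ℝ) : IsLinearMap ℝ (dxRight (p := p) (n₁ := n₁) (n₂ := n₂) ℓ) :=
  isLinearMap_of_val _ (fun _ l => diff1 p 0 l) (fun x l => x.i + l) (fun x _ => x.j) fun _ _ => rfl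

theorem isLinearMap_dyBelow (ℓ : ℝ) : IsLinearMap ℝ (dyBelow (p := p) (n₁ := n₁) (n₂ := n₂) ℓ) :=
  isLinearMap_of_val _ (fun _ l => diff1 p (p - 1) l) (fun x _ => x.i)
    (fun x l => x.j - (p - 1) + l) fun _ _ => rfl

theorem isLinearMap_dyAbove (ℓ : ℝ) : IsLinearMap ℝ (dyAbove (p := p) (n₁ := n₁) (n₂ := n₂) ℓ) :=
  isLinearMap_of_val _ (fun _ l => diff1 p 0 l) (fun x _ => x.i) (fun x l => x.j + l) fun _ _ => rfl

theorem isLinearMap_euler (ℓ h : ℝ) :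
    IsLinearMap ℝ (euler (p := p) (n₁ := n₁) (n₂ := n₂) ℓ h) := by
  have h1 := isLinearMap_of_val (n₁ := n₁) (n₂ := n₂) ((2 / ℓ) ^ 2)
    (fun x (l : Fin p) => diff2 p (x.i % (p - 1)) l)
    (fun x l => (p - 1) * (x.i / (p - 1)) + l) (fun x _ => x.j) fun _ _ => rfl
  have h2 := isLinearMap_of_val (n₁ := n₁) (n₂ := n₂) ((2 / ℓ) ^ 2)
    (fun x (l : Fin p) => diff2 p (x.j % (p - 1)) l)
    (fun x _ => x.i) (fun x l => (p - 1) * (x.j / (p - 1)) + l) fun _ _ => rfl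
  have h3 := (LinearMap.id - h • (h1.mk' _ + h2.mk' _) :
    (Grid p n₁ n₂ → ℝ) →ₗ[ℝ] Grid p n₁ n₂ → ℝ).isLinear
  convert h3 using 1
  funext u x
  simp [euler, lap, mul_add]

variable {E : Type*} [AddCommGroup E] [Module ℝ E] {J : Grid p n₁ n₂ → Prop} [DecidablePred J]

theorem isLinearMap_overwrite {f : E → Grid p n₁ n₂ → ℝ} {r : E → {x // J x} → ℝ}
    (hf : IsLinearMap ℝ f) (hr : IsLinearMap ℝ r) :
    IsLinearMap ℝ fun e => overwrite J (f e) (r e) := by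
  refine ⟨fun u v => ?_, fun c u => ?_⟩ <;> funext x
  · simp only [overwrite, Pi.add_apply, hf.map_add, hr.map_add]; split_ifs <;> rfl
  · simp only [overwrite, Pi.smul_apply, hf.map_smul, hr.map_smul]; split_ifs <;> rfl

theorem overwrite_eq_add (b : Grid p n₁ n₂ → ℝ) (w : {x // J x} → ℝ) :
    overwrite J b w = overwrite J b 0 + overwrite J 0 w := by
  funext x
  simp only [overwrite, Pi.add_apply]; split_ifs <;> simp

theorem overwrite_of {b : Grid p n₁ n₂ → ℝ} {w : {x // J x} → ℝ} {x : Grid p n₁ n₂} (hx : J x) :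
    overwrite J b w x = w ⟨x, hx⟩ := dif_pos hx

theorem overwrite_of_not {b : Grid p n₁ n₂ → ℝ} {w : {x // J x} → ℝ} {x : Grid p n₁ n₂}
    (hx : ¬ J x) : overwrite J b w x = b x := dif_neg hx

theorem block_mulVec {A : (Grid p n₁ n₂ → ℝ) → Grid p n₁ n₂ → ℝ} (hA : IsLinearMap ℝ A)
    (w : {x // J x} → ℝ) (x : {x // J x}) :
    (block J A).mulVec w x = A (overwrite J 0 w) x := by
  have h1 : overwrite J 0 w = ∑ y, w y • Pi.single (y : Grid p n₁ n₂) (1 : ℝ) := by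
    funext z
    rw [Finset.sum_apply]
    by_cases hz : J z
    · rw [overwrite_of hz, Finset.sum_eq_single (⟨z, hz⟩ : {x // J x})]
      · simp
      · intro y _ hy
        have : z ≠ y := fun H => hy (Subtype.ext H.symm)
        simp [this]
      · simp
    · rw [overwrite_of_not hz, Finset.sum_eq_zero]
      · rfl
      · intro y _
        have : z ≠ y := fun H => hz (H ▸ y.2)
        simp [this]
  have h2 : A (overwrite J 0 w) = ∑ y, w y • A (Pi.single (y : Grid p n₁ n₂) (1 : ℝ)) := by
    rw [h1]
    have := map_sum (hA.mk' A) (fun y => w y • Pi.single (y : Grid p n₁ n₂) (1 : ℝ)) Finset.univ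
    simp only [map_smul] at this
    exact this
  rw [h2, Finset.sum_apply]
  exact Finset.sum_congr rfl fun y _ => mul_comm _ _

theorem isUnit_det_of_ker {ι : Type*} [Fintype ι] [DecidableEq ι] {A : Matrix ι ι ℝ}
    (h : ∀ w, A.mulVec w = 0 → w = 0) : IsUnit A.det := by
  rw [← Matrix.isUnit_iff_isUnit_det, ← Matrix.mulVec_injective_iff_isUnit, ← Matrix.coe_mulVecLin,
    ← LinearMap.ker_eq_bot, LinearMap.ker_eq_bot']
  exact h

/-- Solvers which depend linearly on right-hand side and boundary data. -/
def LinearSolver (S : Solver p n₁ n₂) : Prop :=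
  IsLinearMap ℝ fun q : (Grid p n₁ n₂ → ℝ) × (Grid p n₁ n₂ → ℝ) => S q.1 q.2

theorem LinearSolver.comp {S : Solver p n₁ n₂} (hS : LinearSolver S) {f g : E → Grid p n₁ n₂ → ℝ}
    (hf : IsLinearMap ℝ f) (hg : IsLinearMap ℝ g) : IsLinearMap ℝ fun e => S (f e) (g e) := by
  refine ⟨fun u v => ?_, fun c u => ?_⟩
  · simp only [hf.map_add, hg.map_add]; exact hS.map_add (f u, g u) (f v, g v)
  · simp only [hf.map_smul, hg.map_smul]; exact hS.map_smul c (f u, g u)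

theorem LinearSolver.zero_left {S : Solver p n₁ n₂} (hS : LinearSolver S) : IsLinearMap ℝ (S 0) :=
  hS.comp (0 : (Grid p n₁ n₂ → ℝ) →ₗ[ℝ] Grid p n₁ n₂ → ℝ).isLinear LinearMap.id.isLinear

theorem LinearSolver.map_add {S : Solver p n₁ n₂} (hS : LinearSolver S)
    (g g' b b' : Grid p n₁ n₂ → ℝ) : S (g + g') (b + b') = S g b + S g' b' :=
  IsLinearMap.map_add hS (g, b) (g', b')

theorem isLinearMap_comp {E' E'' : Type*} [AddCommGroup E'] [Module ℝ E'] [AddCommGroup E'']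
    [Module ℝ E''] {f : E' → E''} {g : E → E'} (hf : IsLinearMap ℝ f) (hg : IsLinearMap ℝ g) :
    IsLinearMap ℝ fun e => f (g e) :=
  (hf.mk' f ∘ₗ hg.mk' g).isLinear

theorem isLinearMap_restrict_sub {K : Grid p n₁ n₂ → Prop} {f g : E → Grid p n₁ n₂ → ℝ}
    (hf : IsLinearMap ℝ f) (hg : IsLinearMap ℝ g) :
    IsLinearMap ℝ fun e => (fun x : {x // K x} => f e x - g e x) := by
  refine ⟨fun u v => ?_, fun c u => ?_⟩ <;> funext x
  · simp only [hf.map_add, hg.map_add, Pi.add_apply]; ring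
  · simp only [hf.map_smul, hg.map_smul, Pi.smul_apply, smul_eq_mul]; ring

theorem isLinearMap_mulVec {ι : Type*} [Fintype ι] (A : Matrix ι ι ℝ) :
    IsLinearMap ℝ A.mulVec := A.mulVecLin.isLinear

theorem isLinearMap_zero_val {K : Grid p n₁ n₂ → Prop} :
    IsLinearMap ℝ fun _ : E => (0 : {x // K x} → ℝ) :=
  (0 : E →ₗ[ℝ] {x // K x} → ℝ).isLinear

theorem linearSolver_leafSolve (ℓ h : ℝ) (a c : ℕ) :
    LinearSolver (leafSolve (p := p) (n₁ := n₁) (n₂ := n₂) ℓ h a c) := by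
  have hg := (LinearMap.fst ℝ (Grid p n₁ n₂ → ℝ) (Grid p n₁ n₂ → ℝ)).isLinear
  have hb := (LinearMap.snd ℝ (Grid p n₁ n₂ → ℝ) (Grid p n₁ n₂ → ℝ)).isLinear
  exact isLinearMap_overwrite hb (isLinearMap_comp (isLinearMap_mulVec _)
    (isLinearMap_restrict_sub hg (isLinearMap_comp (isLinearMap_euler ℓ h)
      (isLinearMap_overwrite hb isLinearMap_zero_val))))

theorem linearSolver_mergeSolve {Fα Fβ : (Grid p n₁ n₂ → ℝ) → Grid p n₁ n₂ → ℝ}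
    {Sα Sβ : Solver p n₁ n₂} (hFα : IsLinearMap ℝ Fα) (hFβ : IsLinearMap ℝ Fβ)
    (hα : LinearSolver Sα) (hβ : LinearSolver Sβ) : LinearSolver (mergeSolve J Fα Fβ Sα Sβ) := by
  have hg := (LinearMap.fst ℝ (Grid p n₁ n₂ → ℝ) (Grid p n₁ n₂ → ℝ)).isLinear
  have hb := (LinearMap.snd ℝ (Grid p n₁ n₂ → ℝ) (Grid p n₁ n₂ → ℝ)).isLinear
  have h0 := isLinearMap_overwrite (J := J) hb isLinearMap_zero_val
  exact hβ.comp hg (hα.comp hg (isLinearMap_overwrite hb (isLinearMap_comp (isLinearMap_mulVec _)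
    (isLinearMap_restrict_sub (isLinearMap_comp hFβ (hβ.comp hg h0))
      (isLinearMap_comp hFα (hα.comp hg h0))))))

end Linear

/-! ### Locality -/

variable {N n₁ n₂ : ℕ}

theorem Solves.sub {ℓ h : ℝ} {a b c d : ℕ} {g g' v v' : Grid (N + 1) n₁ n₂ → ℝ}
    (hv : Solves ℓ h a b c d g v) (hv' : Solves ℓ h a b c d g' v') :
    Solves ℓ h a b c d (g - g') (v - v') where
  colloc e₁ he₁ e₂ he₂ x hx := by
    rw [(isLinearMap_euler ℓ h).map_sub, Pi.sub_apply, Pi.sub_apply, hv.colloc e₁ he₁ e₂ he₂ x hx,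
      hv'.colloc e₁ he₁ e₂ he₂ x hx]
  matchX m h1 h2 x hx := by
    rw [(isLinearMap_dxLeft ℓ).map_sub, (isLinearMap_dxRight ℓ).map_sub, Pi.sub_apply,
      Pi.sub_apply, hv.matchX m h1 h2 x hx, hv'.matchX m h1 h2 x hx]
  matchY m h1 h2 x hx := by
    rw [(isLinearMap_dyBelow ℓ).map_sub, (isLinearMap_dyAbove ℓ).map_sub, Pi.sub_apply,
      Pi.sub_apply, hv.matchY m h1 h2 x hx, hv'.matchY m h1 h2 x hx]

section Local

variable {ℓ h : ℝ} {a b c d : ℕ} {g v v' : Grid (N + 1) n₁ n₂ → ℝ}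

theorem val_congr (hvv : ∀ x, Closed a b c d x → v x = v' x) {i j : ℕ} (hi1 : N * a ≤ i)
    (hi2 : i ≤ N * b) (hj1 : N * c ≤ j) (hj2 : j ≤ N * d) : val v i j = val v' i j := by
  simp only [val]
  split_ifs with hx
  · exact hvv _ ⟨⟨hi1, hi2⟩, hj1, hj2⟩
  · rfl

theorem mul_bounds {a b m : ℕ} (ha : a ≤ m) (hb : m < b) :
    N * a ≤ N * m ∧ N * m + N ≤ N * b := by
  rw [← Nat.mul_succ]
  exact ⟨Nat.mul_le_mul_left N ha, Nat.mul_le_mul_left N hb⟩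

theorem euler_congr (hvv : ∀ x, Closed a b c d x → v x = v' x) {e₁ e₂ : ℕ}
    (he₁ : e₁ ∈ Finset.Ico a b) (he₂ : e₂ ∈ Finset.Ico c d) {x : Grid (N + 1) n₁ n₂}
    (hx : InLeaf (N + 1) n₁ n₂ e₁ e₂ x) : euler ℓ h v x = euler ℓ h v' x := by
  obtain ⟨⟨h1, h2⟩, h3, h4⟩ := hx
  rw [Nat.add_sub_cancel] at h1 h2 h3 h4
  obtain ⟨k, hk⟩ := exists_interior h1 h2
  obtain ⟨k', hk'⟩ := exists_interior h3 h4
  obtain ⟨a1, a2⟩ := Finset.mem_Ico.1 he₁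
  obtain ⟨c1, c2⟩ := Finset.mem_Ico.1 he₂
  obtain ⟨a3, a4⟩ := mul_bounds (N := N) a1 a2
  obtain ⟨c3, c4⟩ := mul_bounds (N := N) c1 c2
  have hk1 := k.2
  have hk2 := k'.2
  have e1 : cellX N (val v) e₁ e₂ k k' = cellX N (val v') e₁ e₂ k k' := by
    rw [cellX, cellX, curv, curv]
    refine Finset.sum_congr rfl fun l _ => ?_
    have := l.2
    rw [val_congr hvv] <;> omega
  have e2 : cellY N (val v) e₁ e₂ k k' = cellY N (val v') e₁ e₂ k k' := by
    rw [cellY, cellY, curv, curv]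
    refine Finset.sum_congr rfl fun l _ => ?_
    have := l.2
    rw [val_congr hvv] <;> omega
  rw [euler, euler, lap_eq ℓ v x hk hk', lap_eq ℓ v' x hk hk', e1, e2,
    hvv x ⟨⟨by omega, by omega⟩, by omega, by omega⟩]

theorem dxLeft_congr (hvv : ∀ x, Closed a b c d x → v x = v' x) {m : ℕ} (h1 : a < m) (h2 : m ≤ b)
    {x : Grid (N + 1) n₁ n₂} (hx : OnX (N + 1) n₁ n₂ m c d x) : dxLeft ℓ v x = dxLeft ℓ v' x := by
  obtain ⟨hi, hj⟩ := hx
  obtain ⟨m, rfl⟩ : ∃ m', m = m' + 1 := ⟨m - 1, by omega⟩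
  obtain ⟨a3, a4⟩ := mul_bounds (N := N) (show a ≤ m by omega) h2
  rw [Nat.add_sub_cancel] at hi hj
  rw [Nat.mul_succ] at hi
  rw [dxLeft, dxLeft]
  congr 1
  refine Finset.sum_congr rfl fun l _ => ?_
  have := l.2
  rw [val_congr hvv] <;> omega

theorem dxRight_congr (hvv : ∀ x, Closed a b c d x → v x = v' x) {m : ℕ} (h1 : a ≤ m) (h2 : m < b)
    {x : Grid (N + 1) n₁ n₂} (hx : OnX (N + 1) n₁ n₂ m c d x) :
    dxRight ℓ v x = dxRight ℓ v' x := by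
  obtain ⟨hi, hj⟩ := hx
  obtain ⟨a3, a4⟩ := mul_bounds (N := N) h1 h2
  rw [Nat.add_sub_cancel] at hi hj
  rw [dxRight, dxRight]
  congr 1
  refine Finset.sum_congr rfl fun l _ => ?_
  have := l.2
  rw [val_congr hvv] <;> omega

theorem dyBelow_congr (hvv : ∀ x, Closed a b c d x → v x = v' x) {m : ℕ} (h1 : c < m) (h2 : m ≤ d)
    {x : Grid (N + 1) n₁ n₂} (hx : OnY (N + 1) n₁ n₂ m a b x) :
    dyBelow ℓ v x = dyBelow ℓ v' x := by
  obtain ⟨hi, hj⟩ := hx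
  obtain ⟨m, rfl⟩ : ∃ m', m = m' + 1 := ⟨m - 1, by omega⟩
  obtain ⟨a3, a4⟩ := mul_bounds (N := N) (show c ≤ m by omega) h2
  rw [Nat.add_sub_cancel] at hi hj
  rw [Nat.mul_succ] at hi
  rw [dyBelow, dyBelow]
  congr 1
  refine Finset.sum_congr rfl fun l _ => ?_
  have := l.2
  rw [val_congr hvv] <;> omega

theorem dyAbove_congr (hvv : ∀ x, Closed a b c d x → v x = v' x) {m : ℕ} (h1 : c ≤ m) (h2 : m < d)
    {x : Grid (N + 1) n₁ n₂} (hx : OnY (N + 1) n₁ n₂ m a b x) :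
    dyAbove ℓ v x = dyAbove ℓ v' x := by
  obtain ⟨hi, hj⟩ := hx
  obtain ⟨a3, a4⟩ := mul_bounds (N := N) h1 h2
  rw [Nat.add_sub_cancel] at hi hj
  rw [dyAbove, dyAbove]
  congr 1
  refine Finset.sum_congr rfl fun l _ => ?_
  have := l.2
  rw [val_congr hvv] <;> omega

theorem Solves.congr (hv : Solves ℓ h a b c d g v) (hvv : ∀ x, Closed a b c d x → v x = v' x) :
    Solves ℓ h a b c d g v' where
  colloc e₁ he₁ e₂ he₂ x hx := by
    rw [← euler_congr hvv he₁ he₂ hx, hv.colloc e₁ he₁ e₂ he₂ x hx]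
  matchX m h1 h2 x hx := by
    rw [← dxLeft_congr hvv h1 h2.le hx, ← dxRight_congr hvv h1.le h2 hx, hv.matchX m h1 h2 x hx]
  matchY m h1 h2 x hx := by
    rw [← dyBelow_congr hvv h1 h2.le hx, ← dyAbove_congr hvv h1.le h2 hx, hv.matchY m h1 h2 x hx]

theorem Solves.glueX {m : ℕ} (h1 : Solves ℓ h a m c d g v)
    (h2 : Solves ℓ h m b c d g v)
    (h3 : ∀ x, OnX (N + 1) n₁ n₂ m c d x → dxLeft ℓ v x = dxRight ℓ v x) :
    Solves ℓ h a b c d g v where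
  colloc e₁ he₁ e₂ he₂ x hx := by
    obtain ⟨a1, a2⟩ := Finset.mem_Ico.1 he₁
    rcases Nat.lt_or_ge e₁ m with hm | hm
    · exact h1.colloc e₁ (Finset.mem_Ico.2 ⟨a1, hm⟩) e₂ he₂ x hx
    · exact h2.colloc e₁ (Finset.mem_Ico.2 ⟨hm, a2⟩) e₂ he₂ x hx
  matchX m' a1 a2 x hx := by
    rcases lt_trichotomy m' m with hm | rfl | hm
    · exact h1.matchX m' a1 hm x hx
    · exact h3 x hx
    · exact h2.matchX m' hm a2 x hx
  matchY m' a1 a2 x hx := by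
    obtain ⟨hj, hi1, hi2⟩ := hx
    rcases lt_trichotomy x.i ((N + 1 - 1) * m) with hm | hm | hm
    · exact h1.matchY m' a1 a2 x ⟨hj, hi1, hm⟩
    -- A horizontal edge line meets the cut in a corner, which carries no equation.
    · exact (x.not_dvd ⟨⟨m, hm⟩, ⟨m', hj⟩⟩).elim
    · exact h2.matchY m' a1 a2 x ⟨hj, hm, hi2⟩

theorem Solves.glueY {m : ℕ} (h1 : Solves ℓ h a b c m g v)
    (h2 : Solves ℓ h a b m d g v)
    (h3 : ∀ x, OnY (N + 1) n₁ n₂ m a b x → dyBelow ℓ v x = dyAbove ℓ v x) :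
    Solves ℓ h a b c d g v where
  colloc e₁ he₁ e₂ he₂ x hx := by
    obtain ⟨a1, a2⟩ := Finset.mem_Ico.1 he₂
    rcases Nat.lt_or_ge e₂ m with hm | hm
    · exact h1.colloc e₁ he₁ e₂ (Finset.mem_Ico.2 ⟨a1, hm⟩) x hx
    · exact h2.colloc e₁ he₁ e₂ (Finset.mem_Ico.2 ⟨hm, a2⟩) x hx
  matchX m' a1 a2 x hx := by
    obtain ⟨hj, hi1, hi2⟩ := hx
    rcases lt_trichotomy x.j ((N + 1 - 1) * m) with hm | hm | hm
    · exact h1.matchX m' a1 a2 x ⟨hj, hi1, hm⟩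
    · exact (x.not_dvd ⟨⟨m', hj⟩, ⟨m, hm⟩⟩).elim
    · exact h2.matchX m' a1 a2 x ⟨hj, hm, hi2⟩
  matchY m' a1 a2 x hx := by
    rcases lt_trichotomy m' m with hm | rfl | hm
    · exact h1.matchY m' a1 hm x hx
    · exact h3 x hx
    · exact h2.matchY m' hm a2 x hx

end Local

end

section

/-! ### Well-posedness along the tree -/

variable {N n₁ n₂ : ℕ} {ℓ h : ℝ}

/-- A linear solver which changes only the open rectangle and solves the discrete problem there. -/
structure IsSolver (ℓ h : ℝ) (a b c d : ℕ) (S : Solver (N + 1) n₁ n₂) : Prop where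
  linear : LinearSolver S
  outside : ∀ g b' x, ¬ Inside a b c d x → S g b' x = b' x
  solves : ∀ g b', Solves ℓ h a b c d g (S g b')

theorem Inside.closed {a b c d : ℕ} {x : Grid (N + 1) n₁ n₂} (hx : Inside a b c d x) :
    Closed a b c d x :=
  ⟨⟨hx.1.1.le, hx.1.2.le⟩, hx.2.1.le, hx.2.2.le⟩

theorem solves_overwrite_inLeaf {a c : ℕ} {g v : Grid (N + 1) n₁ n₂ → ℝ}
    (hv : ∀ x, InLeaf (N + 1) n₁ n₂ a c x → euler ℓ h v x = g x) :
    Solves ℓ h a (a + 1) c (c + 1) g v where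
  colloc e₁ he₁ e₂ he₂ x hx := by
    rw [Finset.mem_Ico] at he₁ he₂
    obtain rfl : e₁ = a := by omega
    obtain rfl : e₂ = c := by omega
    exact hv x hx
  matchX m h1 h2 := by omega
  matchY m h1 h2 := by omega

theorem leaf_spec (hℓ : 0 < ℓ) (hh : 0 < h) {a c : ℕ} (ha : a + 1 ≤ n₁) (hc : c + 1 ≤ n₂) :
    IsUnit (block (InLeaf (N + 1) n₁ n₂ a c) (euler ℓ h)).det ∧
      IsSolver ℓ h a (a + 1) c (c + 1) (leafSolve (p := N + 1) (n₁ := n₁) (n₂ := n₂) ℓ h a c) := by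
  have hdet : IsUnit (block (InLeaf (N + 1) n₁ n₂ a c) (euler ℓ h)).det := by
    refine isUnit_det_of_ker fun w hw => ?_
    have hs : Solves ℓ h a (a + 1) c (c + 1) 0 (overwrite (InLeaf (N + 1) n₁ n₂ a c) 0 w) :=
      solves_overwrite_inLeaf fun x hx => by
        rw [← block_mulVec (isLinearMap_euler ℓ h) w ⟨x, hx⟩, hw]; rfl
    have h0 := hs.eq_zero hℓ hh (Nat.le_succ a) (Nat.le_succ c) ha hc fun x _ hx =>
      overwrite_of_not hx
    funext x
    have h1 := h0 x (Inside.closed x.2)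
    rwa [overwrite_of x.2] at h1
  refine ⟨hdet, linearSolver_leafSolve ℓ h a c, fun g b x hx => overwrite_of_not hx, fun g b => ?_⟩
  refine solves_overwrite_inLeaf fun x hx => ?_
  rw [leafSolve, overwrite_eq_add, (isLinearMap_euler ℓ h).map_add, Pi.add_apply,
    ← block_mulVec (isLinearMap_euler ℓ h) _ ⟨x, hx⟩, Matrix.mulVec_mulVec,
    Matrix.mul_nonsing_inv _ hdet, Matrix.one_mulVec]
  ring

/-- A kernel vector of the interface matrix, extended by the two local solves with zero data, solves
the homogeneous problem on the merged rectangle and so vanishes by `Solves.eq_zero`. The hypotheses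
on the subrectangles treat vertical and horizontal cuts alike. -/
theorem merge_spec (hℓ : 0 < ℓ) (hh : 0 < h) {a b c d a₁ b₁ c₁ d₁ a₂ b₂ c₂ d₂ : ℕ}
    (hb : b ≤ n₁) (hd : d ≤ n₂) (hab : a ≤ b) (hcd : c ≤ d) (hab₂ : a₂ ≤ b₂) (hcd₂ : c₂ ≤ d₂)
    (hb₂ : b₂ ≤ n₁) (hd₂ : d₂ ≤ n₂)
    {J : Grid (N + 1) n₁ n₂ → Prop} [DecidablePred J]
    {Fα Fβ : (Grid (N + 1) n₁ n₂ → ℝ) → Grid (N + 1) n₁ n₂ → ℝ} {Sα Sβ : Solver (N + 1) n₁ n₂}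
    (hα : IsSolver ℓ h a₁ b₁ c₁ d₁ Sα) (hβ : IsSolver ℓ h a₂ b₂ c₂ d₂ Sβ)
    (hFα : IsLinearMap ℝ Fα) (hFβ : IsLinearMap ℝ Fβ)
    (hJ : ∀ x, J x → Inside a b c d x ∧ ¬ Inside a₁ b₁ c₁ d₁ x ∧ ¬ Inside a₂ b₂ c₂ d₂ x)
    (hin₁ : ∀ x : Grid (N + 1) n₁ n₂, Inside a₁ b₁ c₁ d₁ x → Inside a b c d x)
    (hin₂ : ∀ x : Grid (N + 1) n₁ n₂, Inside a₂ b₂ c₂ d₂ x → Inside a b c d x)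
    (hdis₁ : ∀ x : Grid (N + 1) n₁ n₂, Closed a₁ b₁ c₁ d₁ x → ¬ Inside a₂ b₂ c₂ d₂ x)
    (hdis₂ : ∀ x : Grid (N + 1) n₁ n₂, Closed a₂ b₂ c₂ d₂ x → ¬ Inside a₁ b₁ c₁ d₁ x)
    (hcα : ∀ v v' : Grid (N + 1) n₁ n₂ → ℝ, (∀ x, Closed a₁ b₁ c₁ d₁ x → v x = v' x) →
      ∀ x, J x → Fα v x = Fα v' x)
    (hcβ : ∀ v v' : Grid (N + 1) n₁ n₂ → ℝ, (∀ x, Closed a₂ b₂ c₂ d₂ x → v x = v' x) →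
      ∀ x, J x → Fβ v x = Fβ v' x)
    (hglue : ∀ g v, Solves ℓ h a₁ b₁ c₁ d₁ g v → Solves ℓ h a₂ b₂ c₂ d₂ g v →
      (∀ x, J x → Fα v x = Fβ v x) → Solves ℓ h a b c d g v) :
    IsUnit (mergeMatrix J Fα Fβ Sα Sβ).det ∧
      IsSolver ℓ h a b c d (mergeSolve J Fα Fβ Sα Sβ) := by
  have hsolve : ∀ g b', (∀ x, J x → Fα (Sα g b') x = Fβ (Sβ g b') x) →
      Solves ℓ h a b c d g (Sβ g (Sα g b')) := by
    intro g b' hF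
    have h1 : ∀ x, Closed a₁ b₁ c₁ d₁ x → Sα g b' x = Sβ g (Sα g b') x := fun x hx =>
      (hβ.outside _ _ x (hdis₁ x hx)).symm
    have h2 : ∀ x, Closed a₂ b₂ c₂ d₂ x → Sβ g b' x = Sβ g (Sα g b') x := by
      -- The solve in α alters no node of the closed rectangle β. By uniqueness in β it therefore
      -- does not affect the solution there, so the order of the two solves is immaterial.
      intro x hx
      have h3 := ((hβ.solves g (Sα g b')).sub (hβ.solves g b'))
      rw [sub_self] at h3
      have h4 := h3.eq_zero hℓ hh hab₂ hcd₂ hb₂ hd₂ (fun y hy hy' => by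
        rw [Pi.sub_apply, hβ.outside _ _ y hy', hβ.outside _ _ y hy',
          hα.outside _ _ y (hdis₂ y hy), sub_self]) x hx
      rw [Pi.sub_apply] at h4
      linarith
    refine hglue g _ ((hα.solves g b').congr h1) (hβ.solves g _) fun x hx => ?_
    rw [← hcα _ _ h1 x hx, ← hcβ _ _ h2 x hx, hF x hx]
  have houtside : ∀ g b' x, ¬ Inside a b c d x → Sβ g (Sα g b') x = b' x := fun g b' x hx => by
    rw [hβ.outside _ _ x fun H => hx (hin₂ x H), hα.outside _ _ x fun H => hx (hin₁ x H)]
  have hmul : ∀ (w : {x // J x} → ℝ) (x : {x // J x}), (mergeMatrix J Fα Fβ Sα Sβ).mulVec w x =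
      Fα (Sα 0 (overwrite J 0 w)) x - Fβ (Sβ 0 (overwrite J 0 w)) x := by
    intro w x
    rw [mergeMatrix, Matrix.sub_mulVec, Pi.sub_apply,
      block_mulVec (isLinearMap_comp hFα hα.linear.zero_left),
      block_mulVec (isLinearMap_comp hFβ hβ.linear.zero_left)]
  have hdet : IsUnit (mergeMatrix J Fα Fβ Sα Sβ).det := by
    refine isUnit_det_of_ker fun w hw => ?_
    have hs := hsolve 0 (overwrite J 0 w) fun x hx => by
      have h1 := hmul w ⟨x, hx⟩
      rw [hw, Pi.zero_apply] at h1
      linarith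
    have h0 := hs.eq_zero hℓ hh hab hcd hb hd fun x _ hx => by
      rw [houtside _ _ x hx, overwrite_of_not fun H => hx (hJ x H).1, Pi.zero_apply]
    funext x
    obtain ⟨h1, h2, h3⟩ := hJ x x.2
    have h4 := h0 x h1.closed
    rwa [hβ.outside _ _ _ h3, hα.outside _ _ _ h2, overwrite_of x.2] at h4
  refine ⟨hdet, linearSolver_mergeSolve hFα hFβ hα.linear hβ.linear, fun g b' x hx => ?_,
    fun g b' => hsolve g _ fun x hx => ?_⟩
  · rw [mergeSolve, houtside _ _ x hx, overwrite_of_not fun H => hx (hJ x H).1]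
  · set w := (mergeMatrix J Fα Fβ Sα Sβ)⁻¹.mulVec fun x : {x // J x} =>
      Fβ (Sβ g (overwrite J b' 0)) x - Fα (Sα g (overwrite J b' 0)) x with hw
    -- By linearity the local solutions split into a part with zero interface values and a part
    -- generated by `w`; the choice of `w` cancels the flux jump of the first part.
    have h1 := hmul w ⟨x, hx⟩
    rw [hw, Matrix.mulVec_mulVec, Matrix.mul_nonsing_inv _ hdet, Matrix.one_mulVec, ← hw] at h1
    have h2 := hα.linear.map_add g 0 (overwrite J b' 0) (overwrite J 0 w)
    have h3 := hβ.linear.map_add g 0 (overwrite J b' 0) (overwrite J 0 w)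
    rw [add_zero, ← overwrite_eq_add] at h2 h3
    rw [h2, h3, hFα.map_add, hFβ.map_add, Pi.add_apply, Pi.add_apply]
    linarith

theorem Tree.lt {a b c d : ℕ} (τ : Tree a b c d) : a < b ∧ c < d := by
  induction τ with
  | leaf a c => omega
  | splitX m α β hα hβ => omega
  | splitY m α β hα hβ => omega

theorem solve_spec (hℓ : 0 < ℓ) (hh : 0 < h) {a b c d : ℕ} (τ : Tree a b c d) (hb : b ≤ n₁)
    (hd : d ≤ n₂) : WellDefined (N + 1) n₁ n₂ ℓ h τ ∧
      IsSolver ℓ h a b c d (solve (p := N + 1) (n₁ := n₁) (n₂ := n₂) ℓ h τ) := by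
  induction τ with
  | leaf a c => exact leaf_spec hℓ hh hb hd
  | @splitX a b c d m α β hα hβ =>
    have h1 := α.lt
    have h2 := β.lt
    obtain ⟨wα, sα⟩ := hα (by omega) hd
    obtain ⟨wβ, sβ⟩ := hβ hb hd
    have e1 := Nat.mul_le_mul_left N h1.1
    have e2 := Nat.mul_le_mul_left N h2.1
    rw [Nat.mul_succ] at e1 e2
    -- `N = 0` is not excluded here, but then the interface has no nodes.
    have hN : ∀ x : Grid (N + 1) n₁ n₂, OnX (N + 1) n₁ n₂ m c d x → 0 < N := by
      rintro x ⟨-, hj1, hj2⟩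
      rw [Nat.add_sub_cancel] at hj1 hj2
      exact Nat.pos_of_ne_zero fun h0 => by subst h0; omega
    have hm := merge_spec hℓ hh hb hd (by omega : a ≤ b) h1.2.le h2.1.le h1.2.le hb hd
      (J := OnX (N + 1) n₁ n₂ m c d) sα sβ (isLinearMap_dxLeft ℓ) (isLinearMap_dxRight ℓ)
      (fun x hx => by
        have := hN x hx
        obtain ⟨hi, hj⟩ := hx
        rw [Nat.add_sub_cancel] at hi hj
        refine ⟨⟨⟨by omega, by omega⟩, hj⟩, fun H => ?_, fun H => ?_⟩
        · have := H.1; omega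
        · have := H.1; omega)
      (fun x hx => ⟨⟨hx.1.1, by have := hx.1; omega⟩, hx.2⟩)
      (fun x hx => ⟨⟨by have := hx.1; omega, hx.1.2⟩, hx.2⟩)
      (fun x hx H => by have := hx.1; have := H.1; omega)
      (fun x hx H => by have := hx.1; have := H.1; omega)
      (fun v v' hvv x hx => dxLeft_congr hvv h1.1 le_rfl hx)
      (fun v v' hvv x hx => dxRight_congr hvv le_rfl h2.1 hx)
      fun g v => Solves.glueX
    exact ⟨⟨wα, wβ, hm.1⟩, hm.2⟩
  | @splitY a b c d m α β hα hβ =>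
    have h1 := α.lt
    have h2 := β.lt
    obtain ⟨wα, sα⟩ := hα hb (by omega)
    obtain ⟨wβ, sβ⟩ := hβ hb hd
    have e1 := Nat.mul_le_mul_left N h1.2
    have e2 := Nat.mul_le_mul_left N h2.2
    rw [Nat.mul_succ] at e1 e2
    have hN : ∀ x : Grid (N + 1) n₁ n₂, OnY (N + 1) n₁ n₂ m a b x → 0 < N := by
      rintro x ⟨-, hj1, hj2⟩
      rw [Nat.add_sub_cancel] at hj1 hj2
      exact Nat.pos_of_ne_zero fun h0 => by subst h0; omega
    have hm := merge_spec hℓ hh hb hd h1.1.le (by omega : c ≤ d) h1.1.le h2.2.le hb hd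
      (J := OnY (N + 1) n₁ n₂ m a b) sα sβ (isLinearMap_dyBelow ℓ) (isLinearMap_dyAbove ℓ)
      (fun x hx => by
        have := hN x hx
        obtain ⟨hj, hi⟩ := hx
        rw [Nat.add_sub_cancel] at hi hj
        refine ⟨⟨hi, by omega, by omega⟩, fun H => ?_, fun H => ?_⟩
        · have := H.2; omega
        · have := H.2; omega)
      (fun x hx => ⟨hx.1, hx.2.1, by have := hx.2; omega⟩)
      (fun x hx => ⟨hx.1, by have := hx.2; omega, hx.2.2⟩)
      (fun x hx H => by have := hx.2; have := H.2; omega)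
      (fun x hx H => by have := hx.2; have := H.2; omega)
      (fun v v' hvv x hx => dyBelow_congr hvv h1.2 le_rfl hx)
      (fun v v' hvv x hx => dyAbove_congr hvv le_rfl h2.2 hx)
      fun g v => Solves.glueY
    exact ⟨⟨wα, wβ, hm.1⟩, hm.2⟩

end

section

/-! ### Sums over the grid -/

/-- Sum over the nodes of a line interior to its squares. -/
def sumInterior (N n : ℕ) (φ : ℕ → ℝ) : ℝ :=
  ∑ e ∈ Finset.Ico 0 n, ∑ k : Fin (N - 1), φ (N * e + (k + 1))

/-- Sum over the nodes of a line at the ends of its squares. -/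
def sumEnds (N n : ℕ) (φ : ℕ → ℝ) : ℝ := ∑ e ∈ Finset.range (n + 1), φ (N * e)

theorem sum_range_eq {N : ℕ} (hN : 1 ≤ N) (n : ℕ) (φ : ℕ → ℝ) :
    ∑ i ∈ Finset.range (n * N + 1), φ i = sumEnds N n φ + sumInterior N n φ := by
  induction n with
  | zero => simp [sumEnds, sumInterior]
  | succ n ih =>
    have h1 : sumEnds N (n + 1) φ = sumEnds N n φ + φ (N * (n + 1)) := Finset.sum_range_succ _ _
    have h2 : sumInterior N (n + 1) φ =
        sumInterior N n φ + ∑ k : Fin (N - 1), φ (N * n + (k + 1)) :=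
      Finset.sum_Ico_succ_top (Nat.zero_le n) _
    rw [h1, h2, show (n + 1) * N + 1 = n * N + 1 + (N - 1) + 1 by
      rw [Nat.succ_mul]; omega, Finset.sum_range_succ, Finset.sum_range_add, ih,
      show n * N + 1 + (N - 1) = N * (n + 1) by rw [Nat.mul_succ, mul_comm]; omega,
      Finset.sum_range]
    have h3 : ∑ k : Fin (N - 1), φ (n * N + 1 + k) = ∑ k : Fin (N - 1), φ (N * n + (k + 1)) :=
      Finset.sum_congr rfl fun k _ => by
        rw [show n * N + 1 + (k : ℕ) = N * n + (k + 1) by rw [mul_comm]; omega]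
    rw [h3]; ring

theorem sum_sumInterior {ι : Type*} (N n : ℕ) (s : Finset ι) (F : ι → ℕ → ℝ) :
    ∑ i ∈ s, sumInterior N n (F i) = sumInterior N n fun j => ∑ i ∈ s, F i j := by
  simp only [sumInterior]
  rw [Finset.sum_comm]
  exact Finset.sum_congr rfl fun e _ => Finset.sum_comm

theorem sumInterior_comm (N n n' : ℕ) (F : ℕ → ℕ → ℝ) :
    sumInterior N n (fun i => sumInterior N n' fun j => F i j) =
      sumInterior N n' fun j => sumInterior N n fun i => F i j := by
  rw [sumInterior, Finset.sum_congr rfl fun e _ => sum_sumInterior N n' _ _, sum_sumInterior]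
  rfl

theorem sumEnds_sumInterior_comm (N n n' : ℕ) (F : ℕ → ℕ → ℝ) :
    sumEnds N n (fun i => sumInterior N n' fun j => F i j) =
      sumInterior N n' fun j => sumEnds N n fun i => F i j :=
  sum_sumInterior N n' _ _

theorem sumInterior_le {N n : ℕ} {φ ψ : ℕ → ℝ}
    (h : ∀ e ∈ Finset.Ico 0 n, ∀ k : Fin (N - 1), φ (N * e + (k + 1)) ≤ ψ (N * e + (k + 1))) :
    sumInterior N n φ ≤ sumInterior N n ψ :=
  Finset.sum_le_sum fun e he => Finset.sum_le_sum fun k _ => h e he k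

theorem sumInterior_add (N n : ℕ) (φ ψ : ℕ → ℝ) :
    sumInterior N n (fun i => φ i + ψ i) = sumInterior N n φ + sumInterior N n ψ := by
  simp only [sumInterior, Finset.sum_add_distrib]

theorem sumEnds_add (N n : ℕ) (φ ψ : ℕ → ℝ) :
    sumEnds N n (fun i => φ i + ψ i) = sumEnds N n φ + sumEnds N n ψ := by
  simp only [sumEnds, Finset.sum_add_distrib]

theorem sumInterior_mul (N n : ℕ) (c : ℝ) (φ : ℕ → ℝ) :
    sumInterior N n (fun i => c * φ i) = c * sumInterior N n φ := by
  simp only [sumInterior, Finset.mul_sum]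

theorem sumInterior_nonneg {N n : ℕ} {φ : ℕ → ℝ} (h : ∀ i, 0 ≤ φ i) : 0 ≤ sumInterior N n φ :=
  Finset.sum_nonneg fun _ _ => Finset.sum_nonneg fun _ _ => h _

theorem sumEnds_nonneg {N n : ℕ} {φ : ℕ → ℝ} (h : ∀ i, 0 ≤ φ i) : 0 ≤ sumEnds N n φ :=
  Finset.sum_nonneg fun _ _ => h _

/-- A line of `n` squares has `n + 1` ends; the first carries the value zero, and the others are
right ends of squares. -/
theorem sumEnds_sq_le {N n : ℕ} {C : ℝ} (hC : EdgeBound N C) {ψ : ℕ → ℝ}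
    (hψ : ψ ∈ admissible N 0 n) :
    sumEnds N n (fun i => ψ i ^ 2) ≤ C * sumInterior N n fun i => ψ i ^ 2 := by
  refine le_trans ?_ (hC 0 n ψ (Nat.zero_le n) hψ)
  rw [sumEnds, Finset.sum_range_succ', hψ.1, zero_pow two_ne_zero, add_zero, Finset.range_eq_Ico]
  exact Finset.sum_le_sum fun e _ => le_add_of_nonneg_right (sq_nonneg _)

variable {N n₁ n₂ : ℕ} {ℓ h : ℝ}

/-- Sum of squares over the nodes interior to the squares. -/
def interiorSq (N n₁ n₂ : ℕ) (V : ℕ → ℕ → ℝ) : ℝ :=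
  sumInterior N n₁ fun i => sumInterior N n₂ fun j => V i j ^ 2

theorem interiorSq_eq (N n₁ n₂ : ℕ) (V : ℕ → ℕ → ℝ) : interiorSq N n₁ n₂ V =
    ∑ e₁ ∈ Finset.Ico 0 n₁, ∑ e₂ ∈ Finset.Ico 0 n₂, ∑ k, ∑ k', cell N V e₁ e₂ k k' ^ 2 := by
  simp only [interiorSq, sumInterior]
  exact Finset.sum_congr rfl fun _ _ => Finset.sum_comm

theorem sum_sq_eq (v : Grid (N + 1) n₁ n₂ → ℝ) : ∑ x, v x ^ 2 =
    ∑ i ∈ Finset.range (n₁ * N + 1), ∑ j ∈ Finset.range (n₂ * N + 1), val v i j ^ 2 := by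
  have h1 : ∑ i ∈ Finset.range (n₁ * N + 1), ∑ j ∈ Finset.range (n₂ * N + 1), val v i j ^ 2 =
      ∑ y : Fin (n₁ * N + 1) × Fin (n₂ * N + 1), val v y.1 y.2 ^ 2 := by
    rw [Fintype.sum_prod_type, Finset.sum_range]
    exact Finset.sum_congr rfl fun i _ => Finset.sum_range _
  rw [h1, ← Finset.sum_subset (Finset.subset_univ
    (Finset.univ.filter fun y : Fin (n₁ * N + 1) × Fin (n₂ * N + 1) =>
      ¬ (N ∣ (y.1 : ℕ) ∧ N ∣ (y.2 : ℕ))))]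
  · rw [Finset.sum_subtype (p := fun y : Fin (n₁ * N + 1) × Fin (n₂ * N + 1) =>
      ¬ (N ∣ (y.1 : ℕ) ∧ N ∣ (y.2 : ℕ))) _ (fun y => by simp)]
    exact Finset.sum_congr rfl fun x _ => by rw [← val_self v x]; rfl
  · intro y _ hy
    rw [Finset.mem_filter, not_and, not_not] at hy
    rw [val, dif_neg fun H => H.2 (hy (Finset.mem_univ y)), zero_pow two_ne_zero]

theorem sum_sq_split (hN : 1 ≤ N) (v : Grid (N + 1) n₁ n₂ → ℝ) : ∑ x, v x ^ 2 =
    (sumInterior N n₂ fun j => sumEnds N n₁ fun i => val v i j ^ 2) +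
      (sumInterior N n₁ fun i => sumEnds N n₂ fun j => val v i j ^ 2) +
      interiorSq N n₁ n₂ (val v) := by
  rw [sum_sq_eq, sum_range_eq hN]
  simp only [sum_range_eq hN]
  rw [sumEnds_add, sumInterior_add, sumEnds_sumInterior_comm, interiorSq]
  -- These index pairs are the corners, where `val` takes its default value 0.
  have : (sumEnds N n₁ fun i => sumEnds N n₂ fun j => val v i j ^ 2) = 0 := by
    refine Finset.sum_eq_zero fun e _ => Finset.sum_eq_zero fun e' _ => ?_
    change val v (N * e) (N * e') ^ 2 = 0
    rw [val, dif_neg fun H => H.2 ⟨Dvd.intro e rfl, Dvd.intro e' rfl⟩, zero_pow two_ne_zero]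
  rw [this]; ring

theorem interiorSq_le (hN : 1 ≤ N) (v : Grid (N + 1) n₁ n₂ → ℝ) :
    interiorSq N n₁ n₂ (val v) ≤ ∑ x, v x ^ 2 := by
  rw [sum_sq_split hN]
  have h1 : 0 ≤ sumInterior N n₂ fun j => sumEnds N n₁ fun i => val v i j ^ 2 :=
    sumInterior_nonneg fun _ => sumEnds_nonneg fun _ => sq_nonneg _
  have h2 : 0 ≤ sumInterior N n₁ fun i => sumEnds N n₂ fun j => val v i j ^ 2 :=
    sumInterior_nonneg fun _ => sumEnds_nonneg fun _ => sq_nonneg _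
  linarith

theorem sum_sq_le (hN : 1 ≤ N) {C : ℝ} (hC : EdgeBound N C) {v : Grid (N + 1) n₁ n₂ → ℝ}
    (hX : AdmissibleX N 0 n₁ 0 n₂ (val v)) (hY : AdmissibleX N 0 n₂ 0 n₁ fun j i => val v i j) :
    ∑ x, v x ^ 2 ≤ (1 + 2 * C) * interiorSq N n₁ n₂ (val v) := by
  rw [sum_sq_split hN]
  have h1 : (sumInterior N n₂ fun j => sumEnds N n₁ fun i => val v i j ^ 2) ≤
      C * interiorSq N n₁ n₂ (val v) := by
    rw [interiorSq, sumInterior_comm, ← sumInterior_mul]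
    exact sumInterior_le fun e he k => sumEnds_sq_le hC (hX e he k)
  have h2 : (sumInterior N n₁ fun i => sumEnds N n₂ fun j => val v i j ^ 2) ≤
      C * interiorSq N n₁ n₂ (val v) := by
    rw [interiorSq, ← sumInterior_mul]
    exact sumInterior_le fun e he k => sumEnds_sq_le hC (hY e he k)
  linarith

/-! ### The time-stepping matrix -/

theorem stepMatrix_mulVec (hℓ : 0 < ℓ) (hh : 0 < h) (τ : Tree 0 n₁ 0 n₂)
    (u : Grid (N + 1) n₁ n₂ → ℝ) : (stepMatrix (N + 1) ℓ h τ).mulVec u = solve ℓ h τ u 0 := by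
  have hS := (solve_spec (N := N) hℓ hh τ le_rfl le_rfl).2.linear
  have hA : IsLinearMap ℝ fun u : Grid (N + 1) n₁ n₂ → ℝ => solve ℓ h τ u 0 :=
    hS.comp LinearMap.id.isLinear (0 : (Grid (N + 1) n₁ n₂ → ℝ) →ₗ[ℝ] _).isLinear
  have h1 : stepMatrix (N + 1) ℓ h τ = LinearMap.toMatrix' (hA.mk' _) := by
    ext x y
    rw [LinearMap.toMatrix'_apply, stepMatrix, step, smul_zero, add_zero]
    rfl
  rw [h1, LinearMap.toMatrix'_mulVec]
  rfl

theorem step_eq (hℓ : 0 < ℓ) (hh : 0 < h) (τ : Tree 0 n₁ 0 n₂)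
    (f g u : Grid (N + 1) n₁ n₂ → ℝ) :
    step ℓ h τ f g u = (stepMatrix (N + 1) ℓ h τ).mulVec u + step ℓ h τ f g 0 := by
  have hS := (solve_spec (N := N) hℓ hh τ le_rfl le_rfl).2.linear
  rw [stepMatrix_mulVec hℓ hh, step, step, ← hS.map_add, zero_add, zero_add]

theorem exists_sum_sq_pow_le (N : ℕ) : ∃ K : ℝ, 0 ≤ K ∧ ∀ (n₁ n₂ : ℕ) (τ : Tree 0 n₁ 0 n₂)
    (ℓ h : ℝ), 0 < ℓ → 0 < h → ∀ (k : ℕ) (u : Grid (N + 1) n₁ n₂ → ℝ),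
      ∑ x, (stepMatrix (N + 1) ℓ h τ ^ k).mulVec u x ^ 2 ≤ K * ∑ x, u x ^ 2 := by
  rcases Nat.lt_or_ge N 2 with hN | hN
  · refine ⟨0, le_rfl, fun n₁ n₂ τ ℓ h hℓ hh k u => ?_⟩
    have := isEmpty_grid (n₁ := n₁) (n₂ := n₂) hN
    simp
  have hN1 : 1 ≤ N := by omega
  obtain ⟨m, L, R, hR, hL⟩ := exists_rows_nodal hN
  obtain ⟨C₁, hC₁, hE⟩ := exists_edgeBound hN
  obtain ⟨C₂, hC₂, hlow⟩ := exists_le_coef hR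
  obtain ⟨C₃, hC₃, hup⟩ := exists_coef_le L
  -- The 1 serves `k = 0`: the edge values of arbitrary `u` are not controlled by its energy. For `k
  -- ≥ 1` the vector lies in the range of the step, where slopes match and `C₁` bounds the edge
  -- values; `C₂` and `C₃` compare the energy with the interior sum of squares.
  refine ⟨1 + (1 + 2 * C₁) * (C₂ * C₃), by positivity, fun n₁ n₂ τ ℓ h hℓ hh k u => ?_⟩
  set M := stepMatrix (N + 1) ℓ h τ with hM
  have hspec := (solve_spec (N := N) hℓ hh τ le_rfl le_rfl).2
  have hsol : ∀ w : Grid (N + 1) n₁ n₂ → ℝ, Solves ℓ h 0 n₁ 0 n₂ w (M.mulVec w) ∧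
      ∀ x, Closed 0 n₁ 0 n₂ x → ¬ Inside 0 n₁ 0 n₂ x → M.mulVec w x = 0 := by
    intro w
    rw [hM, stepMatrix_mulVec hℓ hh]
    exact ⟨hspec.solves w 0, fun x _ hx => hspec.outside w 0 x hx⟩
  have hX : ∀ w, AdmissibleX N 0 n₁ 0 n₂ (val (M.mulVec w)) := fun w =>
    (hsol w).1.admissibleX hℓ (Nat.zero_le _) le_rfl le_rfl (hsol w).2
  have hY : ∀ w, AdmissibleX N 0 n₂ 0 n₁ fun j i => val (M.mulVec w) i j := fun w =>
    (hsol w).1.admissibleY hℓ (Nat.zero_le _) le_rfl le_rfl (hsol w).2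
  have hen : ∀ w, energy L 0 n₁ 0 n₂ (val (M.mulVec w)) ≤ energy L 0 n₁ 0 n₂ (val w) := fun w =>
    energy_le (Nat.zero_le _) (Nat.zero_le _) hL (by positivity) (hX w) (hY w)
      ((hsol w).1.cell_eq le_rfl le_rfl)
  have hpow : ∀ k, energy L 0 n₁ 0 n₂ (val ((M ^ k).mulVec u)) ≤ energy L 0 n₁ 0 n₂ (val u) := by
    intro k
    induction k with
    | zero => rw [pow_zero, Matrix.one_mulVec]
    | succ k ih =>
      rw [pow_succ', ← Matrix.mulVec_mulVec]
      exact (hen _).trans ih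
  have hu0 : 0 ≤ ∑ x, u x ^ 2 := Finset.sum_nonneg fun _ _ => sq_nonneg _
  cases k with
  | zero =>
    rw [pow_zero, Matrix.one_mulVec]
    exact le_mul_of_one_le_left hu0 (by linarith [show 0 ≤ (1 + 2 * C₁) * (C₂ * C₃) by positivity])
  | succ k =>
    have hlow' : ∀ V, interiorSq N n₁ n₂ V ≤ C₂ * energy L 0 n₁ 0 n₂ V := by
      intro V
      rw [interiorSq_eq, energy, Finset.mul_sum]
      refine Finset.sum_le_sum fun e₁ _ => ?_
      rw [Finset.mul_sum]
      exact Finset.sum_le_sum fun e₂ _ => hlow _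
    have hup' : ∀ V, energy L 0 n₁ 0 n₂ V ≤ C₃ * interiorSq N n₁ n₂ V := by
      intro V
      rw [interiorSq_eq, energy, Finset.mul_sum]
      refine Finset.sum_le_sum fun e₁ _ => ?_
      rw [Finset.mul_sum]
      exact Finset.sum_le_sum fun e₂ _ => hup _
    have h1 : ∑ x, (M ^ (k + 1)).mulVec u x ^ 2 ≤
        (1 + 2 * C₁) * interiorSq N n₁ n₂ (val ((M ^ (k + 1)).mulVec u)) := by
      rw [pow_succ', ← Matrix.mulVec_mulVec]
      exact sum_sq_le hN1 hE (hX _) (hY _)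
    have h2 : interiorSq N n₁ n₂ (val ((M ^ (k + 1)).mulVec u)) ≤ C₂ * (C₃ * ∑ x, u x ^ 2) :=
      (hlow' _).trans (mul_le_mul_of_nonneg_left ((hpow _).trans ((hup' _).trans
        (mul_le_mul_of_nonneg_left (interiorSq_le hN1 u) hC₃))) hC₂)
    calc _ ≤ (1 + 2 * C₁) * (C₂ * (C₃ * ∑ x, u x ^ 2)) :=
          h1.trans (mul_le_mul_of_nonneg_left h2 (by positivity))
      _ = (1 + 2 * C₁) * (C₂ * C₃) * ∑ x, u x ^ 2 := by ring
      _ ≤ _ := mul_le_mul_of_nonneg_right (by linarith) hu0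

/-! ### Spectral radius and operator norm -/

theorem norm_toEuclideanCLM_le {ι : Type*} [Fintype ι] [DecidableEq ι] {A : Matrix ι ι ℝ} {K : ℝ}
    (hA : ∀ u, ∑ x, A.mulVec u x ^ 2 ≤ K * ∑ x, u x ^ 2) :
    ‖Matrix.toEuclideanCLM (𝕜 := ℝ) A‖ ≤ √K := by
  refine ContinuousLinearMap.opNorm_le_bound _ (Real.sqrt_nonneg K) fun u => ?_
  rw [EuclideanSpace.norm_eq, EuclideanSpace.norm_eq, ← Real.sqrt_mul' _
    (Finset.sum_nonneg fun _ _ => sq_nonneg _)]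
  apply Real.sqrt_le_sqrt
  simp only [Real.norm_eq_abs, sq_abs]
  simpa using hA u.ofLp

/-- The entries of all powers are bounded by √K, so a complex eigenvector cannot grow geometrically.
-/
theorem norm_eigenvalue_le_one {ι : Type*} [Fintype ι] [DecidableEq ι] {A : Matrix ι ι ℝ} {K : ℝ}
    (hA : ∀ (k : ℕ) (u : ι → ℝ), ∑ x, (A ^ k).mulVec u x ^ 2 ≤ K * ∑ x, u x ^ 2) {μ : ℂ}
    (hμ : Module.End.HasEigenvalue (Matrix.toLin' (A.map (algebraMap ℝ ℂ))) μ) : ‖μ‖ ≤ 1 := by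
  obtain ⟨z, hz⟩ := hμ.exists_hasEigenvector
  have hentry : ∀ k x y, |(A ^ k) x y| ≤ √K := by
    intro k x y
    have h1 := hA k (Pi.single y 1)
    rw [Matrix.mulVec_single_one] at h1
    have h2 : ∑ x : ι, (Pi.single y (1 : ℝ) : ι → ℝ) x ^ 2 = 1 := by
      rw [Finset.sum_eq_single y (fun x _ hx => by simp [hx]) (by simp)]; simp
    rw [h2, mul_one] at h1
    apply Real.abs_le_sqrt
    exact (Finset.single_le_sum (f := fun x => (A ^ k) x y ^ 2) (fun _ _ => sq_nonneg _)
      (Finset.mem_univ x)).trans h1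
  have hpow : ∀ k : ℕ, ((A ^ k).map (algebraMap ℝ ℂ)).mulVec z = μ ^ k • z := by
    intro k
    induction k with
    | zero => simp [Matrix.map_one]
    | succ k ih =>
      have h1 : (A.map (algebraMap ℝ ℂ)).mulVec z = μ • z := hz.apply_eq_smul
      rw [pow_succ', Matrix.map_mul, ← Matrix.mulVec_mulVec, ih, Matrix.mulVec_smul, h1, smul_smul,
        pow_succ]
  obtain ⟨x, hx⟩ := Function.ne_iff.1 hz.2
  have hbound : ∀ k : ℕ, ‖μ‖ ^ k * ‖z x‖ ≤ √K * ∑ y, ‖z y‖ := by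
    intro k
    have h1 := congrFun (hpow k) x
    rw [Pi.smul_apply, smul_eq_mul] at h1
    rw [← norm_pow, ← norm_mul, ← h1, Matrix.mulVec, dotProduct, Finset.mul_sum]
    refine (norm_sum_le _ _).trans (Finset.sum_le_sum fun y _ => ?_)
    rw [norm_mul, Matrix.map_apply]
    refine mul_le_mul_of_nonneg_right ?_ (norm_nonneg _)
    simpa using hentry k x y
  by_contra! hgt
  have hx0 : 0 < ‖z x‖ := norm_pos_iff.2 hx
  obtain ⟨k, hk⟩ := pow_unbounded_of_one_lt ((√K * ∑ y, ‖z y‖) / ‖z x‖) hgt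
  rw [div_lt_iff₀ hx0] at hk
  exact absurd (hbound k) (not_le.2 hk)

end

end HPS

end
theorem mainTheorem1 (p : ℕ) (hp : 2 ≤ p) :
    (∀ (n₁ n₂ : ℕ) (τ : HPS.Tree 0 n₁ 0 n₂) (ℓ h : ℝ), 0 < ℓ → 0 < h →
      HPS.WellDefined p n₁ n₂ ℓ h τ ∧
      (∀ f g u : HPS.Grid p n₁ n₂ → ℝ,
        HPS.step ℓ h τ f g u =
          (HPS.stepMatrix p ℓ h τ).mulVec u + HPS.step ℓ h τ f g 0) ∧
      ∀ μ : ℂ,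
        Module.End.HasEigenvalue
          (Matrix.toLin' ((HPS.stepMatrix p ℓ h τ).map (algebraMap ℝ ℂ))) μ → ‖μ‖ ≤ 1) ∧
    ∃ C : ℝ, ∀ (n₁ n₂ : ℕ) (τ : HPS.Tree 0 n₁ 0 n₂) (ℓ h : ℝ), 0 < ℓ → 0 < h → ∀ k : ℕ,
      ‖Matrix.toEuclideanCLM (𝕜 := ℝ) (HPS.stepMatrix p ℓ h τ ^ k)‖ ≤ C := by
  obtain ⟨N, rfl⟩ : ∃ N, p = N + 1 := ⟨p - 1, by omega⟩
  obtain ⟨K, -, hK⟩ := HPS.exists_sum_sq_pow_le N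
  exact ⟨fun n₁ n₂ τ ℓ h hℓ hh => ⟨(HPS.solve_spec hℓ hh τ le_rfl le_rfl).1,
    HPS.step_eq hℓ hh τ, fun μ hμ => HPS.norm_eigenvalue_le_one (hK n₁ n₂ τ ℓ h hℓ hh) hμ⟩,
    √K, fun n₁ n₂ τ ℓ h hℓ hh k => HPS.norm_toEuclideanCLM_le (hK n₁ n₂ τ ℓ h hℓ hh k)⟩
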